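/- **Theorem 1.5 (Extremal Case).** For $k\ge 2$, a $k$-graph $\mathcal H$ consists of a finite vertex set $V$ and a set of edges, each of which is a $k$-element subset of $V$. For a set $S\subseteq V$ let $\deg(S)$ be the number of edges containing $S$, let $\delta_{k-1}(\mathcal H)$ be the minimum of $\deg(S)$ over all $(k-1)$-element sets $S\subseteq V$, and for $B\subseteq V$ let $e(B)$ be the number of edges contained in $B$. For $1\le \ell<k$, a $k$-graph is an $\ell$-cycle if its vertices can be ordered cyclically such that each of its edges consists of $k$ consecutive vertices, each edge starts $k-\ell$ positions after the previous one all the way round the cyclic order, and every two consecutive edges (including the last and the first) share exactly $\ell$ vertices; so an $\ell$-cycle on $n$ vertices has $n/(k-\ell)$ edges. A $k$-graph $\mathcal H$ contains a Hamilton $\ell$-cycle if some subset of its edges forms an $\ell$-cycle on the whole vertex set $V$. For all integers $k\ge 3$ and $1\le \ell<k/2$ there exist a real number $\Delta>0$ and an integer $n_0$ such that the following holds. Let $\mathcal H$ be a $k$-graph on $n\ge n_0$ vertices, where $k-\ell$ divides $n$. Suppose that $\mathcal H$ is $\Delta$-extremal, that is, there is a set $B\subseteq V$ with $$|B|=\left\lfloor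 \frac{2(k-\ell)-1}{2(k-\ell)}\,n\right\rfloor \quad\text{and}\quad e(B)\le \Delta n^k,$$ and that $$\delta_{k-1}(\mathcal H)\ \ge\ \frac{n}{2(k-\ell)}.$$ Then $\mathcal H$ contains a Hamilton $\ell$-cycle. -/

import Mathlib

/-- A `k`-graph (`k`-uniform hypergraph) with vertex set `V`: a family of `k`-element subsets
of `V`, called edges. -/
structure KGraph (V : Type*) (k : ℕ) where
  /-- The set of edges. -/
  edges : Finset (Finset V)
  /-- Every edge has exactly `k` vertices. -/
  card_eq : ∀ e ∈ edges, e.card = k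

namespace KGraph

/-- `deg(S)`: the number of edges containing the vertex set `S`. -/
def degree {V : Type*} [DecidableEq V] {k : ℕ} (H : KGraph V k) (S : Finset V) : ℕ :=
  (H.edges.filter (fun e => S ⊆ e)).card

/-- The minimum `d`-degree `δ_d(H)`: the minimum of `deg(S)` over all sets `S` of `d` vertices.
(It is `0` by convention if there are fewer than `d` vertices.) -/
noncomputable def minDegree {V : Type*} [DecidableEq V] {k : ℕ} (H : KGraph V k) (d : ℕ) : ℕ :=
  sInf {m : ℕ | ∃ S : Finset V, S.card = d ∧ H.degree S = m}

/-- `e(B)`: the number of edges contained in the vertex set `B`. -/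
def edgesIn {V : Type*} [DecidableEq V] {k : ℕ} (H : KGraph V k) (B : Finset V) : ℕ :=
  (H.edges.filter (fun e => e ⊆ B)).card

/-- `H`, with `n` vertices, is `Δ`-extremal (with respect to `ℓ < k`): there is a vertex set `B`
with `|B| = ⌊(2(k-ℓ)-1) n / (2(k-ℓ))⌋` and `e(B) ≤ Δ n^k`. The division is that of natural
numbers, which rounds down. -/
def IsExtremal {V : Type*} [Fintype V] [DecidableEq V] {k : ℕ} (H : KGraph V k) (ℓ : ℕ) (Δ : ℝ) :
    Prop :=
  ∃ B : Finset V,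
    B.card = (2 * (k - ℓ) - 1) * Fintype.card V / (2 * (k - ℓ)) ∧
    (H.edgesIn B : ℝ) ≤ Δ * (Fintype.card V : ℝ) ^ k

/-- For a cyclic ordering `σ` of `V`, the set of the `k` consecutive vertices that starts at
position `s`; positions are read modulo the number `n` of vertices. -/
def segment {V : Type*} [DecidableEq V] {n : ℕ} (σ : ZMod n ≃ V) (k s : ℕ) : Finset V :=
  (Finset.range k).image (fun j => σ ((s + j : ℕ) : ZMod n))

/-- The `k`-graph `C` with vertex set `V` is an `ℓ`-cycle: for some cyclic ordering of its `n`
vertices, its edges are segments of `k` consecutive vertices, each edge starting `k - ℓ` positions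
after the previous one all the way round (so that there are `n / (k - ℓ)` of them), and any two
consecutive edges, the last and the first included, share exactly `ℓ` vertices. -/
def IsCycle {V : Type*} [Fintype V] [DecidableEq V] {k : ℕ} (C : KGraph V k) (ℓ : ℕ) : Prop :=
  (k - ℓ) ∣ Fintype.card V ∧
  ∃ σ : ZMod (Fintype.card V) ≃ V,
    C.edges = (Finset.range (Fintype.card V / (k - ℓ))).image
      (fun i => segment σ k (i * (k - ℓ))) ∧
    ∀ i < Fintype.card V / (k - ℓ),
      (segment σ k (i * (k - ℓ)) ∩ segment σ k ((i + 1) * (k - ℓ))).card = ℓ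

/-- `H` contains a Hamilton `ℓ`-cycle: an `ℓ`-cycle on all of `V` whose edges are edges of `H`. -/
def HasHamiltonCycle {V : Type*} [Fintype V] [DecidableEq V] {k : ℕ} (H : KGraph V k) (ℓ : ℕ) :
    Prop :=
  ∃ C : KGraph V k, C.edges ⊆ H.edges ∧ C.IsCycle ℓ

end KGraph

/-! Put `r = k - ℓ` and let `n` be the number of vertices. As `2 * ℓ < k`, a vertex lies in at most
two edges of an `ℓ`-cycle, and a Hamilton cycle has `n / r` edges. The complement of `B` has about
`n / (2r)` vertices, so a cycle all of whose edges meet this complement must place almost every such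
vertex in the overlap of two consecutive edges. The proof builds such a cycle: the vertices outside
`B` act as hubs, each joining two edges whose other vertices are ordinary.

The codegree condition gives every `(k-1)`-set at least `n / (2r)` neighbours. For most sets inside
`B` few of these lie in `B`, so almost all vertices outside `B` are neighbours.
`exists_hubPartition` reclassifies the vertices by degree into hubs `G`, partial hubs `W` and
ordinary vertices `Y`, after which suitable degree bounds hold for every single vertex of each
class.

The number of hubs is only approximately right, and partial hubs cannot be used freely.
`exists_special_pieces` constructs a few short disjoint paths with typical ends. They contain all of
`W`, and they correct the count: missing hubs are compensated by edges inside `Y`, which the exact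
codegree bound provides, and surplus hubs are used in one edge only. Together with zero-edge pieces,
which are single `ℓ`-tuples of `Y`, this gives exactly as many pieces as free hubs, and the
remaining vertices of `Y` exactly fill the gaps between the pieces.

All gaps are closed at once. Assigning to each gap a hub and the vertices of the two edges through
it is a perfect matching problem in an almost complete multipartite hypergraph, solved by a
switching argument in `exists_perms_avoiding`. This needs every vertex, not merely the average one,
to be in few bad combinations; so the zero-edge pieces must be spread evenly with respect to every
hub and every ordinary vertex. `exists_spread_family` arranges this by choosing them one at a time
with multiplicative weights. -/

namespace KGraph

open Finset

/-! ### Counting tuples. -/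

section Counting

/-- The number of elements of a finite type with a given property. -/
noncomputable def count {α : Type*} (P : α → Prop) : ℕ := Nat.card {x // P x}

theorem count_eq_card {α : Type*} [Fintype α] (P : α → Prop) [DecidablePred P] :
    count P = #{x | P x} := by
  rw [count, Nat.card_eq_fintype_card, Fintype.card_subtype]

theorem count_le_of_injOn {α β : Type*} [Finite β] {P : α → Prop} {Q : β → Prop}
    (f : α → β) (hf : ∀ x, P x → Q (f x)) (hinj : ∀ x y, P x → P y → f x = f y → x = y) :
    count P ≤ count Q :=
  Nat.card_le_card_of_injective (fun x : {x // P x} => (⟨f x.1, hf _ x.2⟩ : {x // Q x}))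
    fun x y h => Subtype.ext (hinj _ _ x.2 y.2 (congrArg Subtype.val h))

theorem count_mono {α : Type*} [Finite α] {P Q : α → Prop} (h : ∀ x, P x → Q x) :
    count P ≤ count Q :=
  count_le_of_injOn id h fun _ _ _ _ h => h

theorem count_or_le {α : Type*} [Finite α] (P Q : α → Prop) :
    count (fun x => P x ∨ Q x) ≤ count P + count Q := by
  classical
  have := Fintype.ofFinite α
  rw [count_eq_card, count_eq_card, count_eq_card, filter_or]
  exact card_union_le _ _

theorem count_exists_le {α β : Type*} [Finite α] (s : Finset β) (P : β → α → Prop) :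
    count (fun x => ∃ b ∈ s, P b x) ≤ ∑ b ∈ s, count (P b) := by
  classical
  have := Fintype.ofFinite α
  simp only [count_eq_card]
  refine (Finset.card_le_card (t := s.biUnion (fun b => {x | P b x})) ?_).trans card_biUnion_le
  intro x hx
  simpa using hx

theorem count_true (α : Type*) [Fintype α] : count (fun _ : α => True) = Fintype.card α := by
  classical
  simp [count_eq_card]

theorem count_le_card {α : Type*} [Fintype α] (P : α → Prop) : count P ≤ Fintype.card α :=
  (count_mono fun _ _ => trivial).trans (count_true α).le

theorem count_mem {α : Type*} (s : Finset α) : count (fun x => x ∈ s) = #s := by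
  simp [count]

theorem count_prod {α β : Type*} [Fintype α] [Finite β] (P : α × β → Prop) :
    count P = ∑ a, count (fun b => P (a, b)) := by
  classical
  have := Fintype.ofFinite β
  simp only [count_eq_card, card_filter]
  rw [Fintype.sum_prod_type]

theorem exists_of_count_lt {α : Type*} [Finite α] {P Q : α → Prop} (h : count Q < count P) :
    ∃ x, P x ∧ ¬ Q x := by
  by_contra! hcon
  exact absurd (count_mono hcon) (not_le.mpr h)

variable {I J α : Type*} [Fintype I] [Fintype J] [Fintype α]

/-- Tuples whose restriction along an injection of index types lies in a given family. -/
theorem count_comp_le (e : J → I) (he : Function.Injective e) (P : (J → α) → Prop) :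
    count (fun f : I → α => P (f ∘ e)) ≤
      count P * Fintype.card α ^ (Fintype.card I - Fintype.card J) := by
  classical
  have hc : Fintype.card {i : I // i ∉ Set.range e} = Fintype.card I - Fintype.card J := by
    rw [Fintype.card_subtype_compl]
    congr 1
    exact (Fintype.card_congr (Equiv.ofInjective e he)).symm
  rw [← hc, ← Fintype.card_fun, ← count_true]
  have : count P * count (fun _ : {i : I // i ∉ Set.range e} → α => True) =
      count (fun p : (J → α) × ({i : I // i ∉ Set.range e} → α) => P p.1) := by
    simp only [count_eq_card]
    rw [← card_product]
    congr 1
    ext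
    simp
  rw [this]
  refine count_le_of_injOn (fun f => (f ∘ e, fun i => f i.1)) (fun _ h => h) ?_
  intro f g _ _ h
  simp only [Prod.mk.injEq] at h
  funext i
  by_cases hi : i ∈ Set.range e
  · obtain ⟨j, rfl⟩ := hi
    exact congrFun h.1 j
  · exact congrFun h.2 ⟨i, hi⟩

theorem count_apply_mem_le (q : I) (S : Finset α) :
    count (fun f : I → α => f q ∈ S) ≤ #S * Fintype.card α ^ (Fintype.card I - 1) := by
  have := count_comp_le (α := α) (fun _ : Unit => q) (fun _ _ _ => rfl) (fun g => g () ∈ S)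
  refine this.trans ?_
  rw [Fintype.card_unit, ← count_mem]
  refine Nat.mul_le_mul_right _ ?_
  refine count_le_of_injOn (fun g => g ()) (fun _ h => h) ?_
  intro g h _ _ hgh
  funext x
  exact hgh

theorem count_apply_eq (q : I) (a : α) :
    count (fun f : I → α => f q = a) = Fintype.card α ^ (Fintype.card I - 1) := by
  classical
  have h1 : count (fun f : I → α => f q = a) ≤ Fintype.card α ^ (Fintype.card I - 1) := by
    simpa using count_apply_mem_le q {a}
  refine le_antisymm h1 ?_
  have hI : Fintype.card {i : I // i ≠ q} = Fintype.card I - 1 := by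
    simp [Fintype.card_subtype_compl]
  rw [← hI, ← Fintype.card_fun, ← count_true]
  refine count_le_of_injOn
    (fun g i => if h : i = q then a else g ⟨i, h⟩) (fun _ _ => by simp) ?_
  intro g g' _ _ h
  funext i
  have := congrFun h i.1
  simpa [i.2] using this

/-- Non-injective tuples with a prescribed entry. -/
theorem count_not_injective_apply_eq_le (q : I) (a : α) :
    count (fun f : I → α => f q = a ∧ ¬ Function.Injective f) ≤
      Fintype.card I ^ 2 * Fintype.card α ^ (Fintype.card I - 2) := by
  classical
  -- Of two colliding indices one differs from `q`. With that one as `p.1`, both `f q` and `f p.1`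
  -- are determined by `a` and the other entries, which leaves `Fintype.card I - 2` free choices.
  have hsub : count (fun f : I → α => f q = a ∧ ¬ Function.Injective f) ≤
      count (fun f : I → α => ∃ p ∈ ({p : I × I | p.1 ≠ p.2 ∧ p.1 ≠ q} : Finset (I × I)),
        f q = a ∧ f p.1 = f p.2) := by
    refine count_mono fun f hf => ?_
    simp only [Function.Injective, not_forall] at hf
    obtain ⟨hq, x, y, hxy, hne⟩ := hf
    simp only [mem_filter, mem_univ, true_and, Prod.exists]
    by_cases hx : x = q
    · exact ⟨y, x, ⟨fun h => hne h.symm, fun h => hne (hx.trans h.symm)⟩, hq, hxy.symm⟩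
    · exact ⟨x, y, ⟨hne, hx⟩, hq, hxy⟩
  refine hsub.trans ((count_exists_le _ _).trans ?_)
  refine (sum_le_card_nsmul _ _ (Fintype.card α ^ (Fintype.card I - 2)) ?_).trans ?_
  · rintro ⟨x, y⟩ hp
    simp only [mem_filter, mem_univ, true_and] at hp
    have hc : Fintype.card {i : I // ¬ (i = x ∨ i = q)} = Fintype.card I - 2 := by
      rw [Fintype.card_subtype_compl]
      congr 1
      rw [Fintype.card_subtype]
      have : ({i | i = x ∨ i = q} : Finset I) = {x, q} := by ext; simp
      rw [this, card_pair hp.2]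
    rw [← hc, ← Fintype.card_fun, ← count_true]
    refine count_le_of_injOn (fun f i => f i.1) (fun _ _ => trivial) ?_
    intro f g hf hg h
    have key : ∀ i, i ≠ x → f i = g i := by
      intro i hi
      by_cases hiq : i = q
      · rw [hiq, hf.1, hg.1]
      · exact congrFun h ⟨i, by tauto⟩
    funext i
    by_cases hi : i = x
    · rw [hi, hf.2, hg.2]
      exact key y (fun h => hp.1 h.symm)
    · exact key i hi
  · rw [smul_eq_mul]
    refine Nat.mul_le_mul_right _ ?_
    refine (card_le_univ _).trans ?_
    simp [sq]

/-- Small degrees of a family of tuples are inherited by its pull-back along an injection of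
index types. -/
theorem degree_comp_le [Nonempty J] (e : J → I) (he : Function.Injective e)
    (P : (J → α) → Prop) (η : ℝ)
    (hP : ∀ j a, (count (fun g : J → α => g j = a ∧ P g) : ℝ) ≤
      η * (Fintype.card α : ℝ) ^ (Fintype.card J - 1)) (i : I) (a : α) :
    (count (fun f : I → α => f i = a ∧ P (f ∘ e)) : ℝ) ≤
      η * (Fintype.card α : ℝ) ^ (Fintype.card I - 1) := by
  have hJI : Fintype.card J ≤ Fintype.card I := Fintype.card_le_of_injective e he
  have hJ : 0 < Fintype.card J := Fintype.card_pos
  by_cases hi : ∃ j, e j = i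
  · obtain ⟨j, rfl⟩ := hi
    have h1 := count_comp_le e he (fun g => g j = a ∧ P g)
    calc (count (fun f : I → α => f (e j) = a ∧ P (f ∘ e)) : ℝ)
        ≤ count (fun g => g j = a ∧ P g) *
            (Fintype.card α : ℝ) ^ (Fintype.card I - Fintype.card J) := by exact_mod_cast h1
      _ ≤ η * (Fintype.card α : ℝ) ^ (Fintype.card J - 1) *
            (Fintype.card α : ℝ) ^ (Fintype.card I - Fintype.card J) := by
          gcongr; exact hP j a
      _ = _ := by rw [mul_assoc, ← pow_add]; congr 2; omega
  -- The fixed entry is invisible to `P` here, so the total count of `P` replaces a degree; summing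
  -- the degrees at one index of `J` bounds it. `Option J` adjoins the fixed coordinate to those of
  -- `J`.
  · have hi' : ∀ j, e j ≠ i := by simpa using hi
    let e' : Option J → I := fun o => o.elim i e
    have he' : Function.Injective e' := by
      rintro (_ | x) (_ | y) h
      · rfl
      · exact absurd h.symm (hi' y)
      · exact absurd h (hi' x)
      · exact congrArg some (he h)
    have h1 := count_comp_le (α := α) e' he'
      (fun g => g none = a ∧ P (fun j => g (some j)))
    have h2 : count (fun g : Option J → α => g none = a ∧ P (fun j => g (some j))) ≤
        count P := by
      refine count_le_of_injOn (fun g j => g (some j)) (fun _ h => h.2) ?_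
      intro g g' hg hg' h
      funext o
      rcases o with _ | j
      · rw [hg.1, hg'.1]
      · exact congrFun h j
    have h3 : (count P : ℝ) ≤ η * (Fintype.card α : ℝ) ^ Fintype.card J := by
      obtain ⟨j⟩ := ‹Nonempty J›
      have : count P ≤ ∑ b : α, count (fun g : J → α => g j = b ∧ P g) :=
        (count_mono (Q := fun g => ∃ b ∈ univ, g j = b ∧ P g)
          fun g hg => ⟨g j, mem_univ _, rfl, hg⟩).trans (count_exists_le _ _)
      calc (count P : ℝ) ≤ ∑ b : α, (count (fun g : J → α => g j = b ∧ P g) : ℝ) := by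
            exact_mod_cast this
        _ ≤ ∑ b : α, η * (Fintype.card α : ℝ) ^ (Fintype.card J - 1) :=
            sum_le_sum fun b _ => hP j b
        _ = η * ((Fintype.card α : ℝ) ^ (Fintype.card J - 1) * Fintype.card α) := by
            rw [sum_const, card_univ, nsmul_eq_mul]; ring
        _ = _ := by rw [← pow_succ, Nat.sub_add_cancel hJ]
    have h4 : Fintype.card J + 1 ≤ Fintype.card I := by
      simpa using Fintype.card_le_of_injective e' he'
    calc (count (fun f : I → α => f i = a ∧ P (f ∘ e)) : ℝ)
        ≤ count (fun g : Option J → α => g none = a ∧ P (fun j => g (some j))) *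
            (Fintype.card α : ℝ) ^ (Fintype.card I - (Fintype.card J + 1)) := by
          rw [Fintype.card_option] at h1
          exact_mod_cast h1
      _ ≤ η * (Fintype.card α : ℝ) ^ Fintype.card J *
            (Fintype.card α : ℝ) ^ (Fintype.card I - (Fintype.card J + 1)) := by
          gcongr
          refine le_trans ?_ h3
          exact_mod_cast h2
      _ = _ := by rw [mul_assoc, ← pow_add]; congr 2; omega

end Counting

/-! ### Perfect matchings in almost complete multipartite hypergraphs. -/

section Matching

/-- A multipartite hypergraph on parts of size `N` in which every vertex misses only few edges has
a perfect matching. -/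
theorem exists_perms_avoiding {ι : Type*} [Fintype ι] [Nonempty ι] {N : ℕ}
    (hN : 0 < N) (bad : (ι → Fin N) → Prop) (η : ℝ)
    (hdeg : ∀ p a, (count (fun f : ι → Fin N => f p = a ∧ bad f) : ℝ) ≤
      η * (N : ℝ) ^ (Fintype.card ι - 1))
    (hι : 2 ≤ Fintype.card ι)
    (hη : Fintype.card ι * η + (Fintype.card ι : ℝ) ^ 2 / N < 1) :
    ∃ π : ι → Equiv.Perm (Fin N), ∀ i, ¬ bad (fun p => π p i) := by
  classical
  have : NeZero (Fintype.card ι) := ⟨Fintype.card_ne_zero⟩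
  -- The group law only serves to write down a switching: `u` selects one row for each element of
  -- `ι`, and the new row `u j` takes its entry in part `p` from the old row `u (j + p)`.
  let _ : AddCommGroup ι := (Fintype.equivFin ι).addCommGroup
  obtain ⟨π, hπ⟩ := Finite.exists_min
    (fun π : ι → Equiv.Perm (Fin N) => #{i | bad (fun p => π p i)})
  refine ⟨π, fun i₀ hi₀ => ?_⟩
  -- A union bound over all `u` with `u 0 = i₀`. The new row `u j` has the prescribed entry `π (-j)
  -- i₀` in part `-j`, so the degree hypothesis limits its failures; `hη` says that these failures
  -- and the non-injective `u` do not exhaust all choices.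
  have key : ∃ u : ι → Fin N, u 0 = i₀ ∧ Function.Injective u ∧
      ∀ j, ¬ bad (fun p => π p (u (j + p))) := by
    by_contra hcon
    push Not at hcon
    have h1 : count (fun u : ι → Fin N => u 0 = i₀) ≤
        count (fun u : ι → Fin N => u 0 = i₀ ∧ ¬ Function.Injective u) +
          ∑ j : ι, count (fun u : ι → Fin N => u 0 = i₀ ∧ bad (fun p => π p (u (j + p)))) := by
      refine (count_mono ?_).trans ((count_or_le _ _).trans
        (Nat.add_le_add_left (count_exists_le univ _) _))
      intro u hu
      by_cases hinj : Function.Injective u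
      · obtain ⟨j, hj⟩ := hcon u hu hinj
        exact Or.inr ⟨j, mem_univ _, hu, hj⟩
      · exact Or.inl ⟨hu, hinj⟩
    rw [count_apply_eq, Fintype.card_fin] at h1
    have h2 := count_not_injective_apply_eq_le (0 : ι) i₀
    rw [Fintype.card_fin] at h2
    have h3 : ∀ j : ι,
        (count (fun u : ι → Fin N => u 0 = i₀ ∧ bad (fun p => π p (u (j + p)))) : ℝ) ≤
        η * (N : ℝ) ^ (Fintype.card ι - 1) := by
      intro j
      refine le_trans ?_ (hdeg (-j) (π (-j) i₀))
      norm_cast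
      refine count_le_of_injOn (fun u p => π p (u (j + p))) ?_ ?_
      · intro u hu
        refine ⟨?_, hu.2⟩
        change π (-j) (u (j + -j)) = _
        rw [add_neg_cancel, hu.1]
      · intro u u' _ _ h
        funext q
        have := congrFun h (-j + q)
        simp only [EmbeddingLike.apply_eq_iff_eq] at this
        simpa using this
    have h4 : (N : ℝ) ^ (Fintype.card ι - 1) ≤
        (Fintype.card ι : ℝ) ^ 2 * (N : ℝ) ^ (Fintype.card ι - 2) +
          Fintype.card ι * (η * (N : ℝ) ^ (Fintype.card ι - 1)) := by
      calc (N : ℝ) ^ (Fintype.card ι - 1) ≤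
          count (fun u : ι → Fin N => u 0 = i₀ ∧ ¬ Function.Injective u) + ∑ j : ι,
            (count (fun u : ι → Fin N => u 0 = i₀ ∧ bad (fun p => π p (u (j + p)))) : ℝ) := by
            exact_mod_cast h1
        _ ≤ (Fintype.card ι : ℝ) ^ 2 * (N : ℝ) ^ (Fintype.card ι - 2) +
            ∑ j : ι, η * (N : ℝ) ^ (Fintype.card ι - 1) := by
            refine add_le_add ?_ (sum_le_sum fun j _ => h3 j)
            exact_mod_cast h2
        _ = _ := by rw [sum_const, card_univ, nsmul_eq_mul]
    have hN' : (0 : ℝ) < N := by exact_mod_cast hN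
    have h5 : (N : ℝ) ^ (Fintype.card ι - 1) = N * (N : ℝ) ^ (Fintype.card ι - 2) := by
      rw [← pow_succ']; congr 1; omega
    have h6 : (0 : ℝ) < (N : ℝ) ^ (Fintype.card ι - 1) := by positivity
    have h7 : (Fintype.card ι : ℝ) ^ 2 * (N : ℝ) ^ (Fintype.card ι - 2) =
        (Fintype.card ι : ℝ) ^ 2 / N * (N : ℝ) ^ (Fintype.card ι - 1) := by
      rw [h5]; field_simp
    rw [h7] at h4
    nlinarith
  obtain ⟨u, hu0, hinj, hgood⟩ := key
  let s : ι → Equiv.Perm (Fin N) := fun p => (Equiv.addRight p).viaEmbedding ⟨u, hinj⟩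
  have hs1 : ∀ p j, s p (u j) = u (j + p) := fun p j =>
    Equiv.Perm.viaEmbedding_apply (Equiv.addRight p) ⟨u, hinj⟩ j
  have hs2 : ∀ p i, i ∉ Set.range u → s p i = i := fun p i hi =>
    Equiv.Perm.viaEmbedding_apply_of_notMem (Equiv.addRight p) ⟨u, hinj⟩ i hi
  -- All switched rows become good, among them the bad row `i₀`, and the other rows are unchanged.
  -- This contradicts minimality.
  refine absurd (hπ (fun p => (s p).trans (π p))) (not_le.mpr (card_lt_card ?_))
  rw [Finset.ssubset_iff_of_subset]
  · refine ⟨i₀, by simpa using hi₀, ?_⟩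
    rw [mem_filter, ← hu0]
    simpa only [mem_univ, true_and, Equiv.trans_apply, hs1] using hgood 0
  · intro i hi
    rw [mem_filter] at hi ⊢
    simp only [mem_univ, true_and, Equiv.trans_apply] at hi ⊢
    by_cases hir : i ∈ Set.range u
    · obtain ⟨j, rfl⟩ := hir
      simp only [hs1] at hi
      exact absurd hi (hgood j)
    · simpa only [hs2 _ i hir] using hi

end Matching

/-! ### Paths as lists of blocks, and the cyclic orders they determine. -/

section Paths

variable {V : Type*} [DecidableEq V] {k : ℕ}

/-- A list of pairs `(S, M)` describes a path from the set `P` to the set `Q`: the edges are the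
unions of `S`, `M` and the `S` of the next pair, where the first `S` is `P` and the last pair is
followed by `Q`. -/
def PathFrom (H : KGraph V k) (P Q : Finset V) : List (Finset V × Finset V) → Prop
  | [] => P = Q
  | b :: t => b.1 = P ∧ ∃ P', b.1 ∪ b.2 ∪ P' ∈ H.edges ∧ PathFrom H P' Q t

theorem PathFrom.append {H : KGraph V k} {P Q R : Finset V} {l l' : List (Finset V × Finset V)}
    (h : H.PathFrom P Q l) (h' : H.PathFrom Q R l') : H.PathFrom P R (l ++ l') := by
  induction l generalizing P with
  | nil =>
    have : P = Q := h
    subst this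
    exact h'
  | cons b t ih =>
    obtain ⟨h1, P', h2, h3⟩ := h
    exact ⟨h1, P', h2, ih h3⟩

theorem PathFrom.start_eq {H : KGraph V k} {P Q : Finset V} {l : List (Finset V × Finset V)}
    (h : H.PathFrom P Q l) (hl : 0 < l.length) : l[0].1 = P := by
  cases l with
  | nil => simp at hl
  | cons b t => exact h.1

theorem PathFrom.edge_mem {H : KGraph V k} {P Q : Finset V} {l : List (Finset V × Finset V)}
    (h : H.PathFrom P Q l) (i : ℕ) (hi : i < l.length) :
    l[i].1 ∪ l[i].2 ∪ (if h : i + 1 < l.length then l[i + 1].1 else Q) ∈ H.edges := by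
  induction l generalizing P i with
  | nil => simp at hi
  | cons b t ih =>
    obtain ⟨-, P', h2, h3⟩ := h
    cases i with
    | zero =>
      cases t with
      | nil =>
        have : P' = Q := h3
        subst this
        simpa using h2
      | cons c u =>
        have : c.1 = P' := h3.1
        simpa [this] using h2
    | succ i =>
      have hi' : i < t.length := by simpa using hi
      simpa using ih h3 i hi'

theorem exists_fin_enum [Nonempty V] (S : Finset V) (n : ℕ) (hS : #S = n) :
    ∃ f : ℕ → V, (Finset.range n).image f = S := by
  obtain ⟨v⟩ := ‹Nonempty V›
  let e := S.equivFinOfCardEq hS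
  refine ⟨fun i => if h : i < n then (e.symm ⟨i, h⟩).1 else v, ?_⟩
  ext x
  simp only [mem_image, mem_range]
  constructor
  · rintro ⟨i, hi, rfl⟩
    simp [hi]
  · intro hx
    refine ⟨e ⟨x, hx⟩, (e ⟨x, hx⟩).2, ?_⟩
    simp

/-- A table of vertices with `m` rows of length `k - ℓ` that contains every vertex gives a Hamilton
`ℓ`-cycle, if each row together with the first `ℓ` entries of the next one is an edge. -/
theorem hasHamiltonCycle_of_table [Fintype V] {H : KGraph V k} {ℓ m : ℕ} (hℓk : 2 * ℓ < k)
    (hm : 3 ≤ m) (hcard : m * (k - ℓ) = Fintype.card V) (τ : ℕ → ℕ → V)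
    (hcover : ∀ v, ∃ i < m, ∃ j < k - ℓ, τ i j = v)
    (hedge : ∀ i < m, (range (k - ℓ)).image (τ i) ∪ (range ℓ).image (τ ((i + 1) % m)) ∈ H.edges) :
    H.HasHamiltonCycle ℓ := by
  set n := Fintype.card V with hn
  set r := k - ℓ with hr
  have hr0 : 0 < r := by omega
  have hkr : k = r + ℓ := by omega
  have hrl : ℓ < r := by omega
  -- Two consecutive segments together span `r + k < 3 * r` positions. With three rows they cannot
  -- wrap around onto each other, so their intersection is exactly the overlap of `ℓ` positions.
  have hn3 : 3 * r ≤ n := by rw [← hcard]; exact Nat.mul_le_mul_right _ hm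
  have : NeZero n := ⟨by omega⟩
  let σ₀ : ZMod n → V := fun x => τ (x.val / r) (x.val % r)
  have hval : ∀ i < m, ∀ j < r, σ₀ ((i * r + j : ℕ) : ZMod n) = τ i j := by
    intro i hi j hj
    have hlt : i * r + j < n := by
      rw [← hcard]
      calc i * r + j < i * r + r := by omega
        _ = (i + 1) * r := by ring
        _ ≤ m * r := Nat.mul_le_mul_right _ hi
    simp only [σ₀]
    rw [ZMod.val_natCast, Nat.mod_eq_of_lt hlt, Nat.add_comm, Nat.add_mul_div_right _ _ hr0,
      Nat.add_mul_mod_self_right, Nat.div_eq_of_lt hj, Nat.mod_eq_of_lt hj, zero_add]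
  have hsurj : Function.Surjective σ₀ := by
    intro v
    obtain ⟨i, hi, j, hj, rfl⟩ := hcover v
    exact ⟨_, hval i hi j hj⟩
  -- The table has as many cells as there are vertices, so covering every vertex already excludes
  -- repetitions.
  have hbij : Function.Bijective σ₀ :=
    (Fintype.bijective_iff_surjective_and_card _).mpr ⟨hsurj, by rw [ZMod.card]⟩
  let σ : ZMod n ≃ V := Equiv.ofBijective σ₀ hbij
  have hnext : ∀ i < m, ∀ j < ℓ, σ₀ ((i * r + (r + j) : ℕ) : ZMod n) = τ ((i + 1) % m) j := by
    intro i hi j hj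
    rw [← hval _ (Nat.mod_lt _ (by omega)) j (by omega)]
    congr 1
    rw [show i * r + (r + j) = (i + 1) * r + j by ring]
    rcases Nat.lt_or_ge (i + 1) m with h | h
    · rw [Nat.mod_eq_of_lt h]
    · have h1 : i + 1 = m := by omega
      rw [h1, Nat.mod_self, hcard]
      simp
  have hseg : ∀ i < m, segment σ k (i * r) =
      (range r).image (τ i) ∪ (range ℓ).image (τ ((i + 1) % m)) := by
    intro i hi
    ext v
    simp only [segment, mem_image, mem_range, mem_union]
    constructor
    · rintro ⟨j, hj, rfl⟩
      rcases Nat.lt_or_ge j r with h | h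
      · exact Or.inl ⟨j, h, (hval i hi j h).symm⟩
      · refine Or.inr ⟨j - r, by omega, ?_⟩
        rw [← hnext i hi (j - r) (by omega)]
        change _ = σ₀ _
        rw [Nat.add_sub_cancel' h]
    · rintro (⟨j, hj, rfl⟩ | ⟨j, hj, rfl⟩)
      · exact ⟨j, by omega, hval i hi j hj⟩
      · exact ⟨r + j, by omega, hnext i hi j hj⟩
  have hm' : n / r = m := by rw [← hcard]; exact Nat.mul_div_cancel _ hr0
  have hmem : ∀ i < m, segment σ k (i * r) ∈ H.edges := fun i hi => by
    rw [hseg i hi]; exact hedge i hi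
  have hsub : (range m).image (fun i => segment σ k (i * r)) ⊆ H.edges := by
    intro e he
    obtain ⟨i, hi, rfl⟩ := mem_image.mp he
    exact hmem i (mem_range.mp hi)
  refine ⟨⟨(range m).image (fun i => segment σ k (i * r)), fun e he => H.card_eq e (hsub he)⟩,
    hsub, ⟨m, by rw [← hn, ← hcard, mul_comm]⟩, σ, ?_, ?_⟩
  · change _ = (range (n / r)).image (fun i => segment σ k (i * r))
    rw [hm']
  · change ∀ i < n / r, #(segment σ k (i * r) ∩ segment σ k ((i + 1) * r)) = ℓ
    rw [hm']
    intro i hi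
    have : segment σ k (i * r) ∩ segment σ k ((i + 1) * r) =
        (range ℓ).image (fun j => σ (((i + 1) * r + j : ℕ) : ZMod n)) := by
      ext v
      simp only [segment, mem_inter, mem_image, mem_range]
      constructor
      · rintro ⟨⟨a, ha, rfl⟩, b, hb, hab⟩
        have h1 := σ.injective hab
        rw [show (i + 1) * r + b = i * r + (r + b) by ring, Nat.cast_add, Nat.cast_add (i * r) a,
          add_left_cancel_iff, ZMod.natCast_eq_natCast_iff', Nat.mod_eq_of_lt (by omega),
          Nat.mod_eq_of_lt (by omega)] at h1
        exact ⟨b, by omega, hab⟩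
      · rintro ⟨j, hj, rfl⟩
        exact ⟨⟨r + j, by omega, by congr 2; ring⟩, j, by omega, rfl⟩
    rw [this, card_image_of_injOn, card_range]
    intro a ha b hb hab
    have ha' : a < ℓ := by simpa using ha
    have hb' : b < ℓ := by simpa using hb
    have h1 := σ.injective hab
    rwa [Nat.cast_add, Nat.cast_add _ b, add_left_cancel_iff, ZMod.natCast_eq_natCast_iff',
      Nat.mod_eq_of_lt (by omega), Nat.mod_eq_of_lt (by omega)] at h1

/-- A closed path that covers all vertices is a Hamilton `ℓ`-cycle. -/
theorem hasHamiltonCycle_of_pathFrom [Fintype V] {H : KGraph V k} {ℓ : ℕ} (hℓk : 2 * ℓ < k)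
    {P : Finset V} {l : List (Finset V × Finset V)} (hpath : H.PathFrom P P l)
    (hcard : ∀ b ∈ l, #b.1 ≤ ℓ ∧ #b.2 ≤ k - 2 * ℓ) (hlen : 3 ≤ l.length)
    (hV : l.length * (k - ℓ) = Fintype.card V) (hcover : ∀ v, ∃ b ∈ l, v ∈ b.1 ∨ v ∈ b.2) :
    H.HasHamiltonCycle ℓ := by
  set m := l.length with hm
  have hmod : ∀ i, (i + 1) % m < l.length := fun i => Nat.mod_lt _ (by omega)
  have hedge : ∀ i (hi : i < m), l[i].1 ∪ l[i].2 ∪ (l[(i + 1) % m]'(hmod i)).1 ∈ H.edges := by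
    intro i hi
    have h := hpath.edge_mem i hi
    split_ifs at h with h1
    · have h2 : (i + 1) % m = i + 1 := Nat.mod_eq_of_lt h1
      simpa only [h2] using h
    · have h2 : (i + 1) % m = 0 := by
        rw [show i + 1 = m by omega, Nat.mod_self]
      rw [← hpath.start_eq (by omega)] at h
      simpa only [h2] using h
  -- The upper bounds `ℓ`, `k - 2 * ℓ` and `ℓ` for the three parts of an edge add up to its size
  -- `k`, so each is attained.
  have hc : ∀ i (hi : i < m), #l[i].1 = ℓ ∧ #l[i].2 = k - 2 * ℓ := by
    intro i hi
    have h1 := H.card_eq _ (hedge i hi)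
    have h2 := hcard _ (List.getElem_mem hi)
    have h3 := hcard _ (List.getElem_mem (hmod i))
    have h4 := card_union_le (l[i].1 ∪ l[i].2) (l[(i + 1) % m]'(hmod i)).1
    have h5 := card_union_le l[i].1 l[i].2
    omega
  have : Nonempty V := by
    rw [← Fintype.card_pos_iff, ← hV]
    exact Nat.mul_pos (by omega) (by omega)
  have hS : ∀ i, ∃ f : ℕ → V, ∀ hi : i < m, (range ℓ).image f = l[i].1 := by
    intro i
    by_cases hi : i < m
    · obtain ⟨f, hf⟩ := exists_fin_enum l[i].1 ℓ (hc i hi).1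
      exact ⟨f, fun _ => hf⟩
    · exact ⟨fun _ => Classical.arbitrary V, fun h => absurd h hi⟩
  have hM : ∀ i, ∃ f : ℕ → V, ∀ hi : i < m, (range (k - 2 * ℓ)).image f = l[i].2 := by
    intro i
    by_cases hi : i < m
    · obtain ⟨f, hf⟩ := exists_fin_enum l[i].2 (k - 2 * ℓ) (hc i hi).2
      exact ⟨f, fun _ => hf⟩
    · exact ⟨fun _ => Classical.arbitrary V, fun h => absurd h hi⟩
  choose fS hfS using hS
  choose fM hfM using hM
  let τ : ℕ → ℕ → V := fun i j => if j < ℓ then fS i j else fM i (j - ℓ)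
  have hτS : ∀ i (hi : i < m), (range ℓ).image (τ i) = l[i].1 := by
    intro i hi
    rw [← hfS i hi]
    refine image_congr fun j hj => ?_
    have : j < ℓ := by simpa using hj
    simp [τ, this]
  have hτ : ∀ i (hi : i < m), (range (k - ℓ)).image (τ i) = l[i].1 ∪ l[i].2 := by
    intro i hi
    rw [← hτS i hi, ← hfM i hi]
    ext v
    simp only [mem_union, mem_image, mem_range]
    constructor
    · rintro ⟨j, hj, rfl⟩
      by_cases h : j < ℓ
      · exact Or.inl ⟨j, h, rfl⟩
      · exact Or.inr ⟨j - ℓ, by omega, by simp [τ, h]⟩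
    · rintro (⟨j, hj, rfl⟩ | ⟨j, hj, rfl⟩)
      · exact ⟨j, by omega, rfl⟩
      · exact ⟨ℓ + j, by omega, by simp [τ]⟩
  refine hasHamiltonCycle_of_table hℓk hlen hV τ ?_ ?_
  · intro v
    obtain ⟨b, hb, hv⟩ := hcover v
    obtain ⟨i, hi, rfl⟩ := List.getElem_of_mem hb
    have : v ∈ (range (k - ℓ)).image (τ i) := by
      rw [hτ i hi]; exact mem_union.mpr hv
    obtain ⟨j, hj, rfl⟩ := mem_image.mp this
    exact ⟨i, hi, j, mem_range.mp hj, rfl⟩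
  · intro i hi
    rw [hτ i hi, hτS _ (hmod i)]
    exact hedge i hi

end Paths

/-! ### Joining pieces through hubs. -/

section Pieces

variable {V : Type*} [DecidableEq V] {k : ℕ}

/-- The vertex `v` together with the entries of the tuple `g` forms an edge. -/
def Joins (H : KGraph V k) {I : Type*} [Fintype I] (v : V) (g : I → V) : Prop :=
  insert v (univ.image g) ∈ H.edges

/-- Index type for the vertices that an edge with a hub has besides the hub and one end. -/
abbrev Inner (k ℓ : ℕ) : Type := Fin (k - 2 * ℓ) ⊕ Fin (ℓ - 1)

/-- Index type for the vertices that the two edges through a hub have besides the hub and the two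
ends. -/
abbrev Between (k ℓ : ℕ) : Type := Inner k ℓ ⊕ Fin (k - 2 * ℓ)

/-- The inner vertices of the first edge through a hub. -/
def firstInner (k ℓ : ℕ) : Inner k ℓ → Between k ℓ := Sum.inl

/-- The inner vertices of the second edge through a hub. -/
def secondInner (k ℓ : ℕ) : Inner k ℓ → Between k ℓ :=
  Sum.elim Sum.inr (fun i => Sum.inl (Sum.inr i))

theorem firstInner_injective (k ℓ : ℕ) : Function.Injective (firstInner k ℓ) :=
  Sum.inl_injective

theorem secondInner_injective (k ℓ : ℕ) : Function.Injective (secondInner k ℓ) := by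
  rintro (a | a) (b | b) h <;> simp_all [secondInner]

theorem card_inner {ℓ : ℕ} (hℓ : 1 ≤ ℓ) (hℓk : 2 * ℓ < k) :
    Fintype.card (Inner k ℓ) = k - ℓ - 1 := by
  simp only [Fintype.card_sum, Fintype.card_fin]
  omega

theorem card_between {ℓ : ℕ} (hℓ : 1 ≤ ℓ) (hℓk : 2 * ℓ < k) :
    Fintype.card (Between k ℓ) = 2 * (k - ℓ) - ℓ - 1 := by
  simp only [Fintype.card_sum, Fintype.card_fin]
  omega

/-- Number of ways in which the end `P` and the hub `h` fail to extend to an edge by vertices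
of `Y`. -/
noncomputable def hubMiss (H : KGraph V k) {ℓ : ℕ} (Y : Finset V) (h : V) (P : Fin ℓ → V) : ℕ :=
  count (fun x : Inner k ℓ → V => (∀ c, x c ∈ Y) ∧ ¬ H.Joins h (Sum.elim P x))

/-- Number of ways in which the end `P` and the vertex `y` in position `c` fail to extend to an edge
by a hub from `G` and vertices of `Y`. -/
noncomputable def innerMiss (H : KGraph V k) {ℓ : ℕ} (G Y : Finset V) (c : Inner k ℓ) (y : V)
    (P : Fin ℓ → V) : ℕ :=
  count (fun p : V × (Inner k ℓ → V) =>
    p.1 ∈ G ∧ (∀ c, p.2 c ∈ Y) ∧ p.2 c = y ∧ ¬ H.Joins p.1 (Sum.elim P p.2))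

/-- Number of ways in which the end `P` fails to extend to an edge by a hub from `G` and vertices
of `Y`. -/
noncomputable def endMiss (H : KGraph V k) {ℓ : ℕ} (G Y : Finset V) (P : Fin ℓ → V) : ℕ :=
  count (fun p : V × (Inner k ℓ → V) =>
    p.1 ∈ G ∧ (∀ c, p.2 c ∈ Y) ∧ ¬ H.Joins p.1 (Sum.elim P p.2))

/-- Each coordinate of the matching problem for one edge of a gap is an end, a hub or an inner
vertex. Fixing an end leaves what `endMiss` counts; fixing a hub or an inner vertex leaves `hubMiss`
or `innerMiss` summed over all ends. Hence these three quantities are all that the choice of pieces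
has to control. -/
theorem degree_not_joins_le [Finite V] {H : KGraph V k} {ℓ N : ℕ} (hℓ : 1 ≤ ℓ) (hℓk : 2 * ℓ < k)
    {G Y : Finset V} (L : Fin N → Fin ℓ → V) (hub : Fin N → V) (hubinj : Function.Injective hub)
    (hubG : ∀ i, hub i ∈ G) (x : Inner k ℓ → Fin N → V) (xinj : ∀ c, Function.Injective (x c))
    (xY : ∀ c i, x c i ∈ Y) (η : ℝ)
    (hend : ∀ i, (H.endMiss G Y (L i) : ℝ) ≤ η * (N : ℝ) ^ (k - ℓ))
    (hhub : ∀ h ∈ G, (∑ i, H.hubMiss Y h (L i) : ℝ) ≤ η * (N : ℝ) ^ (k - ℓ))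
    (hinner : ∀ c, ∀ y ∈ Y, (∑ i, H.innerMiss G Y c y (L i) : ℝ) ≤ η * (N : ℝ) ^ (k - ℓ))
    (j : Bool ⊕ Inner k ℓ) (a : Fin N) :
    (count (fun g : Bool ⊕ Inner k ℓ → Fin N => g j = a ∧
      ¬ H.Joins (hub (g (Sum.inl true)))
        (Sum.elim (L (g (Sum.inl false))) (fun c => x c (g (Sum.inr c))))) : ℝ) ≤
      η * (Fintype.card (Fin N) : ℝ) ^ (Fintype.card (Bool ⊕ Inner k ℓ) - 1) := by
  have hc : Fintype.card (Bool ⊕ Inner k ℓ) - 1 = k - ℓ := by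
    rw [Fintype.card_sum, card_inner hℓ hℓk, Fintype.card_bool]
    omega
  rw [hc, Fintype.card_fin]
  rcases j with (_ | _) | c
  · refine le_trans ?_ (hend a)
    norm_cast
    refine count_le_of_injOn
      (fun g => (hub (g (Sum.inl true)), fun c => x c (g (Sum.inr c)))) ?_ ?_
    · rintro g ⟨rfl, hg⟩
      exact ⟨hubG _, fun c => xY _ _, hg⟩
    · rintro g g' ⟨hg, -⟩ ⟨hg', -⟩ h
      simp only [Prod.mk.injEq] at h
      funext i
      rcases i with (_ | _) | c
      · rw [hg, hg']
      · exact hubinj h.1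
      · exact xinj c (congrFun h.2 c)
  · refine le_trans ?_ (hhub (hub a) (hubG a))
    norm_cast
    simp only [hubMiss]
    rw [← count_prod (fun p : Fin N × (Inner k ℓ → V) =>
      (∀ c, p.2 c ∈ Y) ∧ ¬ H.Joins (hub a) (Sum.elim (L p.1) p.2))]
    refine count_le_of_injOn (fun g => (g (Sum.inl false), fun c => x c (g (Sum.inr c)))) ?_ ?_
    · rintro g ⟨rfl, hg⟩
      exact ⟨fun c => xY _ _, hg⟩
    · rintro g g' ⟨hg, -⟩ ⟨hg', -⟩ h
      simp only [Prod.mk.injEq] at h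
      funext i
      rcases i with (_ | _) | c
      · exact h.1
      · rw [hg, hg']
      · exact xinj c (congrFun h.2 c)
  · refine le_trans ?_ (hinner c (x c a) (xY c a))
    norm_cast
    simp only [innerMiss]
    rw [← count_prod (fun p : Fin N × V × (Inner k ℓ → V) => p.2.1 ∈ G ∧ (∀ c, p.2.2 c ∈ Y) ∧
      p.2.2 c = x c a ∧ ¬ H.Joins p.2.1 (Sum.elim (L p.1) p.2.2))]
    refine count_le_of_injOn (fun g =>
      (g (Sum.inl false), hub (g (Sum.inl true)), fun c => x c (g (Sum.inr c)))) ?_ ?_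
    · rintro g ⟨rfl, hg⟩
      exact ⟨hubG _, fun c => xY _ _, rfl, hg⟩
    · rintro g g' ⟨hg, -⟩ ⟨hg', -⟩ h
      simp only [Prod.mk.injEq] at h
      funext i
      rcases i with (_ | _) | c
      · exact h.1
      · exact hubinj h.2.1
      · exact xinj c (congrFun h.2.2 c)

/-- Regroups an edge into the shape `PathFrom` asks for: an end, a middle part, and the next
overlap, which consists of the hub and `ℓ - 1` companions. -/
theorem edge_of_joins {H : KGraph V k} {ℓ : ℕ} {h : V} {P : Fin ℓ → V} {x : Inner k ℓ → V}
    (hj : H.Joins h (Sum.elim P x)) :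
    univ.image P ∪ univ.image (fun i => x (Sum.inl i)) ∪
      insert h (univ.image (fun i => x (Sum.inr i))) ∈ H.edges := by
  have : univ.image P ∪ univ.image (fun i => x (Sum.inl i)) ∪
      insert h (univ.image (fun i => x (Sum.inr i))) =
      insert h (univ.image (Sum.elim P x)) := by
    ext v
    simp only [mem_union, mem_insert, mem_image, mem_univ, true_and, Sum.exists, Sum.elim_inl,
      Sum.elim_inr]
    tauto
  rw [this]
  exact hj

/-- A path whose two ends are `ℓ`-tuples, together with its vertex set. -/
structure Piece (H : KGraph V k) (ℓ : ℕ) where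
  /-- The first end. -/
  start : Fin ℓ → V
  /-- The last end. -/
  finish : Fin ℓ → V
  /-- The blocks of the path. -/
  blocks : List (Finset V × Finset V)
  /-- The vertex set. -/
  supp : Finset V
  path : H.PathFrom (univ.image start) (univ.image finish) blocks
  card_blocks : ∀ b ∈ blocks, #b.1 ≤ ℓ ∧ #b.2 ≤ k - 2 * ℓ
  cover : ∀ v ∈ supp, v ∈ univ.image finish ∨ ∃ b ∈ blocks, v ∈ b.1 ∨ v ∈ b.2
  card_supp : #supp = blocks.length * (k - ℓ) + ℓ

theorem pathFrom_flatMap {H : KGraph V k} (P : ℕ → Finset V)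
    (seg : ℕ → List (Finset V × Finset V)) (h : ∀ j, H.PathFrom (P j) (P (j + 1)) (seg j)) (N : ℕ) :
    H.PathFrom (P 0) (P N) ((List.range N).flatMap seg) := by
  induction N with
  | zero => exact rfl
  | succ N ih =>
    rw [List.range_succ, List.flatMap_append]
    simpa using ih.append (by simpa using h N)

theorem length_flatMap_range {β : Type*} (seg : ℕ → List β) (N : ℕ) :
    ((List.range N).flatMap seg).length = ∑ i ∈ range N, (seg i).length := by
  induction N with
  | zero => simp
  | succ N ih =>
    rw [List.range_succ, List.flatMap_append, List.length_append, ih, sum_range_succ]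
    simp

/-- Cyclically arranged pieces whose gaps can be closed by hubs give a Hamilton cycle. -/
theorem hasHamiltonCycle_of_gaps [Fintype V] {H : KGraph V k} {ℓ N : ℕ} (hℓ : 1 ≤ ℓ)
    (hℓk : 2 * ℓ < k) (hN : 2 ≤ N) (piece : Fin N → H.Piece ℓ)
    (nxt : Fin N → Fin N) (hnxt : ∀ i, (nxt i).1 = (i.1 + 1) % N)
    (hub : Fin N → V) (x : Between k ℓ → Fin N → V)
    (hfirst : ∀ i, H.Joins (hub i) (Sum.elim (piece i).finish (fun c => x (firstInner k ℓ c) i)))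
    (hsecond : ∀ i, H.Joins (hub i)
      (Sum.elim (piece (nxt i)).start (fun c => x (secondInner k ℓ c) i)))
    (hcover : ∀ v, (∃ i, v ∈ (piece i).supp) ∨ (∃ i, v = hub i) ∨ ∃ d i, v = x d i)
    (hlen : (∑ i, ((piece i).blocks.length + 2)) * (k - ℓ) = Fintype.card V) :
    H.HasHamiltonCycle ℓ := by
  let idx : ℕ → Fin N := fun j => ⟨j % N, Nat.mod_lt _ (by omega)⟩
  have hidx : ∀ i : Fin N, idx i = i := fun i => Fin.ext (Nat.mod_eq_of_lt i.2)
  have hidx1 : ∀ j, nxt (idx j) = idx (j + 1) := fun j => Fin.ext (by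
    rw [hnxt]; exact Nat.mod_add_mod j N 1)
  -- Two blocks close a gap. Their common overlap is the hub with its `ℓ - 1` companions; the two
  -- middle parts have `k - 2 * ℓ` vertices each at most.
  let gap : Fin N → List (Finset V × Finset V) := fun i =>
    [(univ.image (piece i).finish, univ.image (fun m => x (Sum.inl (Sum.inl m)) i)),
      (insert (hub i) (univ.image (fun m => x (Sum.inl (Sum.inr m)) i)),
        univ.image (fun m => x (Sum.inr m) i))]
  have hgap : ∀ i, H.PathFrom (univ.image (piece i).finish) (univ.image (piece (nxt i)).start)
      (gap i) := by
    intro i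
    refine ⟨rfl, _, edge_of_joins (hfirst i), rfl, univ.image (piece (nxt i)).start, ?_, rfl⟩
    have := edge_of_joins (hsecond i)
    simp only [secondInner, Sum.elim_inl, Sum.elim_inr] at this
    convert this using 1
    ext v
    simp only [mem_union]
    tauto
  let seg : Fin N → List (Finset V × Finset V) := fun i => (piece i).blocks ++ gap i
  have hpath := pathFrom_flatMap (H := H) (fun j => univ.image (piece (idx j)).start)
    (fun j => seg (idx j)) (fun j => by
      have := ((piece (idx j)).path).append (hgap (idx j))
      rwa [hidx1] at this) N
  have h0 : idx N = idx 0 := Fin.ext (by simp [idx])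
  simp only [h0] at hpath
  have hmem : ∀ i, ∀ b ∈ seg i, b ∈ (List.range N).flatMap (fun j => seg (idx j)) := by
    intro i b hb
    rw [List.mem_flatMap]
    exact ⟨i, List.mem_range.mpr i.2, by rwa [hidx]⟩
  have hlen' : ((List.range N).flatMap (fun j => seg (idx j))).length =
      ∑ i, ((piece i).blocks.length + 2) := by
    rw [length_flatMap_range, sum_range]
    refine sum_congr rfl fun i _ => ?_
    rw [hidx]
    simp [seg, gap]
  refine hasHamiltonCycle_of_pathFrom hℓk hpath ?_ ?_ ?_ ?_
  · intro b hb
    obtain ⟨j, -, hb⟩ := List.mem_flatMap.mp hb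
    rcases List.mem_append.mp hb with hb | hb
    · exact (piece _).card_blocks b hb
    · simp only [gap, List.mem_cons, List.not_mem_nil, or_false] at hb
      have h1 : ∀ (n : ℕ) (f : Fin n → V), #(univ.image f) ≤ n := fun n f => by
        simpa using card_image_le (s := univ) (f := f)
      rcases hb with rfl | rfl
      · exact ⟨h1 _ _, h1 _ _⟩
      · refine ⟨(card_insert_le _ _).trans ?_, h1 _ _⟩
        have := h1 _ (fun m => x (Sum.inl (Sum.inr m)) (idx j))
        omega
  · rw [hlen']
    have : ∑ i : Fin N, 2 ≤ ∑ i, ((piece i).blocks.length + 2) :=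
      sum_le_sum fun i _ => by omega
    simp only [sum_const, card_univ, Fintype.card_fin, smul_eq_mul] at this
    omega
  · rw [hlen', hlen]
  · intro v
    rcases hcover v with ⟨i, hv⟩ | ⟨i, rfl⟩ | ⟨d, i, rfl⟩
    · rcases (piece i).cover v hv with h | ⟨b, hb, hv⟩
      · exact ⟨_, hmem i _ (List.mem_append_right _ List.mem_cons_self), Or.inl h⟩
      · exact ⟨b, hmem i b (List.mem_append_left _ hb), hv⟩
    · exact ⟨_, hmem i _ (List.mem_append_right _ (List.mem_cons_of_mem _ List.mem_cons_self)),
        Or.inl (mem_insert_self _ _)⟩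
    · rcases d with (d | d) | d
      · exact ⟨_, hmem i _ (List.mem_append_right _ List.mem_cons_self),
          Or.inr (mem_image_of_mem _ (mem_univ d))⟩
      · exact ⟨_, hmem i _ (List.mem_append_right _ (List.mem_cons_of_mem _ List.mem_cons_self)),
          Or.inl (mem_insert_of_mem (mem_image_of_mem _ (mem_univ d)))⟩
      · exact ⟨_, hmem i _ (List.mem_append_right _ (List.mem_cons_of_mem _ List.mem_cons_self)),
          Or.inr (mem_image_of_mem _ (mem_univ d))⟩

/-- Pieces with well-spread ends, as many hubs as pieces, and the right number of further vertices
give a Hamilton cycle. -/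
theorem hasHamiltonCycle_of_pieces [Fintype V] {H : KGraph V k} {ℓ N : ℕ} (hℓ : 1 ≤ ℓ)
    (hℓk : 2 * ℓ < k) (hN : 2 ≤ N) {G Y : Finset V} (piece : Fin N → H.Piece ℓ)
    (hub : Fin N → V) (hubinj : Function.Injective hub) (hubG : ∀ i, hub i ∈ G)
    (x : Between k ℓ → Fin N → V) (xinj : ∀ c, Function.Injective (x c)) (xY : ∀ c i, x c i ∈ Y)
    (hcover : ∀ v, (∃ i, v ∈ (piece i).supp) ∨ (∃ i, v = hub i) ∨ ∃ d i, v = x d i)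
    (hlen : (∑ i, ((piece i).blocks.length + 2)) * (k - ℓ) = Fintype.card V) (η : ℝ)
    (hη : (2 * k : ℝ) * (2 * η) + (2 * k : ℝ) ^ 2 / N < 1) (hη0 : 0 ≤ η)
    (hend : ∀ i, (H.endMiss G Y (piece i).start : ℝ) ≤ η * (N : ℝ) ^ (k - ℓ) ∧
      (H.endMiss G Y (piece i).finish : ℝ) ≤ η * (N : ℝ) ^ (k - ℓ))
    (hhub : ∀ h ∈ G, (∑ i, H.hubMiss Y h (piece i).start : ℝ) ≤ η * (N : ℝ) ^ (k - ℓ) ∧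
      (∑ i, H.hubMiss Y h (piece i).finish : ℝ) ≤ η * (N : ℝ) ^ (k - ℓ))
    (hinner : ∀ c, ∀ y ∈ Y,
      (∑ i, H.innerMiss G Y c y (piece i).start : ℝ) ≤ η * (N : ℝ) ^ (k - ℓ) ∧
      (∑ i, H.innerMiss G Y c y (piece i).finish : ℝ) ≤ η * (N : ℝ) ^ (k - ℓ)) :
    H.HasHamiltonCycle ℓ := by
  let nxt : Fin N → Fin N := fun i => ⟨(i.1 + 1) % N, Nat.mod_lt _ (by omega)⟩
  have hnxt : Function.Bijective nxt := by
    rw [← Finite.injective_iff_bijective]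
    intro i j hij
    have h1 : (i.1 + 1) % N = (j.1 + 1) % N := congrArg Fin.val hij
    have h2 : i.1 % N = j.1 % N := Nat.ModEq.add_right_cancel' 1 h1
    rw [Nat.mod_eq_of_lt i.2, Nat.mod_eq_of_lt j.2] at h2
    exact Fin.ext h2
  -- A row `f` describes one gap: coordinate `Sum.inl false` is the gap itself, `Sum.inl true` its
  -- hub, and `Sum.inr d` the vertex in position `d`.
  let bad (L : Fin N → Fin ℓ → V) (e : Inner k ℓ → Between k ℓ)
      (f : Bool ⊕ Between k ℓ → Fin N) : Prop :=
    ¬ H.Joins (hub (f (Sum.inl true)))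
      (Sum.elim (L (f (Sum.inl false))) (fun c => x (e c) (f (Sum.inr (e c)))))
  have hdeg : ∀ (L : Fin N → Fin ℓ → V) (e : Inner k ℓ → Between k ℓ), Function.Injective e →
      (∀ i, (H.endMiss G Y (L i) : ℝ) ≤ η * (N : ℝ) ^ (k - ℓ)) →
      (∀ h ∈ G, (∑ i, H.hubMiss Y h (L i) : ℝ) ≤ η * (N : ℝ) ^ (k - ℓ)) →
      (∀ c, ∀ y ∈ Y, (∑ i, H.innerMiss G Y c y (L i) : ℝ) ≤ η * (N : ℝ) ^ (k - ℓ)) →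
      ∀ p a, (count (fun f : Bool ⊕ Between k ℓ → Fin N => f p = a ∧ bad L e f) : ℝ) ≤
        η * (Fintype.card (Fin N) : ℝ) ^ (Fintype.card (Bool ⊕ Between k ℓ) - 1) := by
    intro L e he h1 h2 h3 p a
    exact degree_comp_le (Sum.map id e) (Sum.map_injective.mpr ⟨fun _ _ h => h, he⟩) _ η
      (degree_not_joins_le hℓ hℓk L hub hubinj hubG (fun c => x (e c)) (fun c => xinj _)
        (fun c i => xY _ _) η h1 h2 h3) p a
  have hcard : Fintype.card (Bool ⊕ Between k ℓ) ≤ 2 * k := by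
    rw [Fintype.card_sum, card_between hℓ hℓk, Fintype.card_bool]
    omega
  have hcardR : (Fintype.card (Bool ⊕ Between k ℓ) : ℝ) ≤ 2 * k := by exact_mod_cast hcard
  -- A row is bad if either of its two edges is missing, hence the degree `2 * η`. The second edge
  -- uses the start of the next piece; as `nxt` is a bijection, this shift does not change the sums
  -- over all pieces.
  obtain ⟨π, hπ⟩ := exists_perms_avoiding (N := N) (by omega)
    (fun f => bad (fun i => (piece i).finish) (firstInner k ℓ) f ∨
      bad (fun i => (piece (nxt i)).start) (secondInner k ℓ) f) (2 * η) (by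
      intro p a
      have h1 := hdeg _ _ (firstInner_injective k ℓ) (fun i => (hend i).2)
        (fun h hh => (hhub h hh).2) (fun c y hy => (hinner c y hy).2) p a
      have h2 := hdeg (fun i => (piece (nxt i)).start) _ (secondInner_injective k ℓ)
        (fun i => (hend (nxt i)).1)
        (fun h hh => by
          rw [hnxt.sum_comp (fun i => (H.hubMiss Y h (piece i).start : ℝ))]
          exact (hhub h hh).1)
        (fun c y hy => by
          rw [hnxt.sum_comp (fun i => (H.innerMiss G Y c y (piece i).start : ℝ))]
          exact (hinner c y hy).1) p a
      rw [Fintype.card_fin] at h1 h2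
      have h3 := count_or_le
        (fun f : Bool ⊕ Between k ℓ → Fin N => f p = a ∧
          bad (fun i => (piece i).finish) (firstInner k ℓ) f)
        (fun f : Bool ⊕ Between k ℓ → Fin N => f p = a ∧
          bad (fun i => (piece (nxt i)).start) (secondInner k ℓ) f)
      simp only [← and_or_left] at h3
      have h4 := (Nat.cast_le (α := ℝ)).mpr h3
      push_cast at h4
      linarith)
    (by rw [Fintype.card_sum, Fintype.card_bool]; omega)
    (by
      refine lt_of_le_of_lt ?_ hη
      gcongr)
  -- The row of the matching that serves gap `a`.
  let t : Fin N → Fin N := fun a => (π (Sum.inl false)).symm a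
  refine hasHamiltonCycle_of_gaps hℓ hℓk hN piece nxt (fun _ => rfl)
    (fun a => hub (π (Sum.inl true) (t a))) (fun d a => x d (π (Sum.inr d) (t a))) ?_ ?_ ?_ hlen
  · intro a
    have := hπ (t a)
    simp only [bad, not_or, not_not] at this
    simpa [t] using this.1
  · intro a
    have := hπ (t a)
    simp only [bad, not_or, not_not] at this
    simpa [t] using this.2
  · intro v
    have hsurj : ∀ (p : Bool ⊕ Between k ℓ) (i : Fin N), ∃ a, π p (t a) = i := fun p i =>
      ⟨π (Sum.inl false) ((π p).symm i), by simp [t]⟩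
    rcases hcover v with h | ⟨i, rfl⟩ | ⟨d, i, rfl⟩
    · exact Or.inl h
    · obtain ⟨a, ha⟩ := hsurj (Sum.inl true) i
      exact Or.inr (Or.inl ⟨a, by rw [ha]⟩)
    · obtain ⟨a, ha⟩ := hsurj (Sum.inr d) i
      exact Or.inr (Or.inr ⟨d, a, by rw [ha]⟩)

end Pieces

/-! ### Greedy and well-spread selection of disjoint objects. -/

section Selection

/-- The earlier bound relative to the number of all tuples. For fewer than two indices the exponent
`Fintype.card I - 2` is truncated, but then every tuple is injective. -/
theorem cast_count_not_injective_apply_eq_le {I α : Type*} [Fintype I] [Fintype α] [Nonempty α]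
    (q : I) (a : α) :
    (count (fun f : I → α => f q = a ∧ ¬ Function.Injective f) : ℝ) ≤
      (Fintype.card I : ℝ) ^ 2 / Fintype.card α *
        (Fintype.card α : ℝ) ^ (Fintype.card I - 1) := by
  have hα : (0 : ℝ) < Fintype.card α := by exact_mod_cast Fintype.card_pos
  rcases Nat.lt_or_ge (Fintype.card I) 2 with h | h
  · have : Subsingleton I := Fintype.card_le_one_iff_subsingleton.mp (by omega)
    have h0 : count (fun f : I → α => f q = a ∧ ¬ Function.Injective f) = 0 := by
      rw [count, Nat.card_eq_zero]
      exact Or.inl ⟨fun f => f.2.2 (Function.injective_of_subsingleton _)⟩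
    rw [h0, Nat.cast_zero]
    positivity
  · have h1 := count_not_injective_apply_eq_le q a
    have h2 : Fintype.card I - 1 = Fintype.card I - 2 + 1 := by omega
    rw [h2, pow_succ (Fintype.card α : ℝ)]
    have h3 : (Fintype.card I : ℝ) ^ 2 / Fintype.card α *
        ((Fintype.card α : ℝ) ^ (Fintype.card I - 2) * Fintype.card α) =
        (Fintype.card I : ℝ) ^ 2 * (Fintype.card α : ℝ) ^ (Fintype.card I - 2) := by
      field_simp
    rw [h3]
    exact_mod_cast h1

theorem cast_count_not_injective_le {I α : Type*} [Fintype I] [Fintype α] [Nonempty α] :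
    (count (fun f : I → α => ¬ Function.Injective f) : ℝ) ≤
      (Fintype.card I : ℝ) ^ 2 / Fintype.card α * (Fintype.card α : ℝ) ^ Fintype.card I := by
  rcases isEmpty_or_nonempty I with hI | ⟨⟨q⟩⟩
  · have h0 : count (fun f : I → α => ¬ Function.Injective f) = 0 := by
      rw [count, Nat.card_eq_zero]
      exact Or.inl ⟨fun f => f.2 (Function.injective_of_subsingleton _)⟩
    rw [h0, Nat.cast_zero]
    positivity
  · have h1 : (count (fun f : I → α => ¬ Function.Injective f) : ℝ) ≤
        ∑ a : α, (count (fun f : I → α => f q = a ∧ ¬ Function.Injective f) : ℝ) := by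
      exact_mod_cast (count_mono
        (Q := fun f : I → α => ∃ a ∈ univ, f q = a ∧ ¬ Function.Injective f)
        fun f hf => ⟨f q, mem_univ _, rfl, hf⟩).trans (count_exists_le _ _)
    refine h1.trans ((sum_le_card_nsmul _ _ _ fun a _ =>
      cast_count_not_injective_apply_eq_le q a).trans ?_)
    have h2 : (Fintype.card α : ℝ) ^ Fintype.card I =
        Fintype.card α * (Fintype.card α : ℝ) ^ (Fintype.card I - 1) := by
      have : 0 < Fintype.card I := Fintype.card_pos_iff.mpr ⟨q⟩
      rw [← pow_succ', Nat.sub_add_cancel this]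
    rw [nsmul_eq_mul, card_univ, h2]
    exact le_of_eq (by ring)

theorem count_forall_mem {I α : Type*} [Fintype I] [Finite α] (Y : Finset α) :
    count (fun f : I → α => ∀ i, f i ∈ Y) = #Y ^ Fintype.card I := by
  classical
  have := Fintype.ofFinite α
  have h : #Y ^ Fintype.card I = #(Fintype.piFinset fun _ : I => Y) := by simp
  rw [count_eq_card, h]
  refine congrArg Finset.card ?_
  ext f
  simp

theorem count_and_not_add {α : Type*} [Finite α] (P Q : α → Prop) :
    count P ≤ count (fun x => P x ∧ ¬ Q x) + count (fun x => P x ∧ Q x) :=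
  (count_mono fun x hx => by tauto).trans (count_or_le _ _)

/-- Disjoint objects can be chosen one after the other if each choice can avoid any moderately large
set. -/
theorem exists_disjoint_family {J α V : Type*} [Fintype J] [DecidableEq V] (supp : α → Finset V)
    (good : J → α → Prop) (C : ℕ)
    (h : ∀ j (U : Finset V), #U ≤ C * Fintype.card J →
      ∃ x, good j x ∧ #(supp x) ≤ C ∧ Disjoint (supp x) U) :
    ∃ x : J → α, (∀ j, good j (x j)) ∧
      (∀ i j, i ≠ j → Disjoint (supp (x i)) (supp (x j))) := by
  classical
  have key : ∀ s : Finset J, ∃ x : J → α, (∀ j, good j (x j) ∧ #(supp (x j)) ≤ C) ∧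
      ∀ i ∈ s, ∀ j ∈ s, i ≠ j → Disjoint (supp (x i)) (supp (x j)) := by
    intro s
    induction s using Finset.induction_on with
    | empty =>
      choose x hx using fun j => h j ∅ (by simp)
      exact ⟨x, fun j => ⟨(hx j).1, (hx j).2.1⟩, by simp⟩
    | insert a s ha ih =>
      obtain ⟨x, hx, hd⟩ := ih
      obtain ⟨y, hy, hyC, hyd⟩ := h a (s.biUnion fun i => supp (x i)) (by
        refine (card_biUnion_le_card_mul _ _ C fun i _ => (hx i).2).trans ?_
        rw [mul_comm]
        exact Nat.mul_le_mul_left _ (card_le_univ s))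
      have hyd' : ∀ i ∈ s, Disjoint (supp y) (supp (x i)) := fun i hi =>
        disjoint_of_subset_right (subset_biUnion_of_mem (fun i => supp (x i)) hi) hyd
      refine ⟨Function.update x a y, fun j => ?_, fun i hi j hj hij => ?_⟩
      · by_cases hj : j = a
        · subst hj
          simpa using ⟨hy, hyC⟩
        · simpa [hj] using hx j
      · rcases mem_insert.mp hi with rfl | hi'
        · have hj' : j ∈ s := (mem_insert.mp hj).resolve_left fun h => hij h.symm
          rw [Function.update_self, Function.update_of_ne hij.symm]
          exact hyd' j hj'
        · have hia : i ≠ a := fun h => ha (h ▸ hi')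
          rw [Function.update_of_ne hia]
          rcases mem_insert.mp hj with rfl | hj'
          · rw [Function.update_self]
            exact (hyd' i hi').symm
          · have hja : j ≠ a := fun h => ha (h ▸ hj')
            rw [Function.update_of_ne hja]
            exact hd i hi' j hj' hij
  obtain ⟨x, hx, hd⟩ := key univ
  exact ⟨x, fun j => (hx j).1, fun i j hij => hd i (mem_univ _) j (mem_univ _) hij⟩

/-- Multiplicative weights: if each choice can be made so that every weighted average of the tests
is at most `a`, then `t` choices can be made so that no test exceeds `a * t` by much. -/
theorem exists_spread_of_step {V Z : Type*} [Fintype Z] [DecidableEq V] {ℓ : ℕ}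
    (ok : (Fin ℓ → V) → Prop) (w : Z → (Fin ℓ → V) → ℝ)
    (hw : ∀ z f, 0 ≤ w z f ∧ w z f ≤ 1) (a : ℝ) (t : ℕ)
    (hstep : ∀ U : Finset V, #U ≤ t * ℓ → ∀ φ : Z → ℝ, (∀ z, 0 ≤ φ z) →
      ∃ f : Fin ℓ → V, (∀ i, f i ∉ U) ∧ ok f ∧ ∑ z, φ z * w z f ≤ a * ∑ z, φ z) :
    ∃ F : Fin t → Fin ℓ → V, (∀ i, ok (F i)) ∧ (∀ i j, i ≠ j → ∀ c d, F i c ≠ F j d) ∧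
      ∀ z, ∑ i, w z (F i) ≤ Real.log (Fintype.card Z) + 2 * a * t := by
  -- The potential sums the exponentials of the loads of all tests, and these exponentials are the
  -- weights `φ` for the next choice. Since `exp x ≤ 1 + 2 * x` on `[0, 1]`, each choice multiplies
  -- the potential by at most `1 + 2 * a ≤ exp (2 * a)`. At the end every single test is bounded by
  -- the potential.
  have key : ∀ s ≤ t, ∃ F : ℕ → Fin ℓ → V, (∀ i < s, ok (F i)) ∧
      (∀ i < s, ∀ j < s, i ≠ j → ∀ c d, F i c ≠ F j d) ∧
      ∑ z, Real.exp (∑ i ∈ range s, w z (F i)) ≤ Fintype.card Z * Real.exp (2 * a * s) := by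
    intro s
    induction s with
    | zero =>
      intro _
      obtain ⟨f, -⟩ := hstep ∅ (by simp) (fun _ => 0) (fun _ => le_rfl)
      exact ⟨fun _ => f, by simp, by simp, by simp⟩
    | succ s ih =>
      intro hs
      obtain ⟨F, hF, hd, hsum⟩ := ih (by omega)
      obtain ⟨f, hfU, hfok, hfw⟩ := hstep ((range s).biUnion fun i => univ.image (F i)) (by
        refine (card_biUnion_le_card_mul _ _ ℓ fun i _ => ?_).trans ?_
        · simpa using card_image_le (s := univ) (f := F i)
        · rw [card_range]
          exact Nat.mul_le_mul_right _ (by omega))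
        (fun z => Real.exp (∑ i ∈ range s, w z (F i))) (fun z => (Real.exp_pos _).le)
      have hne : ∀ i < s, ∀ c d, F i c ≠ f d := by
        intro i hi c d h
        refine hfU d (mem_biUnion.mpr ⟨i, mem_range.mpr hi, ?_⟩)
        rw [← h]
        exact mem_image_of_mem _ (mem_univ c)
      refine ⟨fun i => if i = s then f else F i, ?_, ?_, ?_⟩
      · intro i hi
        by_cases h : i = s
        · simpa [h] using hfok
        · simpa [h] using hF i (by omega)
      · intro i hi j hj hij c d
        by_cases h : i = s
        · have hj' : j ≠ s := fun h' => hij (h.trans h'.symm)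
          simpa [h, hj'] using (hne j (by omega) d c).symm
        · by_cases h' : j = s
          · simpa [h, h'] using hne i (by omega) c d
          · simpa [h, h'] using hd i (by omega) j (by omega) hij c d
      · have h1 : ∀ z, ∑ i ∈ range (s + 1), w z ((fun i => if i = s then f else F i) i) =
            ∑ i ∈ range s, w z (F i) + w z f := by
          intro z
          rw [sum_range_succ]
          congr 1
          · refine sum_congr rfl fun i hi => ?_
            have : i ≠ s := (mem_range.mp hi).ne
            simp [this]
          · simp
        have h2 : ∀ x : ℝ, 0 ≤ x ∧ x ≤ 1 → Real.exp x ≤ 1 + 2 * x := by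
          rintro x ⟨hx0, hx1⟩
          have := Real.abs_exp_sub_one_le (x := x) (by rw [abs_of_nonneg hx0]; exact hx1)
          rw [abs_of_nonneg hx0] at this
          linarith [le_abs_self (Real.exp x - 1)]
        set Φ := ∑ z, Real.exp (∑ i ∈ range s, w z (F i)) with hΦ
        have hΦ0 : 0 ≤ Φ := sum_nonneg fun z _ => (Real.exp_pos _).le
        calc ∑ z, Real.exp (∑ i ∈ range (s + 1), w z ((fun i => if i = s then f else F i) i))
            = ∑ z, Real.exp (∑ i ∈ range s, w z (F i)) * Real.exp (w z f) := by
              refine sum_congr rfl fun z _ => ?_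
              rw [h1, Real.exp_add]
          _ ≤ ∑ z, Real.exp (∑ i ∈ range s, w z (F i)) * (1 + 2 * w z f) :=
              sum_le_sum fun z _ => mul_le_mul_of_nonneg_left (h2 _ (hw z f)) (Real.exp_pos _).le
          _ = Φ + 2 * ∑ z, Real.exp (∑ i ∈ range s, w z (F i)) * w z f := by
              rw [hΦ, mul_sum, ← sum_add_distrib]
              exact sum_congr rfl fun z _ => by ring
          _ ≤ Φ * (2 * a + 1) := by linarith
          _ ≤ Φ * Real.exp (2 * a) :=
              mul_le_mul_of_nonneg_left (Real.add_one_le_exp _) hΦ0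
          _ ≤ Fintype.card Z * Real.exp (2 * a * s) * Real.exp (2 * a) :=
              mul_le_mul_of_nonneg_right hsum (Real.exp_pos _).le
          _ = Fintype.card Z * Real.exp (2 * a * (s + 1 : ℕ)) := by
              rw [mul_assoc, ← Real.exp_add]
              push_cast
              ring_nf
  obtain ⟨F, hF, hd, hsum⟩ := key t le_rfl
  refine ⟨fun i => F i, fun i => hF i i.2,
    fun i j hij => hd i i.2 j j.2 fun h => hij (Fin.ext h), fun z => ?_⟩
  have hZ : (0 : ℝ) < Fintype.card Z := by
    exact_mod_cast Fintype.card_pos_iff.mpr ⟨z⟩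
  have h1 : Real.exp (∑ i ∈ range t, w z (F i)) ≤ Fintype.card Z * Real.exp (2 * a * t) :=
    (single_le_sum (f := fun z => Real.exp (∑ i ∈ range t, w z (F i)))
      (fun z _ => (Real.exp_pos _).le) (mem_univ z)).trans hsum
  rw [← sum_range (fun i => w z (F i)), ← Real.exp_le_exp, Real.exp_add, Real.exp_log hZ]
  exact h1

/-- Disjoint tuples in `Y` that avoid a sparse family of tuples and are well spread with respect to
finitely many tests. -/
theorem exists_spread_family {V Z : Type*} [Fintype V] [Nonempty V] [Fintype Z] [DecidableEq V]
    {ℓ : ℕ} (Y : Finset V) (ok : (Fin ℓ → V) → Prop) (w : Z → (Fin ℓ → V) → ℝ)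
    (hw : ∀ z f, 0 ≤ w z f ∧ w z f ≤ 1) (t : ℕ) (b c α : ℝ) (hc : 0 < c) (hb : 0 ≤ b)
    (hY : c * Fintype.card V + t * ℓ ≤ #Y)
    (hsum : ∀ z, ∑ f ∈ Fintype.piFinset (fun _ : Fin ℓ => Y), w z f ≤
      b * (Fintype.card V : ℝ) ^ ℓ)
    (hbad : (count (fun f : Fin ℓ → V => (∀ i, f i ∈ Y) ∧ ¬ ok f) : ℝ) ≤
      α * (Fintype.card V : ℝ) ^ ℓ)
    (hα : α + (ℓ : ℝ) ^ 2 / Fintype.card V ≤ c ^ ℓ / 2) :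
    ∃ F : Fin t → Fin ℓ → V, (∀ i, Function.Injective (F i) ∧ (∀ c, F i c ∈ Y) ∧ ok (F i)) ∧
      (∀ i j, i ≠ j → ∀ c d, F i c ≠ F j d) ∧
      ∀ z, ∑ i, w z (F i) ≤ Real.log (Fintype.card Z) + 2 * (2 * b / c ^ ℓ) * t := by
  classical
  set n := Fintype.card V with hn
  have hn0 : (0 : ℝ) < n := by exact_mod_cast Fintype.card_pos
  refine exists_spread_of_step
    (fun f => Function.Injective f ∧ (∀ c, f c ∈ Y) ∧ ok f) w hw _ t ?_
  intro U hU φ hφ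
  -- At least `c * n` vertices of `Y` remain after removing `U`, so there are at least `c ^ ℓ * n ^
  -- ℓ` tuples; by `hα` the non-injective and the forbidden ones cost at most half of this.
  let adm : Finset (Fin ℓ → V) :=
    {f | (∀ i, f i ∈ Y \ U) ∧ Function.Injective f ∧ ok f}
  have hadm : c ^ ℓ / 2 * (n : ℝ) ^ ℓ ≤ #adm := by
    have h1 : c * n ≤ (#(Y \ U) : ℝ) := by
      have h2 : #Y ≤ #(Y \ U) + #U := by
        have := card_le_card (show Y ⊆ (Y \ U) ∪ U by intro v; simp; tauto)
        exact this.trans (card_union_le _ _)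
      have h3 : (#Y : ℝ) ≤ #(Y \ U) + #U := by exact_mod_cast h2
      have h4 : (#U : ℝ) ≤ t * ℓ := by exact_mod_cast hU
      linarith
    have h2 : c ^ ℓ * (n : ℝ) ^ ℓ ≤ (count (fun f : Fin ℓ → V => ∀ i, f i ∈ Y \ U) : ℝ) := by
      rw [count_forall_mem, Fintype.card_fin, ← mul_pow]
      push_cast
      exact pow_le_pow_left₀ (by positivity) h1 ℓ
    have h3 : count (fun f : Fin ℓ → V => ∀ i, f i ∈ Y \ U) ≤ #adm +
        (count (fun f : Fin ℓ → V => ¬ Function.Injective f) +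
          count (fun f : Fin ℓ → V => (∀ i, f i ∈ Y) ∧ ¬ ok f)) := by
      rw [← count_mem adm]
      refine (count_mono ?_).trans ((count_or_le _ _).trans
        (Nat.add_le_add_left (count_or_le _ _) _))
      intro f hf
      by_cases hi : Function.Injective f
      · by_cases ho : ok f
        · exact Or.inl (by simpa [adm] using ⟨by simpa using hf, hi, ho⟩)
        · exact Or.inr (Or.inr ⟨fun i => (mem_sdiff.mp (hf i)).1, ho⟩)
      · exact Or.inr (Or.inl hi)
    have h4 := cast_count_not_injective_le (I := Fin ℓ) (α := V)
    rw [Fintype.card_fin, ← hn] at h4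
    have h5 : (count (fun f : Fin ℓ → V => ∀ i, f i ∈ Y \ U) : ℝ) ≤ #adm +
        (count (fun f : Fin ℓ → V => ¬ Function.Injective f) +
          count (fun f : Fin ℓ → V => (∀ i, f i ∈ Y) ∧ ¬ ok f)) := by exact_mod_cast h3
    have h6 : (0 : ℝ) ≤ (n : ℝ) ^ ℓ := by positivity
    nlinarith
  have hpos : (0 : ℝ) < #adm := lt_of_lt_of_le (by positivity) hadm
  have hne : adm.Nonempty := by
    rw [← card_pos]
    exact_mod_cast hpos
  have hΦ : 0 ≤ ∑ z, φ z := sum_nonneg fun z _ => hφ z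
  -- Some admissible tuple does no worse than the average, which is at most `b * n ^ ℓ` divided by
  -- `c ^ ℓ / 2 * n ^ ℓ`, times the total weight.
  obtain ⟨f, hf, hfw⟩ := exists_le_of_sum_le (s := adm)
    (f := fun f => ∑ z, φ z * w z f) (g := fun _ => 2 * b / c ^ ℓ * ∑ z, φ z) hne (by
      rw [sum_comm, sum_const, nsmul_eq_mul]
      calc ∑ z, ∑ f ∈ adm, φ z * w z f ≤ ∑ z, φ z * (b * (n : ℝ) ^ ℓ) := by
            refine sum_le_sum fun z _ => ?_
            rw [← mul_sum]
            refine mul_le_mul_of_nonneg_left ?_ (hφ z)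
            refine le_trans (sum_le_sum_of_subset_of_nonneg ?_ fun f _ _ => (hw z f).1) (hsum z)
            intro f hf
            simp only [adm, mem_filter, mem_univ, true_and, mem_sdiff] at hf
            exact Fintype.mem_piFinset.mpr fun i => (hf.1 i).1
        _ = c ^ ℓ / 2 * (n : ℝ) ^ ℓ * (2 * b / c ^ ℓ * ∑ z, φ z) := by
            rw [← sum_mul]
            field_simp
        _ ≤ #adm * (2 * b / c ^ ℓ * ∑ z, φ z) :=
            mul_le_mul_of_nonneg_right hadm (by positivity))
  simp only [adm, mem_filter, mem_univ, true_and, mem_sdiff] at hf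
  exact ⟨f, fun i => (hf.1 i).2, ⟨hf.2.1, fun i => (hf.1 i).1, hf.2.2⟩, hfw⟩

end Selection

/-! ### Hub partitions and typical ends. -/

section HubPartition

/-- The images of the families are disjoint in the target, so their sizes add up. The double
counting arguments below rest on this. -/
theorem sum_count_le {α β γ : Type*} [Fintype α] [Finite β] [Finite γ] (s : Finset α)
    (P : α → β → Prop) (Q : γ → Prop) (f : α → β → γ) (hf : ∀ a ∈ s, ∀ b, P a b → Q (f a b))
    (hinj : ∀ a ∈ s, ∀ a' ∈ s, ∀ b b', f a b = f a' b' → a = a' ∧ b = b') :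
    ∑ a ∈ s, count (P a) ≤ count Q := by
  classical
  have h1 : ∑ a ∈ s, count (P a) ≤ ∑ a, count (fun b => a ∈ s ∧ P a b) := by
    refine (sum_le_sum fun a ha => ?_).trans (sum_le_sum_of_subset (subset_univ s))
    exact count_mono fun b hb => ⟨ha, hb⟩
  rw [← count_prod (fun p : α × β => p.1 ∈ s ∧ P p.1 p.2)] at h1
  refine h1.trans (count_le_of_injOn (fun p => f p.1 p.2) (fun p hp => hf _ hp.1 _ hp.2) ?_)
  intro p q hp hq h
  exact Prod.ext_iff.mpr (hinj _ hp.1 _ hq.1 _ _ h)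

theorem count_exists_mem_le {V : Type*} [Fintype V] {I : Type*} [Fintype I] (U : Finset V) :
    count (fun g : I → V => ∃ i, g i ∈ U) ≤
      Fintype.card I * (#U * Fintype.card V ^ (Fintype.card I - 1)) := by
  refine (count_mono (Q := fun g : I → V => ∃ i ∈ univ, g i ∈ U)
    fun g ⟨i, hi⟩ => ⟨i, mem_univ _, hi⟩).trans ((count_exists_le _ _).trans ?_)
  refine (sum_le_card_nsmul _ _ _ fun i _ => count_apply_mem_le i U).trans ?_
  rw [smul_eq_mul, card_univ]

theorem cast_count_exists_mem_le {V : Type*} [Fintype V] [Nonempty V] {I : Type*} [Fintype I] (U : Finset V)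
    {β : ℝ} (hβ : Fintype.card I * (#U : ℝ) ≤ β * Fintype.card V) :
    (count (fun g : I → V => ∃ i, g i ∈ U) : ℝ) ≤
      β * (Fintype.card V : ℝ) ^ (Fintype.card I) := by
  have hn0 : (0 : ℝ) < Fintype.card V := by exact_mod_cast Fintype.card_pos
  rcases isEmpty_or_nonempty I with hI | hI
  · have h0 : count (fun g : I → V => ∃ i, g i ∈ U) = 0 := by
      rw [count, Nat.card_eq_zero]
      exact Or.inl ⟨fun f => by obtain ⟨i, -⟩ := f.2; exact hI.elim i⟩
    rw [h0, Nat.cast_zero]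
    rw [Fintype.card_eq_zero, Nat.cast_zero, zero_mul] at hβ
    have : 0 ≤ β := nonneg_of_mul_nonneg_left hβ hn0
    positivity
  · have h1 : (count (fun g : I → V => ∃ i, g i ∈ U) : ℝ) ≤
        Fintype.card I * (#U * (Fintype.card V : ℝ) ^ (Fintype.card I - 1)) := by
      exact_mod_cast count_exists_mem_le U
    have h2 : (Fintype.card V : ℝ) ^ Fintype.card I =
        Fintype.card V * (Fintype.card V : ℝ) ^ (Fintype.card I - 1) := by
      rw [← pow_succ', Nat.sub_add_cancel Fintype.card_pos]
    rw [h2, ← mul_assoc]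
    rw [← mul_assoc] at h1
    exact h1.trans (mul_le_mul_of_nonneg_right hβ (by positivity))

variable {V : Type*} [DecidableEq V] {k : ℕ}

/-- Index type for the vertices of an edge besides a distinguished one. -/
abbrev Rest (k ℓ : ℕ) : Type := Fin ℓ ⊕ Inner k ℓ

theorem card_rest {ℓ : ℕ} (hℓ : 1 ≤ ℓ) (hℓk : 2 * ℓ < k) : Fintype.card (Rest k ℓ) = k - 1 := by
  rw [Fintype.card_sum, card_inner hℓ hℓk, Fintype.card_fin]
  omega

/-- A partition of the vertices into hubs `G`, partial hubs `W` and ordinary vertices `Y`, such that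
almost all `k`-sets with one vertex in `G` and the others in `Y` are edges, and few edges lie
inside `Y`. -/
structure HubPartition [Fintype V] (H : KGraph V k) (ℓ : ℕ) (G W Y : Finset V) (ε₀ ε₁ δ : ℝ) :
    Prop where
  disjoint_hub_partial : Disjoint G W
  disjoint_hub_ordinary : Disjoint G Y
  disjoint_partial_ordinary : Disjoint W Y
  union : G ∪ W ∪ Y = univ
  card_partial : (#W : ℝ) ≤ δ * Fintype.card V
  balance : |2 * (k - ℓ : ℕ) * (#G + #W : ℝ) - Fintype.card V| ≤ δ * Fintype.card V
  hub : ∀ h ∈ G, (count (fun g : Rest k ℓ → V => (∀ i, g i ∈ Y) ∧ ¬ H.Joins h g) : ℝ) ≤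
    ε₀ * (Fintype.card V : ℝ) ^ (k - 1)
  partial_hub : ∀ w ∈ W, ε₁ / 2 * (Fintype.card V : ℝ) ^ (k - 1) ≤
    (count (fun g : Rest k ℓ → V => (∀ i, g i ∈ Y) ∧ H.Joins w g) : ℝ)
  inner : ∀ y ∈ Y, ∀ q, (count (fun p : V × (Rest k ℓ → V) =>
    p.1 ∈ G ∧ (∀ i, p.2 i ∈ Y) ∧ p.2 q = y ∧ ¬ H.Joins p.1 p.2) : ℝ) ≤
    4 * ε₁ * (Fintype.card V : ℝ) ^ (k - 1)
  sparse : ∀ y ∈ Y, (count (fun g : Rest k ℓ → V => (∀ i, g i ∈ Y) ∧ H.Joins y g) : ℝ) ≤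
    2 * ε₁ * (Fintype.card V : ℝ) ^ (k - 1)
  sparse_at : ∀ y ∈ Y, ∀ q, (count (fun p : V × (Rest k ℓ → V) =>
    p.1 ∈ Y ∧ (∀ i, p.2 i ∈ Y) ∧ p.2 q = y ∧ H.Joins p.1 p.2) : ℝ) ≤
    2 * ε₁ * (Fintype.card V : ℝ) ^ (k - 1)
  codegree : ∀ g : Rest k ℓ → V, Function.Injective g →
    Fintype.card V ≤ 2 * (k - ℓ) * count (fun v => H.Joins v g)

/-- An end is typical if it extends to an edge by most choices of a hub and vertices of `Y`. -/
def Typical [Fintype V] (H : KGraph V k) {ℓ : ℕ} (G Y : Finset V) (τ : ℝ) (P : Fin ℓ → V) : Prop :=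
  (H.endMiss G Y P : ℝ) ≤ τ * (Fintype.card V : ℝ) ^ (k - ℓ)

theorem Joins.card_eq {H : KGraph V k} {I : Type*} [Fintype I] {v : V} {g : I → V}
    (h : H.Joins v g) : #(insert v (univ.image g)) = k :=
  H.card_eq _ h

/-- The `k - 1` entries and `v` must produce `k` different vertices, which leaves no room for a
repetition. -/
theorem Joins.injective {H : KGraph V k} {I : Type*} [Fintype I] {v : V} {g : I → V}
    (h : H.Joins v g) (hI : Fintype.card I = k - 1) : Function.Injective g := by
  have h1 := h.card_eq
  have h2 := card_insert_le v (univ.image g)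
  have h3 := card_image_le (s := univ) (f := g)
  rw [card_univ, hI] at h3
  have h4 : #(univ.image g) = #(univ : Finset I) := by
    rw [card_univ, hI]
    omega
  intro a b hab
  exact card_image_iff.mp h4 (mem_univ a) (mem_univ b) hab

theorem Joins.ne {H : KGraph V k} {I : Type*} [Fintype I] {v : V} {g : I → V}
    (h : H.Joins v g) (hI : Fintype.card I = k - 1) (hk : 1 ≤ k) (i : I) : g i ≠ v := by
  rintro rfl
  have h1 := h.card_eq
  rw [insert_eq_of_mem (mem_image_of_mem _ (mem_univ i))] at h1
  have h3 := card_image_le (s := univ) (f := g)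
  rw [card_univ, hI] at h3
  omega

namespace HubPartition

variable [Fintype V] {H : KGraph V k} {ℓ : ℕ} {G W Y : Finset V} {ε₀ ε₁ δ : ℝ}

/-- Double counting: all hubs together miss at most `ε₀ * n ^ k` tuples of `Y`, while each atypical
end accounts for more than `τ * n ^ (k - ℓ)` of these misses. -/
theorem count_atypical_le (hp : H.HubPartition ℓ G W Y ε₀ ε₁ δ) (hℓ : 1 ≤ ℓ) (hℓk : 2 * ℓ < k)
    [Nonempty V] (hε₀ : 0 ≤ ε₀) {τ : ℝ} (hτ : 0 < τ) :
    (count (fun P : Fin ℓ → V => (∀ i, P i ∈ Y) ∧ ¬ H.Typical G Y τ P) : ℝ) ≤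
      ε₀ / τ * (Fintype.card V : ℝ) ^ ℓ := by
  classical
  set n := Fintype.card V with hn
  have hn0 : (0 : ℝ) < n := by exact_mod_cast Fintype.card_pos
  set S : Finset (Fin ℓ → V) := {P | (∀ i, P i ∈ Y) ∧ ¬ H.Typical G Y τ P} with hS
  have h1 : ∑ P ∈ S, H.endMiss G Y P ≤ count (fun p : V × (Rest k ℓ → V) =>
      p.1 ∈ G ∧ (∀ i, p.2 i ∈ Y) ∧ ¬ H.Joins p.1 p.2) := by
    refine sum_count_le S _ _ (fun P p => (p.1, Sum.elim P p.2)) ?_ ?_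
    · intro P hP p hp
      simp only [hS, mem_filter, mem_univ, true_and] at hP
      exact ⟨hp.1, Sum.forall.mpr ⟨hP.1, hp.2.1⟩, hp.2.2⟩
    · intro P _ P' _ p p' h
      have h1 := congrArg Prod.fst h
      have h2 := congrArg Prod.snd h
      exact ⟨funext fun i => congrFun h2 (Sum.inl i),
        Prod.ext h1 (funext fun i => congrFun h2 (Sum.inr i))⟩
  have h2 : (count (fun p : V × (Rest k ℓ → V) =>
      p.1 ∈ G ∧ (∀ i, p.2 i ∈ Y) ∧ ¬ H.Joins p.1 p.2) : ℝ) ≤ n * (ε₀ * (n : ℝ) ^ (k - 1)) := by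
    rw [count_prod]
    push_cast
    refine (sum_le_card_nsmul _ _ (ε₀ * (n : ℝ) ^ (k - 1)) fun h _ => ?_).trans ?_
    · by_cases hh : h ∈ G
      · refine le_trans ?_ (hp.hub h hh)
        exact Nat.cast_le.mpr (count_mono fun g hg => hg.2)
      · have : count (fun b : Rest k ℓ → V => h ∈ G ∧ (∀ i, b i ∈ Y) ∧ ¬ H.Joins h b) = 0 := by
          rw [count, Nat.card_eq_zero]
          exact Or.inl ⟨fun x => hh x.2.1⟩
        rw [this, Nat.cast_zero]
        positivity
    · rw [nsmul_eq_mul, card_univ]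
  have h3 : (#S : ℝ) * (τ * (n : ℝ) ^ (k - ℓ)) ≤ ∑ P ∈ S, (H.endMiss G Y P : ℝ) := by
    rw [← nsmul_eq_mul]
    refine card_nsmul_le_sum _ _ _ fun P hP => ?_
    simp only [hS, mem_filter, mem_univ, true_and, Typical, not_le] at hP
    exact hP.2.le
  have h4 : (∑ P ∈ S, (H.endMiss G Y P : ℝ)) ≤ n * (ε₀ * (n : ℝ) ^ (k - 1)) := by
    refine le_trans ?_ h2
    exact_mod_cast h1
  rw [count_eq_card, ← hS]
  have h5 : (n : ℝ) * (ε₀ * (n : ℝ) ^ (k - 1)) = ε₀ / τ * (n : ℝ) ^ ℓ * (τ * (n : ℝ) ^ (k - ℓ)) := by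
    have : (n : ℝ) ^ ℓ * (n : ℝ) ^ (k - ℓ) = n * (n : ℝ) ^ (k - 1) := by
      rw [← pow_add, ← pow_succ']
      congr 1
      omega
    calc (n : ℝ) * (ε₀ * (n : ℝ) ^ (k - 1)) = ε₀ * (n * (n : ℝ) ^ (k - 1)) := by ring
      _ = ε₀ / τ * τ * ((n : ℝ) ^ ℓ * (n : ℝ) ^ (k - ℓ)) := by
        rw [this, div_mul_cancel₀ _ hτ.ne']
      _ = _ := by ring
  rw [h5] at h4
  exact le_of_mul_le_mul_right (h3.trans h4) (by positivity)

theorem count_atypical_comp_le (hp : H.HubPartition ℓ G W Y ε₀ ε₁ δ) (hℓ : 1 ≤ ℓ)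
    (hℓk : 2 * ℓ < k) [Nonempty V] (hε₀ : 0 ≤ ε₀) {τ : ℝ} (hτ : 0 < τ) (e : Fin ℓ → Rest k ℓ)
    (he : Function.Injective e) :
    (count (fun g : Rest k ℓ → V => (∀ i, g i ∈ Y) ∧ ¬ H.Typical G Y τ (g ∘ e)) : ℝ) ≤
      ε₀ / τ * (Fintype.card V : ℝ) ^ (k - 1) := by
  have h1 := count_comp_le e he
    (fun P : Fin ℓ → V => (∀ i, P i ∈ Y) ∧ ¬ H.Typical G Y τ P)
  have h2 : count (fun g : Rest k ℓ → V => (∀ i, g i ∈ Y) ∧ ¬ H.Typical G Y τ (g ∘ e)) ≤ _ :=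
    (count_mono fun g hg => ⟨fun i => hg.1 (e i), hg.2⟩).trans h1
  have h3 := hp.count_atypical_le hℓ hℓk hε₀ hτ
  rw [card_rest hℓ hℓk, Fintype.card_fin] at h2
  have h4 : (Fintype.card V : ℝ) ^ (k - 1) =
      (Fintype.card V : ℝ) ^ ℓ * (Fintype.card V : ℝ) ^ (k - 1 - ℓ) := by
    rw [← pow_add]
    congr 1
    omega
  rw [h4, ← mul_assoc]
  calc (count (fun g : Rest k ℓ → V => (∀ i, g i ∈ Y) ∧ ¬ H.Typical G Y τ (g ∘ e)) : ℝ)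
      ≤ (count (fun P : Fin ℓ → V => (∀ i, P i ∈ Y) ∧ ¬ H.Typical G Y τ P) : ℝ) *
          (Fintype.card V : ℝ) ^ (k - 1 - ℓ) := by exact_mod_cast h2
    _ ≤ _ := mul_le_mul_of_nonneg_right h3 (by positivity)

theorem card_ordinary (hp : H.HubPartition ℓ G W Y ε₀ ε₁ δ) :
    #G + #W + #Y = Fintype.card V := by
  rw [← card_univ, ← hp.union, card_union_of_disjoint, card_union_of_disjoint
    hp.disjoint_hub_partial]
  exact disjoint_union_left.mpr ⟨hp.disjoint_hub_ordinary, hp.disjoint_partial_ordinary⟩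

/-- By `balance` there are at most `(1 + δ) * n / (2 * (k - ℓ))` hubs and partial hubs, and `k - ℓ ≥
2`. -/
theorem half_le_card_ordinary (hp : H.HubPartition ℓ G W Y ε₀ ε₁ δ) (hℓ : 1 ≤ ℓ)
    (hℓk : 2 * ℓ < k) (hδ : δ ≤ 1) : (Fintype.card V : ℝ) / 2 ≤ #Y := by
  have h1 : (#G + #W + #Y : ℝ) = Fintype.card V := by exact_mod_cast hp.card_ordinary
  have h2 := (abs_le.mp hp.balance).2
  have h3 : (2 : ℝ) ≤ (k - ℓ : ℕ) := by
    have : 2 ≤ k - ℓ := by omega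
    exact_mod_cast this
  have h4 : (0 : ℝ) ≤ #G + #W := by positivity
  have h5 : (0 : ℝ) ≤ Fintype.card V := by positivity
  nlinarith

end HubPartition

/-- An edge with two disjoint ends is a piece. -/
theorem exists_piece_of_joins {H : KGraph V k} {ℓ : ℕ} (hℓ : 1 ≤ ℓ) (hℓk : 2 * ℓ < k) {v : V}
    {g : Rest k ℓ → V} (hg : H.Joins v g) (j : Fin ℓ → Inner k ℓ) (hj : Function.Injective j) :
    ∃ p : H.Piece ℓ, p.start = g ∘ Sum.inl ∧ p.finish = g ∘ (Sum.inr ∘ j) ∧ p.blocks.length = 1 ∧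
      p.supp = insert v (univ.image g) := by
  have hinj := hg.injective (card_rest hℓ hℓk)
  set A := univ.image (g ∘ Sum.inl) with hA
  set B := univ.image (g ∘ (Sum.inr ∘ j)) with hB
  set E := insert v (univ.image g) with hE
  have hAE : A ⊆ E := by
    intro x hx
    obtain ⟨i, -, rfl⟩ := mem_image.mp hx
    exact mem_insert_of_mem (mem_image_of_mem _ (mem_univ _))
  have hBE : B ⊆ E := by
    intro x hx
    obtain ⟨i, -, rfl⟩ := mem_image.mp hx
    exact mem_insert_of_mem (mem_image_of_mem _ (mem_univ _))
  have hAB : Disjoint A B := by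
    rw [disjoint_left]
    intro x hx hx'
    obtain ⟨a, -, rfl⟩ := mem_image.mp hx
    obtain ⟨b, -, hb⟩ := mem_image.mp hx'
    simpa using hinj hb
  have hAc : #A = ℓ := by
    rw [hA, card_image_of_injective _ (hinj.comp Sum.inl_injective), card_univ, Fintype.card_fin]
  have hBc : #B = ℓ := by
    rw [hB, card_image_of_injective _ (hinj.comp (Sum.inr_injective.comp hj)), card_univ,
      Fintype.card_fin]
  have hEc : #E = k := hg.card_eq
  have hM : #(E \ (A ∪ B)) = k - 2 * ℓ := by
    rw [card_sdiff_of_subset (union_subset hAE hBE), card_union_of_disjoint hAB]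
    omega
  refine ⟨⟨g ∘ Sum.inl, g ∘ (Sum.inr ∘ j), [(A, E \ (A ∪ B))], E, ⟨rfl, B, ?_, rfl⟩, ?_, ?_, ?_⟩,
    rfl, rfl, rfl, rfl⟩
  · have : A ∪ E \ (A ∪ B) ∪ B = E := by
      ext x
      have h1 := @hAE x
      have h2 := @hBE x
      simp only [mem_union, mem_sdiff]
      tauto
    simp only [this]
    exact hg
  · intro b hb
    rw [List.mem_singleton] at hb
    subst hb
    exact ⟨hAc.le, hM.le⟩
  · intro x hx
    by_cases h : x ∈ B
    · exact Or.inl h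
    · refine Or.inr ⟨_, List.mem_singleton_self _, ?_⟩
      simp only [mem_sdiff, mem_union]
      tauto
  · rw [hEc, List.length_singleton]
    omega

/-- Two edges sharing a hub and `ℓ - 1` further vertices form a piece. -/
theorem exists_piece_of_joins_joins {H : KGraph V k} {ℓ : ℕ} (hℓ : 1 ≤ ℓ) (hℓk : 2 * ℓ < k) {w : V}
    {P Q : Fin ℓ → V} {M M' : Fin (k - 2 * ℓ) → V} {R : Fin (ℓ - 1) → V}
    (h1 : H.Joins w (Sum.elim P (Sum.elim M R))) (h2 : H.Joins w (Sum.elim Q (Sum.elim M' R)))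
    (hd : ∀ a b, Sum.elim P M a ≠ Sum.elim Q M' b) :
    ∃ p : H.Piece ℓ, p.start = P ∧ p.finish = Q ∧ p.blocks.length = 2 ∧
      p.supp = insert w (univ.image (Sum.elim P (Sum.elim M R))) ∪
        univ.image (Sum.elim Q M') := by
  have hc := card_rest hℓ hℓk
  have hinj2 := h2.injective hc
  have hQM : Function.Injective (Sum.elim Q M') := by
    have h3 : Sum.elim Q M' = Sum.elim Q (Sum.elim M' R) ∘ Sum.map id Sum.inl := by
      funext x
      rcases x with x | x <;> rfl
    rw [h3]
    exact hinj2.comp (Sum.map_injective.mpr ⟨Function.injective_id, Sum.inl_injective⟩)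
  -- Exactly `Q` and `M'` are new in the second edge: `hd` keeps them away from `P` and `M`, and the
  -- second edge having `k` vertices keeps them away from `w` and `R`.
  have hdisj : Disjoint (insert w (univ.image (Sum.elim P (Sum.elim M R))))
      (univ.image (Sum.elim Q M')) := by
    rw [disjoint_left]
    intro x hx hx'
    obtain ⟨b, -, rfl⟩ := mem_image.mp hx'
    have hb : Sum.elim Q M' b = Sum.elim Q (Sum.elim M' R) (Sum.map id Sum.inl b) := by
      rcases b with b | b <;> rfl
    rcases mem_insert.mp hx with hx | hx
    · rw [hb] at hx
      exact h2.ne hc (by omega) _ hx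
    · obtain ⟨a, -, ha⟩ := mem_image.mp hx
      rcases a with a | a | a
      · exact hd (Sum.inl a) b ha
      · exact hd (Sum.inr a) b ha
      · rw [hb] at ha
        have := hinj2 (show Sum.elim Q (Sum.elim M' R) (Sum.inr (Sum.inr a)) = _ from ha)
        rcases b with b | b <;> simp at this
  have himg : ∀ (n : ℕ) (f : Fin n → V), #(univ.image f) ≤ n := fun n f => by
    simpa using card_image_le (s := univ) (f := f)
  refine ⟨⟨P, Q, [(univ.image P, univ.image M), (insert w (univ.image R), univ.image M')], _,
    ⟨rfl, _, edge_of_joins h1, rfl, univ.image Q, ?_, rfl⟩, ?_, ?_, ?_⟩, rfl, rfl, rfl, rfl⟩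
  · have := edge_of_joins h2
    simp only [Sum.elim_inl, Sum.elim_inr] at this
    convert this using 1
    ext v
    simp only [mem_union]
    tauto
  · intro b hb
    simp only [List.mem_cons, List.not_mem_nil, or_false] at hb
    rcases hb with rfl | rfl
    · exact ⟨himg _ _, himg _ _⟩
    · refine ⟨(card_insert_le _ _).trans ?_, himg _ _⟩
      have := himg _ R
      omega
  · intro x hx
    simp only [mem_union, mem_insert, mem_image, mem_univ, true_and, Sum.exists, Sum.elim_inl,
      Sum.elim_inr] at hx
    simp only [List.mem_cons, List.not_mem_nil, or_false, exists_eq_or_imp, exists_eq_left,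
      mem_insert, mem_image, mem_univ, true_and]
    tauto
  · rw [card_union_of_disjoint hdisj, h1.card_eq, card_image_of_injective _ hQM, card_univ,
      Fintype.card_sum, Fintype.card_fin, Fintype.card_fin]
    simp only [List.length_cons, List.length_nil]
    omega

end HubPartition

/-! ### Pieces through partial hubs, through hubs, and inside the ordinary vertices. -/

section SpecialPieces

variable {V : Type*} [DecidableEq V] {k : ℕ}

namespace HubPartition

variable [Fintype V] {H : KGraph V k} {ℓ : ℕ} {G W Y : Finset V} {ε₀ ε₁ δ : ℝ}

/-- A partial hub lies in the middle of a piece with two edges whose ends are typical. -/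
theorem exists_partial_hub_piece (hp : H.HubPartition ℓ G W Y ε₀ ε₁ δ) (hℓ : 1 ≤ ℓ)
    (hℓk : 2 * ℓ < k) (hε₀ : 0 ≤ ε₀) {τ : ℝ} (hτ : 0 < τ) (hε₁ : 0 < ε₁)
    (hα : ε₀ / τ ≤ ε₁ / 16) (hn : 4 * (k : ℝ) ^ 2 < ε₁ * Fintype.card V) {w : V} (hw : w ∈ W)
    (U : Finset V) (hU : 8 * k * (#U : ℝ) ≤ ε₁ * Fintype.card V) :
    ∃ p : H.Piece ℓ, (H.Typical G Y τ p.start ∧ H.Typical G Y τ p.finish) ∧ p.blocks.length = 2 ∧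
      w ∈ p.supp ∧ p.supp ⊆ insert w Y ∧ Disjoint (p.supp ∩ Y) U := by
  have : Nonempty V := ⟨w⟩
  set n := Fintype.card V with hn'
  have hn0 : (0 : ℝ) < n := by exact_mod_cast Fintype.card_pos
  have hkn : (1 : ℝ) ≤ k := by exact_mod_cast (by omega : 1 ≤ k)
  have hcR := card_rest hℓ hℓk
  -- Of the density `ε₁ / 2` of edges at `w`, atypical ends cost at most `ε₁ / 16` and the vertices
  -- of `U` at most `ε₁ / 8`, so `ε₁ / 4` is left.
  let E : (Rest k ℓ → V) → Prop := fun g => (∀ i, g i ∈ Y) ∧ H.Joins w g ∧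
    H.Typical G Y τ (g ∘ Sum.inl) ∧ ∀ i, g i ∉ U
  have hE : ε₁ / 4 * (n : ℝ) ^ (k - 1) ≤ count E := by
    have h1 := hp.partial_hub w hw
    have h2 := hp.count_atypical_comp_le hℓ hℓk hε₀ hτ Sum.inl Sum.inl_injective
    have h3 : (count (fun g : Rest k ℓ → V => ∃ i, g i ∈ U) : ℝ) ≤
        ε₁ / 8 * (n : ℝ) ^ (k - 1) := by
      rw [← hcR]
      refine cast_count_exists_mem_le U ?_
      have : (Fintype.card (Rest k ℓ) : ℝ) ≤ k := by
        rw [hcR]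
        exact_mod_cast Nat.sub_le k 1
      have h4 : (Fintype.card (Rest k ℓ) : ℝ) * #U ≤ k * #U :=
        mul_le_mul_of_nonneg_right this (by positivity)
      linarith
    have h4 : (count (fun g : Rest k ℓ → V => (∀ i, g i ∈ Y) ∧ H.Joins w g) : ℝ) ≤ count E +
        (count (fun g : Rest k ℓ → V => (∀ i, g i ∈ Y) ∧ ¬ H.Typical G Y τ (g ∘ Sum.inl)) +
          count (fun g : Rest k ℓ → V => ∃ i, g i ∈ U)) := by
      norm_cast
      refine (count_mono fun g hg => ?_).trans ((count_or_le _ _).trans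
        (Nat.add_le_add_left (count_or_le _ _) _))
      by_cases ht : H.Typical G Y τ (g ∘ Sum.inl)
      · by_cases hu : ∃ i, g i ∈ U
        · exact Or.inr (Or.inr hu)
        · exact Or.inl ⟨hg.1, hg.2, ht, by simpa using hu⟩
      · exact Or.inr (Or.inl ⟨hg.1, ht⟩)
    have h5 : (0 : ℝ) < (n : ℝ) ^ (k - 1) := by positivity
    nlinarith
  let F : (Fin (ℓ - 1) → V) → (Fin ℓ ⊕ Fin (k - 2 * ℓ) → V) → Prop := fun R S =>
    E (Sum.elim (S ∘ Sum.inl) (Sum.elim (S ∘ Sum.inr) R))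
  have hF : count E ≤ ∑ R, count (F R) := by
    rw [← count_prod (fun p : (Fin (ℓ - 1) → V) × (Fin ℓ ⊕ Fin (k - 2 * ℓ) → V) => F p.1 p.2)]
    refine count_le_of_injOn (fun g => (fun i => g (Sum.inr (Sum.inr i)),
      Sum.elim (fun i => g (Sum.inl i)) (fun i => g (Sum.inr (Sum.inl i))))) ?_ ?_
    · intro g hg
      simp only [F]
      convert hg using 1
      funext i
      rcases i with i | i | i <;> rfl
    · intro g g' _ _ h
      have h1 := congrArg Prod.fst h
      have h2 := congrArg Prod.snd h
      funext i
      rcases i with i | i | i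
      · exact congrFun h2 (Sum.inl i)
      · exact congrFun h2 (Sum.inr i)
      · exact congrFun h1 i
  -- Averaging over the `ℓ - 1` vertices that the two edges share besides `w` gives one `R` with at
  -- least `ε₁ / 4 * n ^ (k - ℓ)` extensions. Fewer than that meet a given extension `S`, so a
  -- second one is disjoint from it.
  obtain ⟨R, -, hR⟩ := exists_le_of_sum_le (s := (univ : Finset (Fin (ℓ - 1) → V)))
    (f := fun _ => ε₁ / 4 * (n : ℝ) ^ (k - ℓ)) (g := fun R => (count (F R) : ℝ))
    ⟨fun _ => w, mem_univ _⟩ (by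
      rw [sum_const, card_univ, Fintype.card_fun, Fintype.card_fin, nsmul_eq_mul]
      have h1 : (count E : ℝ) ≤ ∑ R, (count (F R) : ℝ) := by exact_mod_cast hF
      refine le_trans (le_of_eq ?_) (hE.trans h1)
      push_cast
      rw [mul_left_comm, ← pow_add]
      congr 2
      omega)
  have hFpos : 0 < count (F R) := by
    have : (0 : ℝ) < count (F R) := lt_of_lt_of_le (by positivity) hR
    exact_mod_cast this
  obtain ⟨S, hS, -⟩ := exists_of_count_lt (P := F R) (Q := fun _ => False) (by
    simpa [count] using hFpos)
  have hhit : count (fun S' : Fin ℓ ⊕ Fin (k - 2 * ℓ) → V => ∃ i, S' i ∈ univ.image S) <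
      count (F R) := by
    have hcS : Fintype.card (Fin ℓ ⊕ Fin (k - 2 * ℓ)) = k - ℓ := by
      rw [Fintype.card_sum, Fintype.card_fin, Fintype.card_fin]
      omega
    have h1 := cast_count_exists_mem_le (I := Fin ℓ ⊕ Fin (k - 2 * ℓ)) (univ.image S)
      (β := (k : ℝ) ^ 2 / n) (by
        rw [div_mul_cancel₀ _ hn0.ne', sq]
        have h2 : #(univ.image S) ≤ k := by
          refine card_image_le.trans ?_
          rw [card_univ, hcS]
          omega
        have h3 : Fintype.card (Fin ℓ ⊕ Fin (k - 2 * ℓ)) ≤ k := by omega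
        exact_mod_cast Nat.mul_le_mul h3 h2)
    rw [hcS] at h1
    have h2 : (k : ℝ) ^ 2 / n < ε₁ / 4 := by
      rw [div_lt_iff₀ hn0]
      linarith
    have h3 : (count (fun S' : Fin ℓ ⊕ Fin (k - 2 * ℓ) → V => ∃ i, S' i ∈ univ.image S) : ℝ) <
        count (F R) :=
      lt_of_le_of_lt h1 (lt_of_lt_of_le (mul_lt_mul_of_pos_right h2 (by positivity)) hR)
    exact_mod_cast h3
  obtain ⟨S', hS', hne⟩ := exists_of_count_lt hhit
  obtain ⟨hY, hj, ht, hUn⟩ := hS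
  obtain ⟨hY', hj', ht', hUn'⟩ := hS'
  obtain ⟨p, hp1, hp2, hp3, hp4⟩ := exists_piece_of_joins_joins hℓ hℓk hj hj' (by
    intro a b hab
    refine hne ⟨b, ?_⟩
    simp only [Sum.elim_comp_inl_inr] at hab
    rw [← hab]
    exact mem_image_of_mem _ (mem_univ a))
  simp only [Sum.elim_comp_inl_inr] at hp4
  have hsub : ∀ v ∈ p.supp, v = w ∨ v ∈ Y ∧ v ∉ U := by
    intro v hv
    rw [hp4] at hv
    rcases mem_union.mp hv with hv | hv
    · rcases mem_insert.mp hv with hv | hv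
      · exact Or.inl hv
      · obtain ⟨i, -, rfl⟩ := mem_image.mp hv
        exact Or.inr ⟨hY i, hUn i⟩
    · obtain ⟨i, -, rfl⟩ := mem_image.mp hv
      rcases i with i | i
      · exact Or.inr ⟨hY' (Sum.inl i), hUn' (Sum.inl i)⟩
      · exact Or.inr ⟨hY' (Sum.inr (Sum.inl i)), hUn' (Sum.inr (Sum.inl i))⟩
  refine ⟨p, ⟨?_, ?_⟩, hp3, ?_, ?_, ?_⟩
  · rw [hp1]
    exact ht
  · rw [hp2]
    exact ht'
  · rw [hp4]
    exact mem_union_left _ (mem_insert_self _ _)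
  · intro v hv
    rcases hsub v hv with h | h
    · exact mem_insert.mpr (Or.inl h)
    · exact mem_insert.mpr (Or.inr h.1)
  · rw [disjoint_left]
    intro v hv
    obtain ⟨hv1, hv2⟩ := mem_inter.mp hv
    rcases hsub v hv1 with rfl | h
    · exact absurd hv2 (disjoint_left.mp hp.disjoint_partial_ordinary hw)
    · exact h.2

/-- Most tuples in `Y` have two disjoint typical ends. -/
theorem count_typical_ge (hp : H.HubPartition ℓ G W Y ε₀ ε₁ δ) (hℓ : 1 ≤ ℓ)
    (hℓk : 2 * ℓ < k) [Nonempty V] (hδ : δ ≤ 1) (hε₀ : 0 ≤ ε₀) {τ : ℝ} (hτ : 0 < τ)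
    (j : Fin ℓ → Inner k ℓ) (hj : Function.Injective j) :
    ((1 / 2 : ℝ) ^ (k - 1) - 2 * (ε₀ / τ)) * (Fintype.card V : ℝ) ^ (k - 1) ≤
      count (fun g : Rest k ℓ → V => (∀ i, g i ∈ Y) ∧ H.Typical G Y τ (g ∘ Sum.inl) ∧
        H.Typical G Y τ (g ∘ (Sum.inr ∘ j))) := by
  have h1 := hp.count_atypical_comp_le hℓ hℓk hε₀ hτ Sum.inl Sum.inl_injective
  have h2 := hp.count_atypical_comp_le hℓ hℓk hε₀ hτ (Sum.inr ∘ j) (Sum.inr_injective.comp hj)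
  have h3 : (1 / 2 : ℝ) ^ (k - 1) * (Fintype.card V : ℝ) ^ (k - 1) ≤
      count (fun g : Rest k ℓ → V => ∀ i, g i ∈ Y) := by
    rw [count_forall_mem, card_rest hℓ hℓk, ← mul_pow]
    push_cast
    refine pow_le_pow_left₀ (by positivity) ?_ _
    have := hp.half_le_card_ordinary hℓ hℓk hδ
    linarith
  have h4 : (count (fun g : Rest k ℓ → V => ∀ i, g i ∈ Y) : ℝ) ≤
      count (fun g : Rest k ℓ → V => (∀ i, g i ∈ Y) ∧ H.Typical G Y τ (g ∘ Sum.inl) ∧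
        H.Typical G Y τ (g ∘ (Sum.inr ∘ j))) +
      (count (fun g : Rest k ℓ → V => (∀ i, g i ∈ Y) ∧ ¬ H.Typical G Y τ (g ∘ Sum.inl)) +
        count (fun g : Rest k ℓ → V => (∀ i, g i ∈ Y) ∧
          ¬ H.Typical G Y τ (g ∘ (Sum.inr ∘ j)))) := by
    norm_cast
    refine (count_mono fun g hg => ?_).trans ((count_or_le _ _).trans
      (Nat.add_le_add_left (count_or_le _ _) _))
    tauto
  linarith

/-- A hub together with ordinary vertices forms a piece with one edge whose ends are typical. -/
theorem exists_hub_piece (hp : H.HubPartition ℓ G W Y ε₀ ε₁ δ) (hℓ : 1 ≤ ℓ)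
    (hℓk : 2 * ℓ < k) (hδ : δ ≤ 1) (hε₀ : 0 ≤ ε₀) {τ : ℝ} (hτ : 0 < τ)
    (hsmall : 2 * (ε₀ / τ) + ε₀ + ε₁ / 8 < (1 / 2 : ℝ) ^ (k - 1)) {h : V} (hh : h ∈ G)
    (U : Finset V) (hU : 8 * k * (#U : ℝ) ≤ ε₁ * Fintype.card V) :
    ∃ p : H.Piece ℓ, (H.Typical G Y τ p.start ∧ H.Typical G Y τ p.finish) ∧ p.blocks.length = 1 ∧
      h ∈ p.supp ∧ p.supp ⊆ insert h Y ∧ Disjoint (p.supp ∩ Y) U := by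
  have : Nonempty V := ⟨h⟩
  set n := Fintype.card V with hn'
  have hn0 : (0 : ℝ) < n := by exact_mod_cast Fintype.card_pos
  have hcR := card_rest hℓ hℓk
  -- Besides the first end and the distinguished vertex, an edge has `k - ℓ - 1 ≥ ℓ` vertices,
  -- enough for a second end.
  obtain ⟨⟨j, hj⟩⟩ : Nonempty (Fin ℓ ↪ Inner k ℓ) := by
    rw [Function.Embedding.nonempty_iff_card_le, Fintype.card_fin, card_inner hℓ hℓk]
    omega
  have h1 := hp.count_typical_ge hℓ hℓk hδ hε₀ hτ j hj
  have h2 := hp.hub h hh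
  have h3 : (count (fun g : Rest k ℓ → V => ∃ i, g i ∈ U) : ℝ) ≤
      ε₁ / 8 * (n : ℝ) ^ (k - 1) := by
    rw [← hcR]
    refine cast_count_exists_mem_le U ?_
    have : (Fintype.card (Rest k ℓ) : ℝ) ≤ k := by
      rw [hcR]
      exact_mod_cast Nat.sub_le k 1
    have h4 : (Fintype.card (Rest k ℓ) : ℝ) * #U ≤ k * #U :=
      mul_le_mul_of_nonneg_right this (by positivity)
    linarith
  have h4 : count (fun g : Rest k ℓ → V => ((∀ i, g i ∈ Y) ∧ ¬ H.Joins h g) ∨ ∃ i, g i ∈ U) <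
      count (fun g : Rest k ℓ → V => (∀ i, g i ∈ Y) ∧ H.Typical G Y τ (g ∘ Sum.inl) ∧
        H.Typical G Y τ (g ∘ (Sum.inr ∘ j))) := by
    have h5 : (count (fun g : Rest k ℓ → V =>
        ((∀ i, g i ∈ Y) ∧ ¬ H.Joins h g) ∨ ∃ i, g i ∈ U) : ℝ) ≤ _ :=
      Nat.cast_le.mpr (count_or_le _ _)
    push_cast at h5
    have h6 : (0 : ℝ) < (n : ℝ) ^ (k - 1) := by positivity
    have h7 : (count (fun g : Rest k ℓ → V =>
        ((∀ i, g i ∈ Y) ∧ ¬ H.Joins h g) ∨ ∃ i, g i ∈ U) : ℝ) <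
        count (fun g : Rest k ℓ → V => (∀ i, g i ∈ Y) ∧ H.Typical G Y τ (g ∘ Sum.inl) ∧
        H.Typical G Y τ (g ∘ (Sum.inr ∘ j))) := by nlinarith
    exact_mod_cast h7
  obtain ⟨g, ⟨hY, ht1, ht2⟩, hg⟩ := exists_of_count_lt h4
  push Not at hg
  have hjoin : H.Joins h g := hg.1 hY
  obtain ⟨p, hp1, hp2, hp3, hp4⟩ := exists_piece_of_joins hℓ hℓk hjoin j hj
  refine ⟨p, ⟨by rw [hp1]; exact ht1, by rw [hp2]; exact ht2⟩, hp3, ?_, ?_, ?_⟩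
  · rw [hp4]
    exact mem_insert_self _ _
  · rw [hp4]
    refine insert_subset_insert _ fun v hv => ?_
    obtain ⟨i, -, rfl⟩ := mem_image.mp hv
    exact hY i
  · rw [disjoint_left]
    intro v hv
    obtain ⟨hv1, hv2⟩ := mem_inter.mp hv
    rw [hp4] at hv1
    rcases mem_insert.mp hv1 with rfl | hv1
    · exact absurd hv2 (disjoint_left.mp hp.disjoint_hub_ordinary hh)
    · obtain ⟨i, -, rfl⟩ := mem_image.mp hv1
      exact hg.2 i

/-- If there are too few hubs, then there are many disjoint edges inside `Y` with typical ends. -/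
theorem exists_ordinary_piece (hp : H.HubPartition ℓ G W Y ε₀ ε₁ δ) (hℓ : 1 ≤ ℓ)
    (hℓk : 2 * ℓ < k) [Nonempty V] (hδ : δ ≤ 1) (hε₀ : 0 ≤ ε₀) {τ : ℝ} (hτ : 0 < τ)
    (hε₁ : 0 ≤ ε₁)
    (hsmall : 2 * (ε₀ / τ) + (k : ℝ) ^ 2 / Fintype.card V + 4 * (k : ℝ) ^ 2 * ε₁ <
      (1 / 2 : ℝ) ^ (k - 1))
    {s : ℕ} (hs : 0 < s)
    (hcount : (2 * (#G + #W) + s) * (k - ℓ) = Fintype.card V) (U : Finset V) (hU : #U ≤ k * s) :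
    ∃ p : H.Piece ℓ, (H.Typical G Y τ p.start ∧ H.Typical G Y τ p.finish) ∧ p.blocks.length = 1 ∧
      p.supp ⊆ Y ∧ Disjoint p.supp U := by
  classical
  set n := Fintype.card V with hn'
  have hn0 : (0 : ℝ) < n := by exact_mod_cast Fintype.card_pos
  have hcR := card_rest hℓ hℓk
  have hpow : (0 : ℝ) < (n : ℝ) ^ (k - 1) := by positivity
  obtain ⟨⟨j, hj⟩⟩ : Nonempty (Fin ℓ ↪ Inner k ℓ) := by
    rw [Function.Embedding.nonempty_iff_card_le, Fintype.card_fin, card_inner hℓ hℓk]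
    omega
  set T : Finset (Rest k ℓ → V) := {g | Function.Injective g ∧ (∀ i, g i ∈ Y) ∧
    H.Typical G Y τ (g ∘ Sum.inl) ∧ H.Typical G Y τ (g ∘ (Sum.inr ∘ j))} with hT
  have hTcard : ((1 / 2 : ℝ) ^ (k - 1) - 2 * (ε₀ / τ) - (k : ℝ) ^ 2 / n) * (n : ℝ) ^ (k - 1) ≤
      #T := by
    have h1 := hp.count_typical_ge hℓ hℓk hδ hε₀ hτ j hj
    have h2 := cast_count_not_injective_le (I := Rest k ℓ) (α := V)
    have h3 : (count (fun g : Rest k ℓ → V => (∀ i, g i ∈ Y) ∧ H.Typical G Y τ (g ∘ Sum.inl) ∧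
        H.Typical G Y τ (g ∘ (Sum.inr ∘ j))) : ℝ) ≤
        #T + count (fun g : Rest k ℓ → V => ¬ Function.Injective g) := by
      rw [← count_mem T]
      norm_cast
      refine (count_mono fun g hg => ?_).trans (count_or_le _ _)
      simp only [hT, mem_filter, mem_univ, true_and]
      tauto
    rw [hcR] at h2
    have h4 : ((k - 1 : ℕ) : ℝ) ^ 2 / n ≤ (k : ℝ) ^ 2 / n := by
      have : k - 1 ≤ k := Nat.sub_le k 1
      gcongr
    have h5 := mul_le_mul_of_nonneg_right h4 hpow.le
    rw [← hn'] at h1 h2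
    nlinarith
  let A : V × (Rest k ℓ → V) → Prop := fun p => p.1 ∈ Y ∧ (∀ i, p.2 i ∈ Y) ∧ H.Joins p.1 p.2 ∧
    H.Typical G Y τ (p.2 ∘ Sum.inl) ∧ H.Typical G Y τ (p.2 ∘ (Sum.inr ∘ j))
  -- By `hcount` the codegree is at least `#G + #W + s / 2`, and at most `#G + #W` of the neighbours
  -- lie outside `Y`.
  have hdeg : ∀ g ∈ T, s ≤ 2 * count (fun v => v ∈ Y ∧ H.Joins v g) := by
    intro g hg
    simp only [hT, mem_filter, mem_univ, true_and] at hg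
    have h1 := hp.codegree g hg.1
    have h2 : count (fun v => H.Joins v g) ≤
        (#G + #W) + count (fun v => v ∈ Y ∧ H.Joins v g) := by
      rw [← card_union_of_disjoint hp.disjoint_hub_partial, ← count_mem (G ∪ W)]
      refine (count_mono fun v hv => ?_).trans (count_or_le _ _)
      have : v ∈ G ∪ W ∪ Y := by rw [hp.union]; exact mem_univ v
      rcases mem_union.mp this with h | h
      · exact Or.inl h
      · exact Or.inr ⟨h, hv⟩
    have h3 : (2 * (#G + #W) + s) * (k - ℓ) ≤
        (2 * (#G + #W) + 2 * count (fun v => v ∈ Y ∧ H.Joins v g)) * (k - ℓ) := by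
      calc (2 * (#G + #W) + s) * (k - ℓ) = n := hcount
        _ ≤ 2 * (k - ℓ) * count (fun v => H.Joins v g) := h1
        _ ≤ 2 * (k - ℓ) * ((#G + #W) + count (fun v => v ∈ Y ∧ H.Joins v g)) :=
            Nat.mul_le_mul_left _ h2
        _ = _ := by ring
    have h4 := Nat.le_of_mul_le_mul_right h3 (by omega)
    omega
  have hA : (#T : ℝ) * s ≤ 2 * count A := by
    have h1 : ∑ g ∈ T, count (fun v => v ∈ Y ∧ H.Joins v g) ≤ count A := by
      refine sum_count_le T _ A (fun g v => (v, g)) ?_ ?_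
      · intro g hg v hv
        simp only [hT, mem_filter, mem_univ, true_and] at hg
        exact ⟨hv.1, hg.2.1, hv.2, hg.2.2⟩
      · intro g _ g' _ v v' h
        exact ⟨congrArg Prod.snd h, congrArg Prod.fst h⟩
    have h2 : #T * s ≤ ∑ g ∈ T, 2 * count (fun v => v ∈ Y ∧ H.Joins v g) := by
      rw [← smul_eq_mul]
      exact card_nsmul_le_sum _ _ _ hdeg
    rw [← mul_sum] at h2
    exact_mod_cast h2.trans (Nat.mul_le_mul_left 2 h1)
  let B₁ : V × (Rest k ℓ → V) → Prop := fun p =>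
    ∃ u ∈ U, p.1 = u ∧ p.1 ∈ Y ∧ (∀ i, p.2 i ∈ Y) ∧ H.Joins p.1 p.2
  let B₂ : V × (Rest k ℓ → V) → Prop := fun p =>
    ∃ q ∈ (univ : Finset (Rest k ℓ)), ∃ u ∈ U,
      p.1 ∈ Y ∧ (∀ i, p.2 i ∈ Y) ∧ p.2 q = u ∧ H.Joins p.1 p.2
  have hzero : ∀ P : V × (Rest k ℓ → V) → Prop, (∀ p, ¬ P p) → count P = 0 := by
    intro P hP
    rw [count, Nat.card_eq_zero]
    exact Or.inl ⟨fun x => hP _ x.2⟩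
  have hB₁ : (count B₁ : ℝ) ≤ #U * (2 * ε₁ * (n : ℝ) ^ (k - 1)) := by
    have h1 : (count B₁ : ℝ) ≤ _ := Nat.cast_le.mpr (count_exists_le U _)
    push_cast at h1
    refine h1.trans ((sum_le_card_nsmul _ _ (2 * ε₁ * (n : ℝ) ^ (k - 1)) ?_).trans
      (nsmul_eq_mul _ _).le)
    intro u _
    by_cases hu : u ∈ Y
    · refine le_trans ?_ (hp.sparse u hu)
      norm_cast
      refine count_le_of_injOn (fun p => p.2) ?_ ?_
      · rintro ⟨v, g⟩ ⟨rfl, -, h2, h3⟩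
        exact ⟨h2, h3⟩
      · rintro ⟨v, g⟩ ⟨v', g'⟩ ⟨h2, -⟩ ⟨h3, -⟩ h4
        exact Prod.ext (h2.trans h3.symm) h4
    · rw [hzero _ (by rintro ⟨v, g⟩ ⟨rfl, h2, -⟩; exact hu h2), Nat.cast_zero]
      positivity
  have hB₂ : (count B₂ : ℝ) ≤ (k - 1 : ℕ) * (#U * (2 * ε₁ * (n : ℝ) ^ (k - 1))) := by
    have h1 : (count B₂ : ℝ) ≤ _ := Nat.cast_le.mpr (count_exists_le univ _)
    push_cast at h1
    refine h1.trans ((sum_le_card_nsmul _ _ (#U * (2 * ε₁ * (n : ℝ) ^ (k - 1))) ?_).trans ?_)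
    · intro q _
      have h2 : (count (fun p : V × (Rest k ℓ → V) => ∃ u ∈ U,
        p.1 ∈ Y ∧ (∀ i, p.2 i ∈ Y) ∧ p.2 q = u ∧ H.Joins p.1 p.2) : ℝ) ≤ _ :=
        Nat.cast_le.mpr (count_exists_le U _)
      push_cast at h2
      refine h2.trans ((sum_le_card_nsmul _ _ (2 * ε₁ * (n : ℝ) ^ (k - 1)) ?_).trans
        (nsmul_eq_mul _ _).le)
      intro u _
      by_cases hu : u ∈ Y
      · exact hp.sparse_at u hu q
      · rw [hzero _ (by rintro ⟨v, g⟩ ⟨-, h2, rfl, -⟩; exact hu (h2 q)), Nat.cast_zero]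
        positivity
    · rw [nsmul_eq_mul, card_univ, hcR]
  -- Both sides scale with `s`: there are at least `#T * s / 2` edges to choose from, and at most `k
  -- * s` forbidden vertices, each in few edges inside `Y`. So even `s = 1` is large enough.
  have hlt : count (fun p => B₁ p ∨ B₂ p) < count A := by
    have h1 : (count (fun p => B₁ p ∨ B₂ p) : ℝ) ≤ count B₁ + count B₂ := by
      exact_mod_cast count_or_le B₁ B₂
    have h2 : ((k - 1 : ℕ) : ℝ) = k - 1 := by
      rw [Nat.cast_sub (by omega), Nat.cast_one]
    rw [h2] at hB₂
    have h3 : (#U : ℝ) ≤ k * s := by exact_mod_cast hU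
    have hs' : (0 : ℝ) < s := by exact_mod_cast hs
    have h4 : (count (fun p => B₁ p ∨ B₂ p) : ℝ) ≤
        k * (k * s) * (2 * ε₁ * (n : ℝ) ^ (k - 1)) := by
      calc (count (fun p => B₁ p ∨ B₂ p) : ℝ) ≤ k * #U * (2 * ε₁ * (n : ℝ) ^ (k - 1)) := by
            linarith
        _ ≤ _ := by gcongr
    have h5 := mul_le_mul_of_nonneg_right hTcard hs'.le
    have h6 : 4 * (k : ℝ) ^ 2 * ε₁ * ((n : ℝ) ^ (k - 1) * s) <
        ((1 / 2 : ℝ) ^ (k - 1) - 2 * (ε₀ / τ) - (k : ℝ) ^ 2 / n) * ((n : ℝ) ^ (k - 1) * s) :=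
      mul_lt_mul_of_pos_right (by linarith) (by positivity)
    have h7 : (count (fun p => B₁ p ∨ B₂ p) : ℝ) < count A := by linarith
    exact_mod_cast h7
  obtain ⟨⟨v, g⟩, ⟨hv, hg, hjoin, ht1, ht2⟩, hnot⟩ := exists_of_count_lt hlt
  rw [not_or] at hnot
  have hvU : v ∉ U := fun h => hnot.1 ⟨v, h, rfl, hv, hg, hjoin⟩
  have hgU : ∀ i, g i ∉ U := fun i h => hnot.2 ⟨i, mem_univ i, g i, h, hv, hg, rfl, hjoin⟩
  obtain ⟨p, hp1, hp2, hp3, hp4⟩ := exists_piece_of_joins hℓ hℓk hjoin j hj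
  refine ⟨p, ⟨by rw [hp1]; exact ht1, by rw [hp2]; exact ht2⟩, hp3, ?_, ?_⟩
  · rw [hp4]
    refine insert_subset hv fun x hx => ?_
    obtain ⟨i, -, rfl⟩ := mem_image.mp hx
    exact hg i
  · rw [hp4, disjoint_left]
    intro x hx
    rcases mem_insert.mp hx with rfl | hx
    · exact hvU
    · obtain ⟨i, -, rfl⟩ := mem_image.mp hx
      exact hgU i

end HubPartition

end SpecialPieces

/-! ### Bounds on misses, and the correction of the number of hubs. -/

section Assembly

variable {V : Type*} [DecidableEq V] {k : ℕ}

theorem hubMiss_le [Fintype V] (H : KGraph V k) {ℓ : ℕ} (hℓ : 1 ≤ ℓ) (hℓk : 2 * ℓ < k)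
    (Y : Finset V) (h : V) (P : Fin ℓ → V) :
    H.hubMiss Y h P ≤ Fintype.card V ^ (k - ℓ - 1) := by
  rw [← card_inner hℓ hℓk, ← Fintype.card_fun]
  exact count_le_card _

/-- The entry at `c` is pinned to `y`, so its slot can store the hub instead. This saves a factor
`n` and gives the same scale as for `hubMiss`. -/
theorem innerMiss_le [Fintype V] (H : KGraph V k) {ℓ : ℕ} (hℓ : 1 ≤ ℓ) (hℓk : 2 * ℓ < k)
    (G Y : Finset V) (c : Inner k ℓ) (y : V) (P : Fin ℓ → V) :
    H.innerMiss G Y c y P ≤ Fintype.card V ^ (k - ℓ - 1) := by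
  rw [← card_inner hℓ hℓk, ← Fintype.card_fun, ← count_true]
  refine count_le_of_injOn (fun p => Function.update p.2 c p.1) (fun _ _ => trivial) ?_
  rintro ⟨v, x⟩ ⟨v', x'⟩ ⟨-, -, hx, -⟩ ⟨-, -, hx', -⟩ h
  refine Prod.ext ?_ (funext fun i => ?_)
  · simpa using congrFun h c
  · by_cases hi : i = c
    · subst hi
      exact hx.trans hx'.symm
    · simpa [hi] using congrFun h i

/-- An end glued to inner vertices is a tuple on `Rest`, so the misses over all ends are part of
those in the field `hub`. This supplies the average of a test in the spread selection. -/
theorem sum_hubMiss_le [Fintype V] (H : KGraph V k) {ℓ : ℕ} {Y Y' : Finset V} (hY : Y' ⊆ Y)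
    (h : V) :
    ∑ P ∈ Fintype.piFinset (fun _ : Fin ℓ => Y'), H.hubMiss Y h P ≤
      count (fun g : Rest k ℓ → V => (∀ i, g i ∈ Y) ∧ ¬ H.Joins h g) := by
  refine sum_count_le _ _ _ (fun P x => Sum.elim P x) ?_ ?_
  · intro P hP x hx
    exact ⟨Sum.forall.mpr ⟨fun i => hY (Fintype.mem_piFinset.mp hP i), hx.1⟩, hx.2⟩
  · intro P _ P' _ x x' h
    exact ⟨funext fun i => congrFun h (Sum.inl i), funext fun i => congrFun h (Sum.inr i)⟩

theorem sum_innerMiss_le [Fintype V] (H : KGraph V k) {ℓ : ℕ} {G Y Y' : Finset V} (hY : Y' ⊆ Y)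
    (c : Inner k ℓ) (y : V) :
    ∑ P ∈ Fintype.piFinset (fun _ : Fin ℓ => Y'), H.innerMiss G Y c y P ≤
      count (fun p : V × (Rest k ℓ → V) =>
        p.1 ∈ G ∧ (∀ i, p.2 i ∈ Y) ∧ p.2 (Sum.inr c) = y ∧ ¬ H.Joins p.1 p.2) := by
  refine sum_count_le _ _ _ (fun P p => (p.1, Sum.elim P p.2)) ?_ ?_
  · intro P hP p hp
    exact ⟨hp.1, Sum.forall.mpr ⟨fun i => hY (Fintype.mem_piFinset.mp hP i), hp.2.1⟩, hp.2.2⟩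
  · intro P _ P' _ p p' h
    have h1 := congrArg Prod.fst h
    have h2 := congrArg Prod.snd h
    exact ⟨funext fun i => congrFun h2 (Sum.inl i),
      Prod.ext h1 (funext fun i => congrFun h2 (Sum.inr i))⟩

/-- The piece without edges that consists of one end. -/
def trivialPiece (H : KGraph V k) {ℓ : ℕ} (P : Fin ℓ → V) (hP : Function.Injective P) :
    H.Piece ℓ where
  start := P
  finish := P
  blocks := []
  supp := univ.image P
  path := rfl
  card_blocks := by simp
  cover := fun v hv => Or.inl hv
  card_supp := by simp [card_image_of_injective _ hP]

namespace HubPartition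

variable [Fintype V] {H : KGraph V k} {ℓ : ℕ} {G W Y : Finset V} {ε₀ ε₁ δ : ℝ}

/-- Disjoint one-edge pieces that correct the number of hubs. -/
theorem exists_single_pieces (hp : H.HubPartition ℓ G W Y ε₀ ε₁ δ) (hℓ : 1 ≤ ℓ)
    (hℓk : 2 * ℓ < k) [Nonempty V] (hdvd : (k - ℓ) ∣ Fintype.card V) (hδk : 12 * k * δ ≤ 1)
    (hδε : 24 * (k : ℝ) ^ 2 * δ ≤ ε₁) (hε₀ : 0 ≤ ε₀) {τ : ℝ} (hτ : 0 < τ) (hε₁ : 0 ≤ ε₁)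
    (hsmall : 2 * (ε₀ / τ) + ε₀ + ε₁ / 8 < (1 / 2 : ℝ) ^ (k - 1))
    (hsmall' : 2 * (ε₀ / τ) + (k : ℝ) ^ 2 / Fintype.card V + 4 * (k : ℝ) ^ 2 * ε₁ <
      (1 / 2 : ℝ) ^ (k - 1)) :
    ∃ (s : ℕ) (G' : Finset V) (p : Fin s → H.Piece ℓ), G' ⊆ G ∧ #G' ≤ s ∧
      (s : ℝ) ≤ δ * Fintype.card V ∧
      (2 * (#G + #W) + s) * (k - ℓ) = Fintype.card V + 2 * #G' * (k - ℓ) ∧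
      (∀ i, (H.Typical G Y τ (p i).start ∧ H.Typical G Y τ (p i).finish) ∧
        (p i).blocks.length = 1 ∧ (p i).supp ⊆ G' ∪ Y) ∧
      (∀ i j, i ≠ j → Disjoint (p i).supp (p j).supp) ∧ ∀ v ∈ G', ∃ i, v ∈ (p i).supp := by
  set n := Fintype.card V with hn
  have hn0 : (0 : ℝ) < n := by exact_mod_cast Fintype.card_pos
  obtain ⟨m, hm⟩ := hdvd
  have hkpos : (1 : ℝ) ≤ k := by exact_mod_cast (by omega : 1 ≤ k)
  have hδ0 : 0 ≤ δ := by
    have h1 := (abs_nonneg _).trans hp.balance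
    exact nonneg_of_mul_nonneg_left h1 hn0
  have hδ1 : δ ≤ 1 := by nlinarith
  have hr1 : (1 : ℝ) ≤ (k - ℓ : ℕ) := by exact_mod_cast (by omega : 1 ≤ k - ℓ)
  have hrk : ((k - ℓ : ℕ) : ℝ) ≤ k := by exact_mod_cast Nat.sub_le k ℓ
  have hmR : (n : ℝ) = (k - ℓ : ℕ) * m := by rw [hm]; push_cast; ring
  have hbal := abs_le.mp hp.balance
  have hUbound : ∀ s : ℕ, (s : ℝ) ≤ δ * n → ∀ U : Finset V, #U ≤ k * s →
      8 * k * (#U : ℝ) ≤ ε₁ * n := by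
    intro s hs U hU
    have h1 : (#U : ℝ) ≤ k * s := by exact_mod_cast hU
    calc 8 * k * (#U : ℝ) ≤ 8 * k * (k * (δ * n)) := by gcongr; exact h1.trans (by gcongr)
      _ ≤ 24 * (k : ℝ) ^ 2 * δ * n := by
          have h2 : 0 ≤ (k : ℝ) ^ 2 * (δ * n) := by positivity
          linarith
      _ ≤ _ := by gcongr
  -- The cycle has `m` edges, and hubs and partial hubs serving two edges each would account for `2
  -- * (#G + #W)`. A deficit is filled with edges inside `Y`; for a surplus, that many hubs serve
  -- one edge only.
  rcases Nat.lt_or_ge (2 * (#G + #W)) m with hlt | hge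
  · obtain ⟨s, hs⟩ := Nat.exists_eq_add_of_lt hlt
    set s' := s + 1 with hs'
    have hm' : m = 2 * (#G + #W) + s' := by omega
    have hsδ : (s' : ℝ) ≤ δ * n := by
      have h1 : (m : ℝ) = 2 * (#G + #W) + s' := by exact_mod_cast hm'
      have h2 : ((k - ℓ : ℕ) : ℝ) * s' ≤ δ * n := by
        have : 2 * ((k - ℓ : ℕ) : ℝ) * (#G + #W) - n = -((k - ℓ : ℕ) * s') := by
          rw [hmR, h1]; ring
        linarith [hbal.1]
      have h3 : (s' : ℝ) ≤ (k - ℓ : ℕ) * s' := le_mul_of_one_le_left (by positivity) hr1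
      linarith
    have hcount : (2 * (#G + #W) + s') * (k - ℓ) = n := by rw [← hm', hm, mul_comm]
    obtain ⟨p, hpg, hpd⟩ := exists_disjoint_family (J := Fin s') (fun p : H.Piece ℓ => p.supp)
      (fun _ p => (H.Typical G Y τ p.start ∧ H.Typical G Y τ p.finish) ∧ p.blocks.length = 1 ∧
        p.supp ⊆ Y) k (by
        intro _ U hU
        rw [Fintype.card_fin] at hU
        obtain ⟨p, h1, h2, h3, h4⟩ := hp.exists_ordinary_piece hℓ hℓk hδ1 hε₀ hτ hε₁ hsmall'
          (Nat.succ_pos s) hcount U hU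
        refine ⟨p, ⟨h1, h2, h3⟩, ?_, h4⟩
        rw [p.card_supp, h2]
        omega)
    refine ⟨s', ∅, p, empty_subset _, by simp, hsδ, by simpa using hcount, fun i => ?_, hpd,
      by simp⟩
    rw [empty_union]
    exact hpg i
  · obtain ⟨s, hs⟩ := Nat.exists_eq_add_of_le hge
    have hsδ : (s : ℝ) ≤ δ * n := by
      have h1 : (2 * (#G + #W) : ℝ) = m + s := by exact_mod_cast hs
      have h2 : ((k - ℓ : ℕ) : ℝ) * s ≤ δ * n := by
        have : 2 * ((k - ℓ : ℕ) : ℝ) * (#G + #W) - n = (k - ℓ : ℕ) * s := by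
          rw [hmR]; linear_combination ((k - ℓ : ℕ) : ℝ) * h1
        linarith [hbal.2]
      have h3 : (s : ℝ) ≤ (k - ℓ : ℕ) * s := le_mul_of_one_le_left (by positivity) hr1
      linarith
    -- `hδk` gives `m ≥ 12 * δ * n`, which outweighs `2 * #W` and `s`; hence `2 * #G = m + s - 2 *
    -- #W ≥ 2 * s`.
    have hsG : s ≤ #G := by
      have h1 : (2 * (#G + #W) : ℝ) = m + s := by exact_mod_cast hs
      have h2 := hp.card_partial
      have h3 : (n : ℝ) ≤ k * m := by
        rw [hmR]; gcongr
      have h4 : 12 * k * δ * n ≤ 1 * n := by gcongr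
      have h5 : k * (12 * δ * n) ≤ k * (m : ℝ) := by linarith
      have h6 : 12 * δ * n ≤ m := le_of_mul_le_mul_left h5 (by linarith)
      have h7 : (0 : ℝ) ≤ δ * n := by positivity
      have h8 : (s : ℝ) ≤ #G := by linarith
      exact_mod_cast h8
    obtain ⟨G', hG', hcard⟩ := exists_subset_card_eq hsG
    let e : Fin s ≃ G' := (G'.equivFinOfCardEq hcard).symm
    -- The hubs are prescribed and distinct, so only the ordinary parts of the pieces have to be
    -- kept disjoint.
    obtain ⟨p, hpg, hpd⟩ := exists_disjoint_family (J := Fin s)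
      (fun p : H.Piece ℓ => p.supp ∩ Y)
      (fun i p => (H.Typical G Y τ p.start ∧ H.Typical G Y τ p.finish) ∧ p.blocks.length = 1 ∧
        (e i).1 ∈ p.supp ∧ p.supp ⊆ insert (e i).1 Y) k (by
        intro i U hU
        rw [Fintype.card_fin] at hU
        obtain ⟨p, h1, h2, h3, h4, h5⟩ := hp.exists_hub_piece hℓ hℓk hδ1 hε₀ hτ hsmall
          (hG' (e i).2) U (hUbound s hsδ U hU)
        refine ⟨p, ⟨h1, h2, h3, h4⟩, ?_, h5⟩
        refine (card_le_card inter_subset_left).trans ?_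
        rw [p.card_supp, h2]
        omega)
    refine ⟨s, G', p, hG', hcard.le, hsδ, ?_, fun i => ⟨(hpg i).1, (hpg i).2.1, ?_⟩, ?_, ?_⟩
    · rw [hs, hcard, hm]
      ring
    · refine (hpg i).2.2.2.trans ?_
      rw [insert_subset_iff]
      exact ⟨mem_union_left _ (e i).2, subset_union_right⟩
    · intro i j hij
      rw [disjoint_left]
      intro v hvi hvj
      by_cases hv : v ∈ Y
      · exact disjoint_left.mp (hpd i j hij) (mem_inter.mpr ⟨hvi, hv⟩) (mem_inter.mpr ⟨hvj, hv⟩)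
      · have h1 := (mem_insert.mp ((hpg i).2.2.2 hvi)).resolve_right hv
        have h2 := (mem_insert.mp ((hpg j).2.2.2 hvj)).resolve_right hv
        exact hij (e.injective (Subtype.ext (h1.symm.trans h2)))
    · intro v hv
      refine ⟨e.symm ⟨v, hv⟩, ?_⟩
      simpa using (hpg (e.symm ⟨v, hv⟩)).2.2.1

/-- Disjoint pieces that correct the number of hubs and contain all partial hubs. -/
theorem exists_special_pieces (hp : H.HubPartition ℓ G W Y ε₀ ε₁ δ) (hℓ : 1 ≤ ℓ)
    (hℓk : 2 * ℓ < k) [Nonempty V] (hdvd : (k - ℓ) ∣ Fintype.card V) (hδk : 12 * k * δ ≤ 1)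
    (hδε : 24 * (k : ℝ) ^ 2 * δ ≤ ε₁) (hε₀ : 0 ≤ ε₀) {τ : ℝ} (hτ : 0 < τ) (hε₁ : 0 < ε₁)
    (hα : ε₀ / τ ≤ ε₁ / 16) (hn : 4 * (k : ℝ) ^ 2 < ε₁ * Fintype.card V)
    (hsmall : 2 * (ε₀ / τ) + ε₀ + ε₁ / 8 < (1 / 2 : ℝ) ^ (k - 1))
    (hsmall' : 2 * (ε₀ / τ) + (k : ℝ) ^ 2 / Fintype.card V + 4 * (k : ℝ) ^ 2 * ε₁ <
      (1 / 2 : ℝ) ^ (k - 1)) :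
    ∃ (s : ℕ) (G' : Finset V) (p : Fin s ⊕ Fin (#W) → H.Piece ℓ), G' ⊆ G ∧ #G' ≤ s ∧
      (s : ℝ) ≤ δ * Fintype.card V ∧
      (2 * (#G + #W) + s) * (k - ℓ) = Fintype.card V + 2 * #G' * (k - ℓ) ∧
      (∀ i, (H.Typical G Y τ (p i).start ∧ H.Typical G Y τ (p i).finish) ∧
        (p i).supp ⊆ G' ∪ W ∪ Y) ∧
      (∀ i j, i ≠ j → Disjoint (p i).supp (p j).supp) ∧
      (∀ v ∈ G' ∪ W, ∃ i, v ∈ (p i).supp) ∧ ∑ i, (p i).blocks.length = s + 2 * #W := by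
  obtain ⟨s, G', p, hG', hG's, hs, hcount, hpg, hpd, hpc⟩ :=
    hp.exists_single_pieces hℓ hℓk hdvd hδk hδε hε₀ hτ hε₁.le hsmall hsmall'
  set n := Fintype.card V with hn'
  have hkpos : (1 : ℝ) ≤ k := by exact_mod_cast (by omega : 1 ≤ k)
  let U₀ : Finset V := univ.biUnion fun i => (p i).supp
  have hU₀ : #U₀ ≤ k * s := by
    refine (card_biUnion_le_card_mul _ _ k fun i _ => ?_).trans ?_
    · rw [(p i).card_supp, (hpg i).2.1]
      omega
    · rw [card_univ, Fintype.card_fin, mul_comm]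
  let e : Fin (#W) ≃ W := (W.equivFinOfCardEq rfl).symm
  -- The one-edge pieces occupy at most `k * δ * n` vertices and the two-edge pieces `2 * k * δ *
  -- n`. Times the factor `8 * k` of `exists_partial_hub_piece` this is `24 * k ^ 2 * δ * n`, whence
  -- `hδε`.
  obtain ⟨q, hqg, hqd⟩ := exists_disjoint_family (J := Fin (#W))
    (fun p : H.Piece ℓ => p.supp ∩ Y)
    (fun i p => (H.Typical G Y τ p.start ∧ H.Typical G Y τ p.finish) ∧ p.blocks.length = 2 ∧
      (e i).1 ∈ p.supp ∧ p.supp ⊆ insert (e i).1 Y ∧ Disjoint (p.supp ∩ Y) U₀) (2 * k) (by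
      intro i U hU
      rw [Fintype.card_fin] at hU
      obtain ⟨p, h1, h2, h3, h4, h5⟩ := hp.exists_partial_hub_piece hℓ hℓk hε₀ hτ hε₁ hα hn
        (e i).2 (U ∪ U₀) (by
          have h1 : #(U ∪ U₀) ≤ 2 * k * #W + k * s :=
            (card_union_le _ _).trans (add_le_add hU hU₀)
          have h2 : (#(U ∪ U₀) : ℝ) ≤ 2 * k * #W + k * s := by exact_mod_cast h1
          have h3 : (#(U ∪ U₀) : ℝ) ≤ 3 * k * (δ * n) := by
            calc (#(U ∪ U₀) : ℝ) ≤ 2 * k * (δ * n) + k * (δ * n) := by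
                  refine h2.trans ?_
                  gcongr
                  exact hp.card_partial
              _ = _ := by ring
          calc 8 * k * (#(U ∪ U₀) : ℝ) ≤ 8 * k * (3 * k * (δ * n)) := by gcongr
            _ = 24 * (k : ℝ) ^ 2 * δ * n := by ring
            _ ≤ _ := by gcongr)
      rw [disjoint_union_right] at h5
      refine ⟨p, ⟨h1, h2, h3, h4, h5.2⟩, ?_, h5.1⟩
      refine (card_le_card inter_subset_left).trans ?_
      rw [p.card_supp, h2]
      omega)
  have hpW : ∀ i v, v ∈ (p i).supp → v ∉ W := by
    intro i v hv hvW
    rcases mem_union.mp ((hpg i).2.2 hv) with h | h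
    · exact disjoint_left.mp hp.disjoint_hub_partial (hG' h) hvW
    · exact disjoint_left.mp hp.disjoint_partial_ordinary hvW h
  have hpq : ∀ i j, Disjoint (p i).supp (q j).supp := by
    intro i j
    rw [disjoint_left]
    intro v hvi hvj
    by_cases hv : v ∈ Y
    · exact disjoint_left.mp (hqg j).2.2.2.2 (mem_inter.mpr ⟨hvj, hv⟩)
        (mem_biUnion.mpr ⟨i, mem_univ i, hvi⟩)
    · have h2 := (mem_insert.mp ((hqg j).2.2.2.1 hvj)).resolve_right hv
      exact hpW i v hvi (h2 ▸ (e j).2)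
  refine ⟨s, G', Sum.elim p q, hG', hG's, hs, hcount, ?_, ?_, ?_, ?_⟩
  · rintro (i | i)
    · refine ⟨(hpg i).1, (hpg i).2.2.trans ?_⟩
      exact union_subset_union_left subset_union_left
    · refine ⟨(hqg i).1, (hqg i).2.2.2.1.trans ?_⟩
      rw [insert_subset_iff]
      exact ⟨mem_union_left _ (mem_union_right _ (e i).2), subset_union_right⟩
  · rintro (i | i) (j | j) hij
    · exact hpd i j fun h => hij (congrArg _ h)
    · exact hpq i j
    · exact (hpq j i).symm
    · have hij' : i ≠ j := fun h => hij (congrArg _ h)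
      rw [disjoint_left]
      intro v hvi hvj
      simp only [Sum.elim_inr] at hvi hvj
      by_cases hv : v ∈ Y
      · exact disjoint_left.mp (hqd i j hij') (mem_inter.mpr ⟨hvi, hv⟩)
          (mem_inter.mpr ⟨hvj, hv⟩)
      · have h1 := (mem_insert.mp ((hqg i).2.2.2.1 hvi)).resolve_right hv
        have h2 := (mem_insert.mp ((hqg j).2.2.2.1 hvj)).resolve_right hv
        exact hij' (e.injective (Subtype.ext (h1.symm.trans h2)))
  · intro v hv
    rcases mem_union.mp hv with hv | hv
    · obtain ⟨i, hi⟩ := hpc v hv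
      exact ⟨Sum.inl i, hi⟩
    · refine ⟨Sum.inr (e.symm ⟨v, hv⟩), ?_⟩
      simpa using (hqg (e.symm ⟨v, hv⟩)).2.2.1
  · rw [Fintype.sum_sum_type]
    simp only [Sum.elim_inl, Sum.elim_inr, (hpg _).2.1, (hqg _).2.1, sum_const, card_univ,
      Fintype.card_fin, smul_eq_mul]
    omega

end HubPartition

end Assembly

/-! ### From a hub partition to a Hamilton cycle. -/

section Completion

variable {V : Type*} [DecidableEq V] {k : ℕ}

theorem card_biUnion_supp {H : KGraph V k} {ℓ : ℕ} {J : Type*} [Fintype J] (p : J → H.Piece ℓ)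
    (hd : ∀ i j, i ≠ j → Disjoint (p i).supp (p j).supp) :
    #(univ.biUnion fun i => (p i).supp) =
      (∑ i, (p i).blocks.length) * (k - ℓ) + Fintype.card J * ℓ := by
  rw [card_biUnion fun i _ j _ hij => hd i j hij]
  simp only [Piece.card_supp, sum_add_distrib, sum_const, card_univ, smul_eq_mul, sum_mul]

namespace HubPartition

variable [Fintype V] {H : KGraph V k} {ℓ : ℕ} {G W Y : Finset V} {ε₀ ε₁ δ : ℝ}

/-- Disjoint typical ends in a large subset `Y'` of `Y` that are well spread. -/
theorem exists_spread_ends (hp : H.HubPartition ℓ G W Y ε₀ ε₁ δ) (hℓ : 1 ≤ ℓ)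
    (hℓk : 2 * ℓ < k) [Nonempty V] (hε₀ : 0 ≤ ε₀) (hε : ε₀ ≤ 4 * ε₁) {τ : ℝ} (hτ : 0 < τ)
    {Y' : Finset V} (hY' : Y' ⊆ Y) {c : ℝ} (hc : 0 < c) (t : ℕ)
    (hcard : c * Fintype.card V + t * ℓ ≤ #Y')
    (hα : ε₀ / τ + (ℓ : ℝ) ^ 2 / Fintype.card V ≤ c ^ ℓ / 2) :
    ∃ F : Fin t → Fin ℓ → V,
      (∀ i, Function.Injective (F i) ∧ (∀ c, F i c ∈ Y') ∧ H.Typical G Y τ (F i)) ∧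
      (∀ i j, i ≠ j → ∀ c d, F i c ≠ F j d) ∧
      (∀ h ∈ G, ∑ i, (H.hubMiss Y h (F i) : ℝ) ≤ (Real.log ((k + 1) * Fintype.card V) +
        16 * ε₁ / c ^ ℓ * t) * (Fintype.card V : ℝ) ^ (k - ℓ - 1)) ∧
      ∀ q, ∀ y ∈ Y, ∑ i, (H.innerMiss G Y q y (F i) : ℝ) ≤
        (Real.log ((k + 1) * Fintype.card V) +
        16 * ε₁ / c ^ ℓ * t) * (Fintype.card V : ℝ) ^ (k - ℓ - 1) := by
  classical
  set n := Fintype.card V with hn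
  have hn0 : (0 : ℝ) < n := by exact_mod_cast Fintype.card_pos
  have hpow : (0 : ℝ) < (n : ℝ) ^ (k - ℓ - 1) := by positivity
  have hsplit : (n : ℝ) ^ (k - 1) = (n : ℝ) ^ ℓ * (n : ℝ) ^ (k - ℓ - 1) := by
    rw [← pow_add]
    congr 1
    omega
  -- One test for each hub and one for each position with an ordinary vertex in it. Division by the
  -- trivial bound `n ^ (k - ℓ - 1)` brings them into `[0, 1]`; there are at most `(k + 1) * n` of
  -- them, which explains the logarithm.
  let miss : G ⊕ (Inner k ℓ × Y) → (Fin ℓ → V) → ℕ := fun z P =>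
    Sum.elim (fun h => H.hubMiss Y h.1 P) (fun q => H.innerMiss G Y q.1 q.2.1 P) z
  have hmiss : ∀ z P, miss z P ≤ n ^ (k - ℓ - 1) := by
    rintro (h | q) P
    · exact H.hubMiss_le hℓ hℓk Y h.1 P
    · exact H.innerMiss_le hℓ hℓk G Y q.1 q.2.1 P
  have hsum : ∀ z, ∑ P ∈ Fintype.piFinset (fun _ : Fin ℓ => Y'), (miss z P : ℝ) ≤
      4 * ε₁ * (n : ℝ) ^ (k - 1) := by
    rintro (h | q)
    · have h1 := (Nat.cast_le (α := ℝ)).mpr (H.sum_hubMiss_le (ℓ := ℓ) hY' h.1)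
      rw [Nat.cast_sum] at h1
      exact (h1.trans (hp.hub h.1 h.2)).trans (by gcongr)
    · have h1 := (Nat.cast_le (α := ℝ)).mpr (H.sum_innerMiss_le (G := G) hY' q.1 q.2.1)
      rw [Nat.cast_sum] at h1
      exact h1.trans (hp.inner q.2.1 q.2.2 _)
  obtain ⟨F, hF, hd, hs⟩ := exists_spread_family Y' (H.Typical G Y τ)
    (fun z P => (miss z P : ℝ) / (n : ℝ) ^ (k - ℓ - 1)) (fun z P => ⟨by positivity, by
      rw [div_le_one hpow]
      exact_mod_cast hmiss z P⟩) t (4 * ε₁) c (ε₀ / τ) hc (by linarith) hcard (fun z => by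
      rw [← sum_div, div_le_iff₀ hpow, mul_assoc, ← hn, ← hsplit]
      exact hsum z) ((Nat.cast_le.mpr (count_mono fun P hP =>
        ⟨fun i => hY' (hP.1 i), hP.2⟩)).trans (hp.count_atypical_le hℓ hℓk hε₀ hτ)) hα
  have hbound : ∀ z, ∑ i, (miss z (F i) : ℝ) ≤ (Real.log ((k + 1) * n) +
      16 * ε₁ / c ^ ℓ * t) * (n : ℝ) ^ (k - ℓ - 1) := by
    intro z
    have h1 := hs z
    rw [← sum_div, div_le_iff₀ hpow] at h1
    refine h1.trans (mul_le_mul_of_nonneg_right ?_ hpow.le)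
    have h2 : (Fintype.card (G ⊕ (Inner k ℓ × Y)) : ℝ) ≤ (k + 1) * n := by
      rw [Fintype.card_sum, Fintype.card_prod, card_inner hℓ hℓk, Fintype.card_coe,
        Fintype.card_coe]
      have h3 : #G ≤ n := card_le_univ G
      have h4 : #Y ≤ n := card_le_univ Y
      have h5 : k - ℓ - 1 ≤ k := by omega
      have h6 : #G + (k - ℓ - 1) * #Y ≤ n + k * n := add_le_add h3 (Nat.mul_le_mul h5 h4)
      have h7 : ((#G + (k - ℓ - 1) * #Y : ℕ) : ℝ) ≤ (n : ℝ) + k * n := by exact_mod_cast h6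
      linarith
    have h3 : (0 : ℝ) < Fintype.card (G ⊕ (Inner k ℓ × Y)) := by
      exact_mod_cast Fintype.card_pos_iff.mpr ⟨z⟩
    refine add_le_add (Real.log_le_log h3 h2) (le_of_eq ?_)
    ring
  exact ⟨F, hF, hd, fun h hh => hbound (Sum.inl ⟨h, hh⟩),
    fun q y hy => hbound (Sum.inr (q, ⟨y, hy⟩))⟩

set_option maxHeartbeats 1600000 in
/-- A hub partition with sufficiently small error terms gives a Hamilton cycle. -/
theorem hasHamiltonCycle (hp : H.HubPartition ℓ G W Y ε₀ ε₁ δ) (hℓ : 1 ≤ ℓ)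
    (hℓk : 2 * ℓ < k) [Nonempty V] (hdvd : (k - ℓ) ∣ Fintype.card V) (hδk : 12 * k * δ ≤ 1)
    (hδε : 24 * (k : ℝ) ^ 2 * δ ≤ ε₁) (hε₀ : 0 ≤ ε₀) {τ : ℝ} (hτ : 0 < τ) (hε₁ : 0 < ε₁)
    (hα : ε₀ / τ ≤ ε₁ / 16) (hn : 4 * (k : ℝ) ^ 2 < ε₁ * Fintype.card V)
    (hsmall : 2 * (ε₀ / τ) + ε₀ + ε₁ / 8 < (1 / 2 : ℝ) ^ (k - 1))
    (hsmall' : 2 * (ε₀ / τ) + (k : ℝ) ^ 2 / Fintype.card V + 4 * (k : ℝ) ^ 2 * ε₁ <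
      (1 / 2 : ℝ) ^ (k - 1)) (hε : ε₀ ≤ 4 * ε₁)
    {c : ℝ} (hc0 : 0 < c) (hc : c * (4 * k) ≤ 1)
    (hαc : ε₀ / τ + (k : ℝ) ^ 2 / Fintype.card V ≤ c ^ k / 2)
    (hτc : τ * (16 * k) ≤ c ^ k)
    (hlog : (2 * δ + Real.log ((k + 1) * Fintype.card V) / Fintype.card V + 16 * ε₁ / c ^ k) *
      (16 * k) ≤ c ^ k)
    (hnc : 16 * (k : ℝ) ^ 2 < c * Fintype.card V) :
    H.HasHamiltonCycle ℓ := by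
  classical
  obtain ⟨s, G', p, hG', hG's, hs, hcount, hpg, hpd, hpc, hplen⟩ :=
    hp.exists_special_pieces hℓ hℓk hdvd hδk hδε hε₀ hτ hε₁ hα hn hsmall hsmall'
  set n := Fintype.card V with hn'
  have hn0 : (0 : ℝ) < n := by exact_mod_cast Fintype.card_pos
  have hkpos : (3 : ℝ) ≤ k := by exact_mod_cast (by omega : 3 ≤ k)
  have hc1 : c ≤ 1 := by nlinarith
  have hδ0 : 0 ≤ δ := nonneg_of_mul_nonneg_left ((abs_nonneg _).trans hp.balance) hn0
  have hG's' : #G' ≤ #G := card_le_card hG'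
  -- the number of hubs that remain
  obtain ⟨N, hN⟩ : ∃ N, #G = #G' + N := ⟨#G - #G', by omega⟩
  have hGG' : #(G \ G') = N := by
    rw [card_sdiff_of_subset hG']
    omega
  have hnN : n = (2 * N + 2 * #W + s) * (k - ℓ) := by
    have h1 : (2 * (#G + #W) + s) * (k - ℓ) =
        (2 * N + 2 * #W + s) * (k - ℓ) + 2 * #G' * (k - ℓ) := by
      rw [hN]; ring
    omega
  have hWs : (#W + s : ℝ) ≤ 2 * δ * n := by
    have := hp.card_partial
    rw [← hn'] at this
    linarith
  have hNk : (n : ℝ) ≤ k * (2 * N + 2 * #W + s) := by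
    have h1 : n ≤ k * (2 * N + 2 * #W + s) := by
      rw [hnN, mul_comm]
      exact Nat.mul_le_mul_right _ (Nat.sub_le k ℓ)
    exact_mod_cast h1
  have hδn : 12 * k * δ * n ≤ 1 * n := by gcongr
  have hkN : (n : ℝ) ≤ 3 * k * N := by
    have h1 : (k : ℝ) * (2 * #W + s) ≤ k * (4 * δ * n) := by
      refine mul_le_mul_of_nonneg_left ?_ (by linarith)
      have : (0 : ℝ) ≤ s := by positivity
      linarith
    linarith
  have hcN : c * n ≤ N := by
    have h1 : c * n ≤ c * (3 * k * N) := by gcongr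
    have h2 : (0 : ℝ) ≤ N := by positivity
    have h3 : (0 : ℝ) ≤ c * k * N := by positivity
    have h4 : c * (4 * k) * N ≤ 1 * N := by gcongr
    linarith
  have hpN : s + #W ≤ N := by
    have h1 : (s + #W : ℝ) ≤ N := by
      have h2 : (k : ℝ) * (12 * (δ * n)) ≤ k * (3 * N) := by linarith
      have h3 : 12 * (δ * n) ≤ 3 * (N : ℝ) := le_of_mul_le_mul_left h2 (by linarith)
      have h4 : (0 : ℝ) ≤ N := by positivity
      linarith
    exact_mod_cast h1
  -- The number of pieces has to equal the number `N` of free hubs, so `t` zero-edge pieces join the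
  -- `s + #W` special ones.
  obtain ⟨t, ht⟩ : ∃ t, N = s + #W + t := ⟨N - (s + #W), by omega⟩
  have hdY : Fintype.card (Between k ℓ) + ℓ + 1 = 2 * (k - ℓ) := by
    rw [card_between hℓ hℓk]
    omega
  have hd1 : 1 ≤ Fintype.card (Between k ℓ) := by omega
  -- the ordinary vertices outside the special pieces
  set U := univ.biUnion fun i => (p i).supp with hU
  have hUcard := card_biUnion_supp p hpd
  rw [← hU, hplen, Fintype.card_sum, Fintype.card_fin, Fintype.card_fin] at hUcard
  have hUmem : ∀ v, v ∈ U ↔ ∃ i, v ∈ (p i).supp := fun v => by simp [hU]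
  have hUG : Disjoint U (G \ G') := by
    rw [disjoint_left]
    intro v hv hvG
    obtain ⟨i, hi⟩ := (hUmem v).mp hv
    obtain ⟨hv1, hv2⟩ := mem_sdiff.mp hvG
    rcases mem_union.mp ((hpg i).2 hi) with h | h
    · rcases mem_union.mp h with h | h
      · exact hv2 h
      · exact disjoint_left.mp hp.disjoint_hub_partial hv1 h
    · exact disjoint_left.mp hp.disjoint_hub_ordinary hv1 h
  have hpart : ∀ v, v ∈ U ∨ v ∈ G \ G' ∨ v ∈ Y \ U := by
    intro v
    have h1 : v ∈ G ∪ W ∪ Y := by rw [hp.union]; exact mem_univ v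
    by_cases hvU : v ∈ U
    · exact Or.inl hvU
    · have h2 : v ∉ G' ∪ W := fun h => hvU ((hUmem v).mpr (hpc v h))
      simp only [mem_union, mem_sdiff, not_or] at h1 h2 ⊢
      tauto
  -- The correction of the hub count makes this exact: `hdY` splits the `2 * (k - ℓ)` vertices for
  -- one free hub into the hub, an end and the vertices of a gap.
  have hYU : #(Y \ U) = t * ℓ + N * Fintype.card (Between k ℓ) := by
    have h1 : #(U ∪ (G \ G') ∪ (Y \ U)) = n := by
      rw [hn', ← card_univ]
      congr 1
      ext v
      simpa [or_assoc] using hpart v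
    rw [card_union_of_disjoint, card_union_of_disjoint hUG, hUcard, hGG'] at h1
    · have h2 : n = (s + 2 * #W) * (k - ℓ) + N * (Fintype.card (Between k ℓ) + ℓ + 1) := by
        rw [hdY, hnN]; ring
      have h3 : N * ℓ = (s + #W) * ℓ + t * ℓ := by rw [ht]; ring
      have h4 : N * (Fintype.card (Between k ℓ) + ℓ + 1) =
        N * Fintype.card (Between k ℓ) + N * ℓ + N := by ring
      omega
    · rw [disjoint_union_left]
      refine ⟨disjoint_sdiff, ?_⟩
      exact disjoint_of_subset_left sdiff_subset
        (disjoint_of_subset_right sdiff_subset hp.disjoint_hub_ordinary)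
  have hckk : ∀ i ≤ k, c ^ k ≤ c ^ i := fun i hi => pow_le_pow_of_le_one hc0.le hc1 hi
  obtain ⟨F, hF, hFd, hFhub, hFinner⟩ := hp.exists_spread_ends hℓ hℓk hε₀ hε hτ
    (Y' := Y \ U) sdiff_subset hc0 t (by
      rw [hYU]
      push_cast
      have h1 : (N : ℝ) ≤ N * Fintype.card (Between k ℓ) :=
        le_mul_of_one_le_right (by positivity) (by exact_mod_cast hd1)
      linarith) (by
      have h1 : ((ℓ : ℝ)) ^ 2 / n ≤ (k : ℝ) ^ 2 / n := by
        have : (ℓ : ℝ) ≤ k := by exact_mod_cast (by omega : ℓ ≤ k)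
        gcongr
      have h2 := hckk ℓ (by omega)
      linarith)
  -- all pieces
  let P : (Fin s ⊕ Fin (#W)) ⊕ Fin t → H.Piece ℓ :=
    Sum.elim p (fun i => H.trivialPiece (F i) (hF i).1)
  have hPd : ∀ i j, i ≠ j → Disjoint (P i).supp (P j).supp := by
    have hpt : ∀ i j, Disjoint (p i).supp (univ.image (F j)) := by
      intro i j
      rw [disjoint_left]
      intro v hv hv'
      obtain ⟨a, -, rfl⟩ := mem_image.mp hv'
      exact (mem_sdiff.mp ((hF j).2.1 a)).2 ((hUmem _).mpr ⟨i, hv⟩)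
    rintro (i | i) (j | j) hij
    · exact hpd i j fun h => hij (congrArg _ h)
    · exact hpt i j
    · exact (hpt j i).symm
    · change Disjoint (univ.image (F i)) (univ.image (F j))
      rw [disjoint_left]
      intro v hv hv'
      obtain ⟨a, -, rfl⟩ := mem_image.mp hv
      obtain ⟨b, -, hb⟩ := mem_image.mp hv'
      exact hFd i j (fun h => hij (congrArg _ h)) a b hb.symm
  have hPlen : ∑ i, (P i).blocks.length = s + 2 * #W := by
    rw [Fintype.sum_sum_type]
    simp only [P, Sum.elim_inl, Sum.elim_inr, hplen, trivialPiece, List.length_nil, sum_const_zero,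
      add_zero]
  have hJ : Fintype.card ((Fin s ⊕ Fin (#W)) ⊕ Fin t) = N := by
    simp [ht]
  set U' := univ.biUnion fun i => (P i).supp with hU'
  have hU'mem : ∀ v, v ∈ U' ↔ ∃ i, v ∈ (P i).supp := fun v => by simp [hU']
  have hUU' : U ⊆ U' := by
    intro v hv
    obtain ⟨i, hi⟩ := (hUmem v).mp hv
    exact (hU'mem v).mpr ⟨Sum.inl i, hi⟩
  have hU'sub : ∀ v ∈ U', v ∉ U → v ∈ Y := by
    intro v hv hvU
    obtain ⟨i | i, hi⟩ := (hU'mem v).mp hv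
    · exact absurd ((hUmem v).mpr ⟨i, hi⟩) hvU
    · obtain ⟨a, -, rfl⟩ := mem_image.mp (show v ∈ univ.image (F i) from hi)
      exact (mem_sdiff.mp ((hF i).2.1 a)).1
  have hYU' : #(Y \ U') = N * Fintype.card (Between k ℓ) := by
    have h1 := card_biUnion_supp P hPd
    rw [← hU', hPlen, hJ] at h1
    have h2 : #(U' \ U) + #U = #U' := card_sdiff_add_card_eq_card hUU'
    have h3 : #((Y \ U) \ (U' \ U)) + #(U' \ U) = #(Y \ U) := by
      refine card_sdiff_add_card_eq_card fun v hv => ?_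
      obtain ⟨hv1, hv2⟩ := mem_sdiff.mp hv
      exact mem_sdiff.mpr ⟨hU'sub v hv1 hv2, hv2⟩
    have h4 : (Y \ U) \ (U' \ U) = Y \ U' := by
      ext v
      have := @hUU' v
      simp only [mem_sdiff]
      tauto
    rw [h4] at h3
    have h5 : N * ℓ = (s + #W) * ℓ + t * ℓ := by rw [ht]; ring
    omega
  let eP : Fin N ≃ (Fin s ⊕ Fin (#W)) ⊕ Fin t := (Fintype.equivFinOfCardEq hJ).symm
  let eG : Fin N ≃ (G \ G' : Finset V) := ((G \ G').equivFinOfCardEq hGG').symm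
  let eY : Fin N × Between k ℓ ≃ (Y \ U' : Finset V) :=
    Fintype.equivOfCardEq (by
      rw [Fintype.card_prod, Fintype.card_fin, Fintype.card_coe, hYU'])
  have hNpos : (0 : ℝ) < N := lt_of_lt_of_le (by positivity) hcN
  -- Typicality and spread are measured in powers of `n`, the matching in powers of `N ≥ c * n`; the
  -- conversion costs a factor `c ^ k`.
  have hpowN : c ^ k * (n : ℝ) ^ (k - ℓ) ≤ (N : ℝ) ^ (k - ℓ) := by
    calc c ^ k * (n : ℝ) ^ (k - ℓ) ≤ c ^ (k - ℓ) * (n : ℝ) ^ (k - ℓ) := by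
          exact mul_le_mul_of_nonneg_right (hckk _ (Nat.sub_le k ℓ)) (by positivity)
      _ = (c * n) ^ (k - ℓ) := by rw [mul_pow]
      _ ≤ _ := pow_le_pow_left₀ (by positivity) hcN _
  have hk16 : (0 : ℝ) < 16 * k := by linarith
  have hηN : c ^ k / (16 * k) * (n : ℝ) ^ (k - ℓ) ≤ 1 / (16 * k) * (N : ℝ) ^ (k - ℓ) := by
    calc c ^ k / (16 * k) * (n : ℝ) ^ (k - ℓ) = 1 / (16 * k) * (c ^ k * (n : ℝ) ^ (k - ℓ)) := by
          ring
      _ ≤ _ := by gcongr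
  have htyp : ∀ Q : Fin ℓ → V, H.Typical G Y τ Q →
      (H.endMiss G Y Q : ℝ) ≤ 1 / (16 * k) * (N : ℝ) ^ (k - ℓ) := by
    intro Q hQ
    refine le_trans (le_trans hQ ?_) hηN
    refine mul_le_mul_of_nonneg_right ?_ (by positivity)
    rw [le_div_iff₀ hk16]
    exact hτc
  have hPt : ∀ i, H.Typical G Y τ (P i).start ∧ H.Typical G Y τ (P i).finish := by
    rintro (i | i)
    · exact (hpg i).1
    · exact ⟨(hF i).2.2, (hF i).2.2⟩
  -- Only the zero-edge pieces were chosen with spread. The special pieces, at most `2 * δ * n` in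
  -- number, are charged the trivial maximum.
  have hspread : ∀ (f : (Fin ℓ → V) → ℕ) (end' : H.Piece ℓ → Fin ℓ → V),
      (∀ i, end' (P (Sum.inr i)) = F i) → (∀ Q, f Q ≤ n ^ (k - ℓ - 1)) →
      (∑ i, (f (F i) : ℝ) ≤ (Real.log ((k + 1) * n) + 16 * ε₁ / c ^ ℓ * t) *
        (n : ℝ) ^ (k - ℓ - 1)) →
      ∑ i, (f (end' (P (eP i))) : ℝ) ≤ 1 / (16 * k) * (N : ℝ) ^ (k - ℓ) := by
    intro f end' hend hf hsum
    refine le_trans ?_ hηN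
    rw [Equiv.sum_comp eP (fun j => (f (end' (P j)) : ℝ)), Fintype.sum_sum_type]
    simp only [hend]
    have h1 : ∑ i, (f (end' (P (Sum.inl i))) : ℝ) ≤ (2 * δ * n) * (n : ℝ) ^ (k - ℓ - 1) := by
      refine (sum_le_card_nsmul _ _ ((n : ℝ) ^ (k - ℓ - 1))
        fun i _ => by exact_mod_cast hf _).trans ?_
      rw [nsmul_eq_mul, card_univ, Fintype.card_sum, Fintype.card_fin, Fintype.card_fin]
      refine mul_le_mul_of_nonneg_right ?_ (by positivity)
      push_cast
      linarith
    have h2 : (n : ℝ) ^ (k - ℓ) = n * (n : ℝ) ^ (k - ℓ - 1) := by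
      rw [← pow_succ']
      congr 1
      omega
    have h3 : 16 * ε₁ / c ^ ℓ * t ≤ 16 * ε₁ / c ^ k * n := by
      have h4 := hckk ℓ (by omega)
      have h5 : (t : ℝ) ≤ n := by
        have h6 : t ≤ N := by omega
        have h7 : N ≤ n := by
          rw [← hGG']
          exact card_le_univ _
        exact_mod_cast h6.trans h7
      gcongr
    have h4 : 2 * δ * n + (Real.log ((k + 1) * n) + 16 * ε₁ / c ^ k * n) ≤
        c ^ k / (16 * k) * n := by
      have h5 : 2 * δ + Real.log ((k + 1) * n) / n + 16 * ε₁ / c ^ k ≤ c ^ k / (16 * k) := by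
        rw [le_div_iff₀ hk16]
        exact hlog
      calc 2 * δ * n + (Real.log ((k + 1) * n) + 16 * ε₁ / c ^ k * n) =
          (2 * δ + Real.log ((k + 1) * n) / n + 16 * ε₁ / c ^ k) * n := by
            field_simp
            ring
        _ ≤ _ := by gcongr
    rw [h2]
    calc _ ≤ (2 * δ * n) * (n : ℝ) ^ (k - ℓ - 1) +
          (Real.log ((k + 1) * n) + 16 * ε₁ / c ^ ℓ * t) * (n : ℝ) ^ (k - ℓ - 1) :=
          add_le_add h1 hsum
      _ = (2 * δ * n + (Real.log ((k + 1) * n) + 16 * ε₁ / c ^ ℓ * t)) *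
          (n : ℝ) ^ (k - ℓ - 1) := by ring
      _ ≤ (c ^ k / (16 * k) * n) * (n : ℝ) ^ (k - ℓ - 1) := by
          refine mul_le_mul_of_nonneg_right ?_ (by positivity)
          linarith
      _ = _ := by ring
  -- With `η = 1 / (16 * k)` the matching condition reads `1 / 4 + (2 * k) ^ 2 / N < 1`, and `hnc`
  -- keeps the second term below `1 / 2`.
  refine hasHamiltonCycle_of_pieces (G := G) (Y := Y) hℓ hℓk (N := N) ?_ (fun i => P (eP i))
    (fun i => (eG i).1) (fun i j h => eG.injective (Subtype.ext h))
    (fun i => (mem_sdiff.mp (eG i).2).1) (fun d i => (eY (i, d)).1)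
    (fun d i j h => congrArg Prod.fst (eY.injective (Subtype.ext h)))
    (fun d i => (mem_sdiff.mp (eY (i, d)).2).1) ?_ ?_ (1 / (16 * k)) ?_ (by positivity)
    (fun i => ⟨htyp _ (hPt _).1, htyp _ (hPt _).2⟩) ?_ ?_
  · have h1 : (16 : ℝ) * 9 ≤ 16 * (k : ℝ) ^ 2 := by nlinarith
    have h2 : (2 : ℝ) ≤ N := by linarith
    exact_mod_cast h2
  · intro v
    by_cases hv : v ∈ U'
    · obtain ⟨i, hi⟩ := (hU'mem v).mp hv
      exact Or.inl ⟨eP.symm i, by simpa using hi⟩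
    · rcases hpart v with h | h | h
      · exact absurd (hUU' h) hv
      · exact Or.inr (Or.inl ⟨eG.symm ⟨v, h⟩, by simp⟩)
      · have h1 : v ∈ Y \ U' := mem_sdiff.mpr ⟨(mem_sdiff.mp h).1, hv⟩
        refine Or.inr (Or.inr ⟨(eY.symm ⟨v, h1⟩).2, (eY.symm ⟨v, h1⟩).1, ?_⟩)
        simp
  · rw [sum_add_distrib, Equiv.sum_comp eP (fun j => (P j).blocks.length), hPlen, sum_const,
      card_univ, Fintype.card_fin, smul_eq_mul, ← hn', hnN]
    ring
  · have h1 : (2 * k : ℝ) ^ 2 / N < 1 / 2 := by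
      rw [div_lt_iff₀ hNpos]
      nlinarith
    have h2 : (2 * k : ℝ) * (2 * (1 / (16 * k))) = 1 / 4 := by
      field_simp
      norm_num
    rw [h2]
    linarith
  · intro h hh
    exact ⟨hspread _ (fun p => p.start) (fun _ => rfl) (H.hubMiss_le hℓ hℓk Y h) (hFhub h hh),
      hspread _ (fun p => p.finish) (fun _ => rfl) (H.hubMiss_le hℓ hℓk Y h) (hFhub h hh)⟩
  · intro q y hy
    exact ⟨hspread _ (fun p => p.start) (fun _ => rfl) (H.innerMiss_le hℓ hℓk G Y q y)
        (hFinner q y hy),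
      hspread _ (fun p => p.finish) (fun _ => rfl) (H.innerMiss_le hℓ hℓk G Y q y)
        (hFinner q y hy)⟩

end HubPartition

end Completion

/-! ### From an extremal set to a hub partition. -/

section Extremal

variable {V : Type*} [DecidableEq V] {k : ℕ}

/-- An edge containing the `k - 1` entries is recovered from its one remaining vertex, so the degree
is at most the number of such vertices. -/
theorem le_count_joins [Finite V] {H : KGraph V k} (hk : 1 ≤ k) {I : Type*} [Fintype I]
    (hI : Fintype.card I = k - 1) (g : I → V) (hg : Function.Injective g) :
    H.minDegree (k - 1) ≤ count (fun v => H.Joins v g) := by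
  classical
  have := Fintype.ofFinite V
  have hS : #(univ.image g) = k - 1 := by
    rw [card_image_of_injective _ hg, card_univ, hI]
  have h0 : H.minDegree (k - 1) ≤ H.degree (univ.image g) := Nat.sInf_le ⟨_, hS, rfl⟩
  refine h0.trans ?_
  rw [count_eq_card, degree]
  refine (card_le_card (t := ({v | H.Joins v g} : Finset V).image
    (fun v => insert v (univ.image g))) ?_).trans card_image_le
  intro e he
  obtain ⟨he, hSe⟩ := mem_filter.mp he
  have h1 : #(e \ univ.image g) = 1 := by
    rw [card_sdiff_of_subset hSe, H.card_eq e he, hS]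
    omega
  obtain ⟨v, hv⟩ := card_eq_one.mp h1
  have h2 : insert v (univ.image g) = e := by
    rw [insert_eq, ← hv, sdiff_union_of_subset hSe]
  refine mem_image.mpr ⟨v, ?_, h2⟩
  rw [mem_filter]
  refine ⟨mem_univ v, ?_⟩
  change insert v _ ∈ H.edges
  rw [h2]
  exact he

/-- A tuple with large codegree has few non-neighbours in a set of about that size, unless it has
neighbours outside. -/
theorem count_not_joins_le [Fintype V] (H : KGraph V k) {I : Type*} [Fintype I] (g : I → V)
    (Z : Finset V) {β : ℝ} (hZ : (#Z : ℝ) ≤ count (fun v => H.Joins v g) + β) :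
    (count (fun v => v ∈ Z ∧ ¬ H.Joins v g) : ℝ) ≤ β + count (fun v => v ∉ Z ∧ H.Joins v g) := by
  classical
  have h1 : count (fun v => v ∈ Z ∧ ¬ H.Joins v g) + count (fun v => v ∈ Z ∧ H.Joins v g) =
      #Z := by
    simp only [count_eq_card]
    rw [← card_filter_add_card_filter_not (s := Z) (fun v => ¬ H.Joins v g)]
    congr 2 <;> ext v <;> simp
  have h2 : count (fun v => H.Joins v g) ≤ count (fun v => v ∈ Z ∧ H.Joins v g) +
      count (fun v => v ∉ Z ∧ H.Joins v g) :=
    (count_mono fun v hv => by tauto).trans (count_or_le _ _)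
  have h1' : (count (fun v => v ∈ Z ∧ ¬ H.Joins v g) : ℝ) +
      count (fun v => v ∈ Z ∧ H.Joins v g) = #Z := by exact_mod_cast h1
  have h2' : (count (fun v => H.Joins v g) : ℝ) ≤ count (fun v => v ∈ Z ∧ H.Joins v g) +
      count (fun v => v ∉ Z ∧ H.Joins v g) := by exact_mod_cast h2
  linarith

/-- `count_not_joins_le` summed over tuples; non-injective ones, to which the codegree condition
does not apply, are charged all vertices. The filter `Q` allows both all tuples of `B` and the
tuples through a fixed ordinary vertex. -/
theorem count_pairs_not_joins_le [Fintype V] (H : KGraph V k) {I : Type*} [Fintype I]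
    (Z : Finset V) {β : ℝ} (hβ : 0 ≤ β)
    (hZ : ∀ g : I → V, Function.Injective g → (#Z : ℝ) ≤ count (fun v => H.Joins v g) + β)
    (Q : (I → V) → Prop) :
    (count (fun p : V × (I → V) => p.1 ∈ Z ∧ Q p.2 ∧ ¬ H.Joins p.1 p.2) : ℝ) ≤
      β * count Q + Fintype.card V * count (fun g : I → V => Q g ∧ ¬ Function.Injective g) +
        count (fun p : V × (I → V) => p.1 ∉ Z ∧ Q p.2 ∧ H.Joins p.1 p.2) := by
  classical
  have hswap : ∀ P : V → (I → V) → Prop, count (fun p : V × (I → V) => P p.1 p.2) =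
      ∑ g, count (fun v => P v g) := by
    intro P
    rw [← count_prod (fun p : (I → V) × V => P p.2 p.1)]
    exact le_antisymm
      (count_le_of_injOn Prod.swap (fun _ h => h) fun _ _ _ _ h => Prod.swap_injective h)
      (count_le_of_injOn Prod.swap (fun _ h => h) fun _ _ _ _ h => Prod.swap_injective h)
  rw [hswap (fun v g => v ∈ Z ∧ Q g ∧ ¬ H.Joins v g),
    hswap (fun v g => v ∉ Z ∧ Q g ∧ H.Joins v g), count_eq_card Q,
    count_eq_card (fun g : I → V => Q g ∧ ¬ Function.Injective g), ← sum_boole, ← sum_boole]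
  push_cast
  rw [mul_sum, mul_sum, ← sum_add_distrib, ← sum_add_distrib]
  refine sum_le_sum fun g _ => ?_
  by_cases hQ : Q g
  · simp only [hQ, true_and, if_true, mul_one]
    by_cases hg : Function.Injective g
    · simpa [hg] using H.count_not_joins_le g Z (hZ g hg)
    · have h1 : (count (fun v => v ∈ Z ∧ ¬ H.Joins v g) : ℝ) ≤ Fintype.card V := by
        exact_mod_cast count_le_card _
      have h2 : (0 : ℝ) ≤ count (fun v => v ∉ Z ∧ H.Joins v g) := by positivity
      simp only [hg, not_false_eq_true, if_true, mul_one]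
      linarith
  · have h0 : count (fun v => v ∈ Z ∧ Q g ∧ ¬ H.Joins v g) = 0 := by
      rw [count, Nat.card_eq_zero]
      exact Or.inl ⟨fun x => hQ x.2.2.1⟩
    rw [h0, Nat.cast_zero]
    simp only [hQ, false_and, if_false, mul_zero, zero_add]
    positivity

/-- The vertex and the `k - 1` entries all lie in the edge they form, so one edge comes from at most
`k ^ k` pairs. -/
theorem count_joins_le_edgesIn [Fintype V] (H : KGraph V k) (hk : 1 ≤ k) {I : Type*} [Fintype I]
    (hI : Fintype.card I = k - 1) (B : Finset V) :
    count (fun p : V × (I → V) => p.1 ∈ B ∧ (∀ i, p.2 i ∈ B) ∧ H.Joins p.1 p.2) ≤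
      H.edgesIn B * k ^ k := by
  refine (count_mono (Q := fun p : V × (I → V) => ∃ e ∈ H.edges.filter (fun e => e ⊆ B),
    p.1 ∈ e ∧ ∀ i, p.2 i ∈ e) ?_).trans ((count_exists_le _ _).trans ?_)
  · rintro ⟨v, g⟩ ⟨hv, hg, hj⟩
    refine ⟨_, mem_filter.mpr ⟨hj, insert_subset hv fun x hx => ?_⟩, mem_insert_self _ _,
      fun i => mem_insert_of_mem (mem_image_of_mem _ (mem_univ i))⟩
    obtain ⟨i, -, rfl⟩ := mem_image.mp hx
    exact hg i
  · refine (sum_le_card_nsmul _ _ (k ^ k) fun e he => ?_).trans (smul_eq_mul _ _).le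
    have h1 := count_forall_mem (I := Option I) e
    rw [Fintype.card_option, hI, Nat.sub_add_cancel hk, H.card_eq e (mem_filter.mp he).1] at h1
    rw [← h1]
    refine count_le_of_injOn (fun p o => o.elim p.1 p.2) ?_ ?_
    · rintro ⟨v, g⟩ ⟨hv, hg⟩ (_ | i)
      · exact hv
      · exact hg i
    · rintro ⟨v, g⟩ ⟨v', g'⟩ _ _ h
      exact Prod.ext (congrFun h none) (funext fun i => congrFun h (some i))

/-- Exchanging the distinguished vertex of an edge with another one. -/
theorem count_joins_apply_eq_le [Fintype V] (H : KGraph V k) {I : Type*} [Fintype I] (Y : Finset V)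
    (y : V) (q : I) :
    count (fun p : V × (I → V) => p.1 ∈ Y ∧ (∀ i, p.2 i ∈ Y) ∧ p.2 q = y ∧ H.Joins p.1 p.2) ≤
      count (fun g : I → V => (∀ i, g i ∈ Y) ∧ H.Joins y g) := by
  classical
  refine count_le_of_injOn (fun p => Function.update p.2 q p.1) ?_ ?_
  · rintro ⟨v, g⟩ ⟨hv, hg, rfl, hj⟩
    refine ⟨fun i => ?_, ?_⟩
    · by_cases hi : i = q
      · subst hi
        simpa using hv
      · simpa [hi] using hg i
    · have : insert (g q) (univ.image (Function.update g q v)) = insert v (univ.image g) := by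
        ext x
        simp only [mem_insert, mem_image, mem_univ, true_and]
        constructor
        · rintro (rfl | ⟨i, rfl⟩)
          · exact Or.inr ⟨q, rfl⟩
          · by_cases hi : i = q
            · subst hi
              simp
            · exact Or.inr ⟨i, by simp [hi]⟩
        · rintro (rfl | ⟨i, rfl⟩)
          · exact Or.inr ⟨q, by simp⟩
          · by_cases hi : i = q
            · exact Or.inl (by rw [hi])
            · exact Or.inr ⟨i, by simp [hi]⟩
      change insert _ _ ∈ H.edges
      rw [this]
      exact hj
  · rintro ⟨v, g⟩ ⟨v', g'⟩ ⟨-, -, hg, -⟩ ⟨-, -, hg', -⟩ h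
    refine Prod.ext ?_ (funext fun i => ?_)
    · simpa using congrFun h q
    · by_cases hi : i = q
      · subst hi
        exact hg.trans hg'.symm
      · simpa [hi] using congrFun h i

set_option maxHeartbeats 1600000 in
/-- An extremal `k`-graph of large codegree has a hub partition. -/
theorem exists_hubPartition [Fintype V] [Nonempty V] {H : KGraph V k} {ℓ : ℕ} (hℓ : 1 ≤ ℓ)
    (hℓk : 2 * ℓ < k) {B : Finset V} {Δ ε₀ ε₁ ρ : ℝ}
    (hB : #B = (2 * (k - ℓ) - 1) * Fintype.card V / (2 * (k - ℓ)))
    (he : (H.edgesIn B : ℝ) ≤ Δ * (Fintype.card V : ℝ) ^ k)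
    (hdeg : Fintype.card V ≤ 2 * (k - ℓ) * H.minDegree (k - 1)) (hn4 : 4 ≤ Fintype.card V)
    (hρ : (k : ℝ) ^ k * Δ + (1 + (k : ℝ) ^ 2) / Fintype.card V ≤ ρ * ε₀) (hε₀ : 0 < ε₀)
    (hε : 2 * ε₀ ≤ ε₁) (hε₁ : ε₁ ≤ 1) (hkρ : k * ρ ≤ ε₀) (hkn : (k : ℝ) ^ 2 / Fintype.card V ≤ ε₁)
    (hΔ : 0 ≤ Δ) (hsmall : ε₀ + ε₁ ≤ (1 / 2 : ℝ) ^ (k - 1)) :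
    ∃ G W Y, H.HubPartition ℓ G W Y (2 * ε₀) ε₁ (4 * k * ρ) := by
  classical
  set n := Fintype.card V with hn
  have hn0 : (0 : ℝ) < n := by exact_mod_cast Fintype.card_pos
  have hcR := card_rest hℓ hℓk
  have hk3 : (3 : ℝ) ≤ k := by exact_mod_cast (by omega : 3 ≤ k)
  set r := k - ℓ with hr
  have hr2 : 2 ≤ r := by omega
  have hrk : (r : ℝ) ≤ k := by exact_mod_cast Nat.sub_le k ℓ
  have hr2' : (2 : ℝ) ≤ r := by exact_mod_cast hr2
  have hpow : (0 : ℝ) < (n : ℝ) ^ (k - 1) := by positivity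
  have hnk : (n : ℝ) ^ k = n * (n : ℝ) ^ (k - 1) := by
    rw [← pow_succ', Nat.sub_add_cancel (by omega)]
  have hρn : 1 / n ≤ ρ := by
    have h1 : (1 : ℝ) / n ≤ (1 + (k : ℝ) ^ 2) / n := by
      gcongr
      nlinarith
    have h2 : (0 : ℝ) ≤ (k : ℝ) ^ k * Δ := by positivity
    have h3 : 1 / (n : ℝ) ≤ ρ * ε₀ := by linarith
    have h4 : 0 ≤ ρ := by
      have : (0 : ℝ) < 1 / n := by positivity
      exact nonneg_of_mul_nonneg_left (this.le.trans h3) hε₀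
    exact h3.trans (mul_le_of_le_one_right h4 (by linarith))
  have hρ0 : 0 < ρ := lt_of_lt_of_le (by positivity) hρn
  have h1ρ : 1 ≤ ρ * n := (div_le_iff₀ hn0).mp hρn
  -- sizes of `B` and its complement
  have hBhi : 2 * r * #B ≤ (2 * r - 1) * n := by
    rw [hB]
    exact Nat.mul_div_le _ _
  have hBlo : (2 * r - 1) * n < 2 * r * #B + 2 * r := by
    rw [hB]
    have := Nat.lt_mul_div_succ ((2 * r - 1) * n) (show 0 < 2 * r by omega)
    rwa [mul_add, mul_one] at this
  have hr1 : ((2 * r - 1 : ℕ) : ℝ) = 2 * r - 1 := by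
    rw [Nat.cast_sub (by omega)]
    push_cast
    ring
  have hBhi' : 2 * r * (#B : ℝ) ≤ (2 * r - 1) * n := by
    rw [← hr1]
    exact_mod_cast hBhi
  have hBlo' : (2 * r - 1) * (n : ℝ) < 2 * r * #B + 2 * r := by
    rw [← hr1]
    exact_mod_cast hBlo
  -- As `r ≥ 2`, the set `B` has more than `3 * n / 4 - 1` vertices, and `n ≥ 4`.
  have hBhalf : (n : ℝ) / 2 ≤ #B := by
    have h4 : (4 : ℝ) ≤ n := by exact_mod_cast hn4
    nlinarith
  set A : Finset V := Bᶜ with hA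
  have hAB : (#A : ℝ) = n - #B := by
    have h1 : #A + #B = n := by rw [hA, card_compl_add_card]
    have h2 : (#A + #B : ℝ) = n := by exact_mod_cast h1
    linarith
  have hAhi : 2 * r * (#A : ℝ) ≤ n + 2 * r := by rw [hAB]; linarith
  have hAlo : (n : ℝ) ≤ 2 * r * #A := by rw [hAB]; linarith
  have hcodeg : ∀ g : Rest k ℓ → V, Function.Injective g →
      n ≤ 2 * r * count (fun v => H.Joins v g) := fun g hg =>
    hdeg.trans (Nat.mul_le_mul_left _ (le_count_joins (by omega) hcR g hg))
  have hZ : ∀ (Z : Finset V) (β : ℝ), 2 * r * (#Z : ℝ) ≤ n + 2 * r * β →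
      ∀ g : Rest k ℓ → V, Function.Injective g →
        (#Z : ℝ) ≤ count (fun v => H.Joins v g) + β := by
    intro Z β h g hg
    have h1 : (n : ℝ) ≤ 2 * r * count (fun v => H.Joins v g) := by exact_mod_cast hcodeg g hg
    have h2 : (2 * r : ℝ) * #Z ≤ 2 * r * (count (fun v => H.Joins v g) + β) := by linarith
    exact le_of_mul_le_mul_left h2 (by linarith)
  -- edges inside `B`
  have hBB : (count (fun p : V × (Rest k ℓ → V) => p.1 ∈ B ∧ (∀ i, p.2 i ∈ B) ∧
      H.Joins p.1 p.2) : ℝ) ≤ (k : ℝ) ^ k * Δ * (n : ℝ) ^ k := by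
    have h1 : (count (fun p : V × (Rest k ℓ → V) => p.1 ∈ B ∧ (∀ i, p.2 i ∈ B) ∧
      H.Joins p.1 p.2) : ℝ) ≤ H.edgesIn B * (k : ℝ) ^ k := by
      exact_mod_cast H.count_joins_le_edgesIn (by omega) hcR B
    calc _ ≤ H.edgesIn B * (k : ℝ) ^ k := h1
      _ ≤ Δ * (n : ℝ) ^ k * (k : ℝ) ^ k := by gcongr
      _ = _ := by ring
  -- Tuples of `B` have few neighbours in `B`, so they are joined to almost all of `A`. The slack `β
  -- = 1` absorbs the rounding in the size of `B`.
  have hAnot : (count (fun p : V × (Rest k ℓ → V) => p.1 ∈ A ∧ (∀ i, p.2 i ∈ B) ∧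
      ¬ H.Joins p.1 p.2) : ℝ) ≤ ρ * ε₀ * (n : ℝ) ^ k := by
    have h1 := H.count_pairs_not_joins_le (I := Rest k ℓ) A zero_le_one
      (hZ A 1 (by linarith)) (fun g => ∀ i, g i ∈ B)
    have h2 : (count (fun g : Rest k ℓ → V => ∀ i, g i ∈ B) : ℝ) ≤ (n : ℝ) ^ (k - 1) := by
      have := count_le_card (fun g : Rest k ℓ → V => ∀ i, g i ∈ B)
      rw [Fintype.card_fun, hcR] at this
      exact_mod_cast this
    have h3 : (count (fun g : Rest k ℓ → V => (∀ i, g i ∈ B) ∧ ¬ Function.Injective g) : ℝ) ≤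
        (k : ℝ) ^ 2 / n * (n : ℝ) ^ (k - 1) := by
      have h4 := cast_count_not_injective_le (I := Rest k ℓ) (α := V)
      rw [hcR] at h4
      refine (Nat.cast_le.mpr (count_mono fun g hg => hg.2)).trans (h4.trans ?_)
      have : ((k - 1 : ℕ) : ℝ) ≤ k := by exact_mod_cast Nat.sub_le k 1
      gcongr
    have h4 : count (fun p : V × (Rest k ℓ → V) => p.1 ∉ A ∧ (∀ i, p.2 i ∈ B) ∧
        H.Joins p.1 p.2) = count (fun p : V × (Rest k ℓ → V) => p.1 ∈ B ∧ (∀ i, p.2 i ∈ B) ∧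
        H.Joins p.1 p.2) := by
      simp [hA]
    rw [h4] at h1
    calc _ ≤ 1 * (n : ℝ) ^ (k - 1) + n * ((k : ℝ) ^ 2 / n * (n : ℝ) ^ (k - 1)) +
          (k : ℝ) ^ k * Δ * (n : ℝ) ^ k := by
          refine h1.trans ?_
          gcongr
      _ = ((k : ℝ) ^ k * Δ + (1 + (k : ℝ) ^ 2) / n) * (n : ℝ) ^ k := by
          rw [hnk]
          field_simp
          ring
      _ ≤ _ := by gcongr
  -- the three classes
  set G : Finset V := {v | (count (fun g : Rest k ℓ → V => (∀ i, g i ∈ B) ∧ ¬ H.Joins v g) : ℝ) ≤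
    ε₀ * (n : ℝ) ^ (k - 1)} with hG
  set X : Finset V := {v | ε₁ * (n : ℝ) ^ (k - 1) ≤
    (count (fun g : Rest k ℓ → V => (∀ i, g i ∈ B) ∧ H.Joins v g) : ℝ)} with hX
  have hGX : G ⊆ X := by
    intro v hv
    simp only [hG, hX, mem_filter, mem_univ, true_and] at hv ⊢
    have h1 : ((1 / 2 : ℝ) * n) ^ (k - 1) ≤ count (fun g : Rest k ℓ → V => ∀ i, g i ∈ B) := by
      rw [count_forall_mem, hcR]
      push_cast
      exact pow_le_pow_left₀ (by positivity) (by linarith) _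
    have h2 : (count (fun g : Rest k ℓ → V => ∀ i, g i ∈ B) : ℝ) ≤
        count (fun g : Rest k ℓ → V => (∀ i, g i ∈ B) ∧ ¬ H.Joins v g) +
        count (fun g : Rest k ℓ → V => (∀ i, g i ∈ B) ∧ H.Joins v g) := by
      exact_mod_cast count_and_not_add _ _
    rw [mul_pow] at h1
    have h3 := mul_le_mul_of_nonneg_right hsmall hpow.le
    linarith
  -- Markov's inequality, applied to the misses between `A` and `B` and to the edges inside `B`; it
  -- shows that the classes differ from `A` and `B` in few vertices.
  have hmarkov : ∀ (S : Finset V) (P : V → (Rest k ℓ → V) → Prop) (Z : Finset V) (ε K : ℝ),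
      0 < ε → S ⊆ Z → (∀ v ∈ S, ε * (n : ℝ) ^ (k - 1) ≤
        (count (fun g : Rest k ℓ → V => (∀ i, g i ∈ B) ∧ P v g) : ℝ)) →
      (count (fun p : V × (Rest k ℓ → V) => p.1 ∈ Z ∧ (∀ i, p.2 i ∈ B) ∧ P p.1 p.2) : ℝ) ≤
        K * ε * (n : ℝ) ^ k → (#S : ℝ) ≤ K * n := by
    intro S P Z ε K hε hSZ hS hK
    have h1 : ∑ v ∈ S, count (fun g : Rest k ℓ → V => (∀ i, g i ∈ B) ∧ P v g) ≤
        count (fun p : V × (Rest k ℓ → V) => p.1 ∈ Z ∧ (∀ i, p.2 i ∈ B) ∧ P p.1 p.2) :=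
      sum_count_le S _ _ (fun v g => (v, g)) (fun v hv g hg => ⟨hSZ hv, hg⟩)
        fun v _ v' _ g g' h => ⟨congrArg Prod.fst h, congrArg Prod.snd h⟩
    have h2 : (#S : ℝ) * (ε * (n : ℝ) ^ (k - 1)) ≤
        ∑ v ∈ S, (count (fun g : Rest k ℓ → V => (∀ i, g i ∈ B) ∧ P v g) : ℝ) := by
      rw [← nsmul_eq_mul]
      exact card_nsmul_le_sum _ _ _ hS
    have h3 : (∑ v ∈ S, (count (fun g : Rest k ℓ → V => (∀ i, g i ∈ B) ∧ P v g) : ℝ)) ≤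
        K * ε * (n : ℝ) ^ k := by
      refine le_trans ?_ hK
      exact_mod_cast h1
    have h4 : (#S : ℝ) * (ε * (n : ℝ) ^ (k - 1)) ≤ K * n * (ε * (n : ℝ) ^ (k - 1)) := by
      calc _ ≤ K * ε * (n : ℝ) ^ k := h2.trans h3
        _ = _ := by rw [hnk]; ring
    exact le_of_mul_le_mul_right h4 (by positivity)
  have hAG : (#(A \ G) : ℝ) ≤ ρ * n := by
    refine hmarkov _ (fun v g => ¬ H.Joins v g) A ε₀ ρ hε₀ sdiff_subset ?_ hAnot
    intro v hv
    have := (mem_sdiff.mp hv).2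
    simp only [hG, mem_filter, mem_univ, true_and, not_le] at this
    exact this.le
  have hXB : (#(X ∩ B) : ℝ) ≤ ρ * n := by
    refine hmarkov _ (fun v g => H.Joins v g) B ε₁ ρ (by linarith) inter_subset_right ?_ ?_
    · intro v hv
      have := (mem_inter.mp hv).1
      simpa only [hX, mem_filter, mem_univ, true_and] using this
    · refine hBB.trans ?_
      have h1 : (0 : ℝ) ≤ (1 + (k : ℝ) ^ 2) / n := by positivity
      have h2 : ρ * ε₀ ≤ ρ * ε₁ := mul_le_mul_of_nonneg_left (by linarith) hρ0.le
      refine mul_le_mul_of_nonneg_right (by linarith) (by positivity)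
  set Y : Finset V := Xᶜ with hY
  have hYB : Y \ B ⊆ A \ G := by
    intro v hv
    obtain ⟨hv1, hv2⟩ := mem_sdiff.mp hv
    exact mem_sdiff.mpr ⟨mem_compl.mpr hv2, fun h => mem_compl.mp hv1 (hGX h)⟩
  have hBY : B \ Y ⊆ X ∩ B := by
    intro v hv
    obtain ⟨hv1, hv2⟩ := mem_sdiff.mp hv
    exact mem_inter.mpr ⟨by simpa [hY] using hv2, hv1⟩
  have hYB' : (#(Y \ B) : ℝ) ≤ ρ * n := le_trans (by exact_mod_cast card_le_card hYB) hAG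
  have hBY' : (#(B \ Y) : ℝ) ≤ ρ * n := le_trans (by exact_mod_cast card_le_card hBY) hXB
  have hcRk : (Fintype.card (Rest k ℓ) : ℝ) ≤ k := by
    rw [hcR]
    exact_mod_cast Nat.sub_le k 1
  -- Degrees were measured in `B` but are needed in `Y`. The exchange costs `k * ρ ≤ ε₀` in density.
  have htransfer : ∀ (S T : Finset V) (P : (Rest k ℓ → V) → Prop), (#(S \ T) : ℝ) ≤ ρ * n →
      (count (fun g => (∀ i, g i ∈ S) ∧ P g) : ℝ) ≤
        count (fun g => (∀ i, g i ∈ T) ∧ P g) + ε₀ * (n : ℝ) ^ (k - 1) := by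
    intro S T P hST
    have h1 : (count (fun g : Rest k ℓ → V => ∃ i, g i ∈ S \ T) : ℝ) ≤
        ε₀ * (n : ℝ) ^ (k - 1) := by
      rw [← hcR]
      refine cast_count_exists_mem_le _ ?_
      calc (Fintype.card (Rest k ℓ) : ℝ) * #(S \ T) ≤ k * (ρ * n) := by gcongr
        _ = k * ρ * n := by ring
        _ ≤ _ := by gcongr
    have h2 : (count (fun g => (∀ i, g i ∈ S) ∧ P g) : ℝ) ≤
        count (fun g => (∀ i, g i ∈ T) ∧ P g) +
          count (fun g : Rest k ℓ → V => ∃ i, g i ∈ S \ T) := by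
      norm_cast
      refine (count_mono fun g hg => ?_).trans (count_or_le _ _)
      by_cases h : ∀ i, g i ∈ T
      · exact Or.inl ⟨h, hg.2⟩
      · push Not at h
        obtain ⟨i, hi⟩ := h
        exact Or.inr ⟨i, mem_sdiff.mpr ⟨hg.1 i, hi⟩⟩
    linarith
  have hXcard : (#X : ℝ) ≤ #A + ρ * n ∧ #A - ρ * n ≤ (#X : ℝ) := by
    have h1 : #X ≤ #A + #(X ∩ B) := by
      refine (card_le_card (t := A ∪ (X ∩ B)) fun v hv => ?_).trans (card_union_le _ _)
      simp only [hA, mem_union, mem_compl, mem_inter]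
      tauto
    have h2 : #A ≤ #(A \ G) + #X := by
      refine (card_le_card (t := (A \ G) ∪ X) fun v hv => ?_).trans (card_union_le _ _)
      by_cases h : v ∈ G
      · exact mem_union_right _ (hGX h)
      · exact mem_union_left _ (mem_sdiff.mpr ⟨hv, h⟩)
    have h1' : (#X : ℝ) ≤ #A + #(X ∩ B) := by exact_mod_cast h1
    have h2' : (#A : ℝ) ≤ #(A \ G) + #X := by exact_mod_cast h2
    constructor <;> linarith
  have hXhi : 2 * r * (#X : ℝ) ≤ n + 2 * r * (2 * (ρ * n)) := by
    have h1 : 2 * r * (#X : ℝ) ≤ 2 * r * (#A + ρ * n) := by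
      have := hXcard.1
      gcongr
    have h2 : 2 * (r : ℝ) * 1 ≤ 2 * r * (ρ * n) := by gcongr
    linarith
  have hsparse : ∀ y ∈ Y, (count (fun g : Rest k ℓ → V => (∀ i, g i ∈ Y) ∧ H.Joins y g) : ℝ) ≤
      2 * ε₁ * (n : ℝ) ^ (k - 1) := by
    intro y hy
    have h1 := htransfer Y B (fun g => H.Joins y g) hYB'
    simp only [hY, hX, mem_compl, mem_filter, mem_univ, true_and, not_le] at hy
    have h2 : ε₀ * (n : ℝ) ^ (k - 1) ≤ ε₁ * (n : ℝ) ^ (k - 1) := by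
      gcongr
      linarith
    linarith
  have hsparse_at : ∀ y ∈ Y, ∀ q : Rest k ℓ, (count (fun p : V × (Rest k ℓ → V) =>
      p.1 ∈ Y ∧ (∀ i, p.2 i ∈ Y) ∧ p.2 q = y ∧ H.Joins p.1 p.2) : ℝ) ≤
      2 * ε₁ * (n : ℝ) ^ (k - 1) := by
    intro y hy q
    refine le_trans ?_ (hsparse y hy)
    exact_mod_cast H.count_joins_apply_eq_le Y y q
  refine ⟨G, X \ G, Y, ?_⟩
  have hXG : G ∪ X \ G = X := union_sdiff_of_subset hGX
  have hXGc : (#G : ℝ) + #(X \ G) = #X := by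
    have := card_sdiff_add_card_eq_card hGX
    rw [add_comm]
    exact_mod_cast this
  refine
    { disjoint_hub_partial := disjoint_sdiff
      disjoint_hub_ordinary := disjoint_of_subset_left hGX disjoint_compl_right
      disjoint_partial_ordinary := disjoint_of_subset_left sdiff_subset disjoint_compl_right
      union := ?_
      card_partial := ?_
      balance := ?_
      hub := ?_
      partial_hub := ?_
      inner := ?_
      sparse := hsparse
      sparse_at := hsparse_at
      codegree := hcodeg }
  · rw [hXG, hY, union_compl]
  · have h1 : #(X \ G) ≤ #(A \ G) + #(X ∩ B) := by
      refine (card_le_card (t := (A \ G) ∪ (X ∩ B)) fun v hv => ?_).trans (card_union_le _ _)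
      simp only [hA, mem_union, mem_sdiff, mem_compl, mem_inter] at hv ⊢
      tauto
    have h1' : (#(X \ G) : ℝ) ≤ #(A \ G) + #(X ∩ B) := by exact_mod_cast h1
    have h2 : (0 : ℝ) ≤ ρ * n := by positivity
    have h3 : 2 * (ρ * n) ≤ 4 * k * (ρ * n) := by nlinarith
    linarith
  · rw [hXGc, abs_le]
    have h1 : (r : ℝ) * (ρ * n) ≤ k * (ρ * n) := by gcongr
    have h2 : 2 * r * (#A - ρ * n) ≤ 2 * r * (#X : ℝ) := by
      have := hXcard.2
      gcongr
    have h3 : (0 : ℝ) ≤ k * (ρ * n) := by positivity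
    constructor <;> linarith
  · intro h hh
    have h1 := htransfer Y B (fun g => ¬ H.Joins h g) hYB'
    simp only [hG, mem_filter, mem_univ, true_and] at hh
    linarith
  · intro w hw
    have h1 := htransfer B Y (fun g => H.Joins w g) hBY'
    have hwX := (mem_sdiff.mp hw).1
    simp only [hX, mem_filter, mem_univ, true_and] at hwX
    have h2 : 2 * ε₀ * (n : ℝ) ^ (k - 1) ≤ ε₁ * (n : ℝ) ^ (k - 1) := by gcongr
    linarith
  -- By the codegree condition, a tuple through `y` that misses more than about `2 * ρ * n` vertices
  -- of `X` has neighbours in `Y` instead. The resulting edges lie in `Y` and contain `y`, so they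
  -- are few because `y` is not in `X`.
  · intro y hy q
    have h1 := H.count_pairs_not_joins_le (I := Rest k ℓ) X (β := 2 * (ρ * n)) (by positivity)
      (hZ X _ hXhi) (fun g => (∀ i, g i ∈ Y) ∧ g q = y)
    have h2 : (count (fun p : V × (Rest k ℓ → V) =>
        p.1 ∈ G ∧ (∀ i, p.2 i ∈ Y) ∧ p.2 q = y ∧ ¬ H.Joins p.1 p.2) : ℝ) ≤
        count (fun p : V × (Rest k ℓ → V) =>
          p.1 ∈ X ∧ ((∀ i, p.2 i ∈ Y) ∧ p.2 q = y) ∧ ¬ H.Joins p.1 p.2) :=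
      Nat.cast_le.mpr (count_mono fun p hp => ⟨hGX hp.1, ⟨hp.2.1, hp.2.2.1⟩, hp.2.2.2⟩)
    have h3 : (count (fun g : Rest k ℓ → V => (∀ i, g i ∈ Y) ∧ g q = y) : ℝ) ≤
        (n : ℝ) ^ (k - 1 - 1) := by
      have h4 : count (fun g : Rest k ℓ → V => (∀ i, g i ∈ Y) ∧ g q = y) ≤
          count (fun g : Rest k ℓ → V => g q = y) := count_mono fun g hg => hg.2
      rw [count_apply_eq, hcR] at h4
      exact_mod_cast h4
    have h4 : (count (fun g : Rest k ℓ → V => ((∀ i, g i ∈ Y) ∧ g q = y) ∧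
        ¬ Function.Injective g) : ℝ) ≤ (k : ℝ) ^ 2 / n * (n : ℝ) ^ (k - 1 - 1) := by
      have h5 := cast_count_not_injective_apply_eq_le q y
      rw [hcR] at h5
      refine (Nat.cast_le.mpr (count_mono fun g hg => ⟨hg.1.2, hg.2⟩)).trans (h5.trans ?_)
      have : ((k - 1 : ℕ) : ℝ) ≤ k := by exact_mod_cast Nat.sub_le k 1
      gcongr
    have h5 : (count (fun p : V × (Rest k ℓ → V) =>
        p.1 ∉ X ∧ ((∀ i, p.2 i ∈ Y) ∧ p.2 q = y) ∧ H.Joins p.1 p.2) : ℝ) ≤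
        2 * ε₁ * (n : ℝ) ^ (k - 1) :=
      (Nat.cast_le.mpr (count_mono fun p hp =>
        ⟨mem_compl.mpr hp.1, hp.2.1.1, hp.2.1.2, hp.2.2⟩)).trans (hsparse_at y hy q)
    have h6 : (n : ℝ) ^ (k - 1) = n * (n : ℝ) ^ (k - 1 - 1) := by
      rw [← pow_succ', Nat.sub_add_cancel (by omega)]
    have h7 : 2 * ρ ≤ ε₁ := by nlinarith
    calc _ ≤ 2 * (ρ * n) * (n : ℝ) ^ (k - 1 - 1) +
          n * ((k : ℝ) ^ 2 / n * (n : ℝ) ^ (k - 1 - 1)) + 2 * ε₁ * (n : ℝ) ^ (k - 1) := by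
          refine h2.trans (h1.trans ?_)
          gcongr
      _ = (2 * ρ + (k : ℝ) ^ 2 / n + 2 * ε₁) * (n : ℝ) ^ (k - 1) := by rw [h6]; ring
      _ ≤ _ := by
          gcongr
          linarith

end Extremal

/-! ### Choice of the constants. -/

section Constants

theorem exists_log_bound (a ε : ℝ) (ha : 0 < a) (hε : 0 < ε) :
    ∃ n₀ : ℕ, ∀ n : ℕ, n₀ ≤ n → Real.log (a * n) / n ≤ ε := by
  have h1 := Real.tendsto_pow_log_div_mul_add_atTop (1 / a) 0 1 (by positivity)
  have h2 : Filter.Tendsto (fun n : ℕ => a * (n : ℝ)) Filter.atTop Filter.atTop :=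
    tendsto_natCast_atTop_atTop.const_mul_atTop ha
  have h3 := (h1.comp h2).eventually (eventually_le_nhds hε)
  obtain ⟨n₀, hn₀⟩ := Filter.eventually_atTop.mp h3
  refine ⟨n₀, fun n hn => ?_⟩
  have h4 := hn₀ n hn
  simp only [Function.comp_apply, pow_one, add_zero] at h4
  have h5 : 1 / a * (a * (n : ℝ)) = n := by field_simp
  rwa [h5] at h4

set_option maxHeartbeats 4000000 in
/-- Extremal `k`-graphs of large codegree have Hamilton cycles. -/
theorem hasHamiltonCycle_of_extremal (k ℓ : ℕ) (hℓ : 1 ≤ ℓ) (hℓk : 2 * ℓ < k) :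
    ∃ Δ : ℝ, 0 < Δ ∧ ∃ n₀ : ℕ, ∀ (V : Type*) [Fintype V] [DecidableEq V] (H : KGraph V k),
      n₀ ≤ Fintype.card V → (k - ℓ) ∣ Fintype.card V → H.IsExtremal ℓ Δ →
      Fintype.card V ≤ 2 * (k - ℓ) * H.minDegree (k - 1) → H.HasHamiltonCycle ℓ := by
  have hk3 : (3 : ℝ) ≤ k := by exact_mod_cast (by omega : 3 ≤ k)
  have hk0 : (0 : ℝ) < k := by linarith
  -- The constants are fixed from large to small: `c`, then `q = c ^ k`, then `ε₁` of order `q ^ 2`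
  -- and `τ` of order `q`, then `ε₀` of order `τ * ε₁`, then `ρ` of order `ε₀`, then `μ` of order `ρ
  -- * ε₀`, with factors depending on `k` only. The partition is obtained with `2 * ε₀` and `δ = 4 *
  -- k * ρ`.
  obtain ⟨c, hc⟩ : ∃ c : ℝ, c = 1 / (4 * k) := ⟨_, rfl⟩
  have hc0 : 0 < c := by rw [hc]; positivity
  have hck : c * (4 * k) = 1 := by rw [hc]; field_simp
  have hc2 : c ≤ 1 / 2 := by nlinarith
  obtain ⟨q, hq⟩ : ∃ q : ℝ, q = c ^ k := ⟨_, rfl⟩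
  have hq0 : 0 < q := by rw [hq]; positivity
  have hqc : q ≤ c := by
    rw [hq]
    exact pow_le_of_le_one hc0.le (by linarith) (by omega)
  have hqp : q ≤ (1 / 2 : ℝ) ^ (k - 1) := by
    rw [hq]
    calc c ^ k ≤ (1 / 2 : ℝ) ^ k := pow_le_pow_left₀ hc0.le hc2 k
      _ ≤ _ := pow_le_pow_of_le_one (by norm_num) (by norm_num) (Nat.sub_le k 1)
  have hq1 : q ≤ 1 / 2 := hqc.trans hc2
  obtain ⟨ε₁, hε₁⟩ : ∃ ε₁ : ℝ, ε₁ * (1024 * (k : ℝ) ^ 2) = q ^ 2 :=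
    ⟨q ^ 2 / (1024 * (k : ℝ) ^ 2), div_mul_cancel₀ _ (by positivity)⟩
  have hk2 : 9 ≤ (k : ℝ) ^ 2 := by nlinarith
  have hk2' : 3 * (k : ℝ) ≤ (k : ℝ) ^ 2 := by nlinarith
  have hε₁0 : 0 < ε₁ := by
    have h1 : 0 < ε₁ * (1024 * (k : ℝ) ^ 2) := by rw [hε₁]; positivity
    exact pos_of_mul_pos_left h1 (by positivity)
  have hqq : q ^ 2 ≤ q / 2 := by nlinarith
  have hε₁k : ε₁ * (k : ℝ) ^ 2 ≤ q / 2048 := by linarith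
  have hε₁q : ε₁ ≤ q / 9216 := by nlinarith
  have hε₁l : 16 * ε₁ / q * (16 * k) ≤ q / 4 := by
    rw [div_mul_eq_mul_div, div_le_iff₀ hq0]
    nlinarith [mul_le_mul_of_nonneg_left hk2' hε₁0.le]
  obtain ⟨τ, hτ⟩ : ∃ τ : ℝ, τ * (16 * k) = q := ⟨q / (16 * k), div_mul_cancel₀ _ (by positivity)⟩
  have hτ0 : 0 < τ := by
    have h1 : 0 < τ * (16 * k) := by rw [hτ]; exact hq0
    exact pos_of_mul_pos_left h1 (by positivity)
  have hτ1 : τ ≤ 1 := by nlinarith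
  obtain ⟨ε₀, hε₀⟩ : ∃ ε₀ : ℝ, ε₀ = τ * ε₁ / 32 := ⟨_, rfl⟩
  have hε₀0 : 0 < ε₀ := by rw [hε₀]; positivity
  have hε₀τ : 2 * ε₀ / τ = ε₁ / 16 := by
    rw [hε₀]
    field_simp
    norm_num
  have hε₀ε₁ : ε₀ ≤ ε₁ / 32 := by
    rw [hε₀]
    have := mul_le_of_le_one_left hε₁0.le hτ1
    linarith
  obtain ⟨ρ, hρ⟩ : ∃ ρ : ℝ, ρ * (1000 * (k : ℝ) ^ 3) = ε₀ :=
    ⟨ε₀ / (1000 * (k : ℝ) ^ 3), div_mul_cancel₀ _ (by positivity)⟩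
  have hρ0 : 0 < ρ := by
    have h1 : 0 < ρ * (1000 * (k : ℝ) ^ 3) := by rw [hρ]; exact hε₀0
    exact pos_of_mul_pos_left h1 (by positivity)
  have hρ3 : ρ * (k : ℝ) ^ 3 = ε₀ / 1000 := by linarith
  have hρ2 : ρ * (k : ℝ) ^ 2 ≤ ε₀ / 3000 := by
    have h1 : 3 * (ρ * (k : ℝ) ^ 2) ≤ ρ * (k : ℝ) ^ 3 := by
      have : ρ * (k : ℝ) ^ 3 = k * (ρ * (k : ℝ) ^ 2) := by ring
      rw [this]
      gcongr
    linarith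
  have hρ1 : ρ * k ≤ ε₀ / 9000 := by
    have h1 : 3 * (ρ * k) ≤ ρ * (k : ℝ) ^ 2 := by
      have : ρ * (k : ℝ) ^ 2 = k * (ρ * k) := by ring
      rw [this]
      gcongr
    linarith
  have hρε : ρ ≤ ε₀ := by nlinarith
  obtain ⟨μ, hμ⟩ : ∃ μ : ℝ, μ = ρ * ε₀ / 2 := ⟨_, rfl⟩
  have hμ0 : 0 < μ := by rw [hμ]; positivity
  have hμε : μ ≤ ε₀ / 2 := by
    rw [hμ]
    have : ρ * ε₀ ≤ 1 * ε₀ := by gcongr; linarith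
    linarith
  -- `n₁` makes the logarithm of the number of tests negligible, and `n₂` makes `(1 + k ^ 2) / n` at
  -- most `μ`. In the hypothesis `hρ` of `exists_hubPartition` this term and the edge density in `B`
  -- each take half of `ρ * ε₀`.
  obtain ⟨n₁, hn₁⟩ := exists_log_bound (k + 1) (q / (64 * k)) (by positivity) (by positivity)
  obtain ⟨n₂, hn₂⟩ := exists_nat_gt ((1 + (k : ℝ) ^ 2) / μ)
  refine ⟨μ / (k : ℝ) ^ k, by positivity, max n₁ n₂, ?_⟩
  intro V _ _ H hn hdvd hext hdeg
  obtain ⟨B, hB, he⟩ := hext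
  have hnk : (1 + (k : ℝ) ^ 2) / Fintype.card V ≤ μ := by
    have h1 : (n₂ : ℝ) ≤ Fintype.card V := by exact_mod_cast (le_max_right _ _).trans hn
    have h2 : (1 + (k : ℝ) ^ 2) / μ ≤ Fintype.card V := hn₂.le.trans h1
    have h3 : (0 : ℝ) < (1 + (k : ℝ) ^ 2) / μ := by positivity
    rw [div_le_iff₀ (lt_of_lt_of_le h3 h2), mul_comm]
    exact (div_le_iff₀ hμ0).mp h2
  have hlog := hn₁ (Fintype.card V) ((le_max_left _ _).trans hn)
  have hnpos : (0 : ℝ) < Fintype.card V := by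
    have h1 : (n₂ : ℝ) ≤ Fintype.card V := by exact_mod_cast (le_max_right _ _).trans hn
    have h3 : (0 : ℝ) < (1 + (k : ℝ) ^ 2) / μ := by positivity
    linarith
  have : Nonempty V := Fintype.card_pos_iff.mp (by exact_mod_cast hnpos)
  have hnk' : (k : ℝ) ^ 2 / Fintype.card V ≤ μ := by
    refine le_trans ?_ hnk
    gcongr
    linarith
  have hkn : (k : ℝ) ^ 2 ≤ μ * Fintype.card V := (div_le_iff₀ hnpos).mp hnk'
  have hμ1 : μ ≤ 1 := by linarith
  have hn4 : 4 ≤ Fintype.card V := by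
    have h1 : μ * (Fintype.card V : ℝ) ≤ 1 * Fintype.card V := by gcongr
    have h2 : (4 : ℝ) ≤ Fintype.card V := by linarith
    exact_mod_cast h2
  obtain ⟨G, W, Y, hp⟩ := exists_hubPartition (H := H) hℓ hℓk (ε₀ := ε₀) (ε₁ := ε₁) (ρ := ρ) hB he
    hdeg hn4 (by
      rw [mul_div_cancel₀ _ (by positivity)]
      linarith) hε₀0 (by linarith) (by linarith) (by linarith) (by linarith) (by positivity)
    (by linarith)
  refine hp.hasHamiltonCycle hℓ hℓk hdvd (τ := τ) (c := c) ?_ ?_ (by positivity) hτ0 hε₁0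
    hε₀τ.le ?_ ?_ ?_ (by linarith) hc0 hck.le ?_ (hτ.trans hq).le ?_ ?_
  · linarith
  · linarith
  · nlinarith
  · rw [hε₀τ]
    linarith
  · rw [hε₀τ]
    linarith
  · rw [hε₀τ, ← hq]
    linarith
  · rw [← hq]
    have h1 : Real.log ((k + 1) * Fintype.card V) / Fintype.card V * (16 * k) ≤ q / 4 := by
      calc _ ≤ q / (64 * k) * (16 * k) := by gcongr
        _ = q / 4 := by field_simp; norm_num
    have h2 : 2 * (4 * k * ρ) * (16 * k) = 128 * (ρ * (k : ℝ) ^ 2) := by ring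
    linarith
  · have h1 : 16 * μ * (Fintype.card V : ℝ) < c * Fintype.card V := by
      gcongr
      linarith
    linarith

end Constants

end KGraph

theorem theorem1p5 (k ℓ : ℕ) (hk : 3 ≤ k) (hℓ : 1 ≤ ℓ) (hℓk : 2 * ℓ < k) :
    ∃ Δ : ℝ, 0 < Δ ∧ ∃ n₀ : ℕ,
      ∀ (V : Type*) [Fintype V] [DecidableEq V] (H : KGraph V k),
        n₀ ≤ Fintype.card V →
        (k - ℓ) ∣ Fintype.card V →
        H.IsExtremal ℓ Δ →
        (Fintype.card V : ℝ) / (2 * ((k : ℝ) - (ℓ : ℝ))) ≤ (H.minDegree (k - 1) : ℝ) →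
        H.HasHamiltonCycle ℓ := by
  obtain ⟨Δ, hΔ, n₀, h⟩ := KGraph.hasHamiltonCycle_of_extremal k ℓ hℓ hℓk
  refine ⟨Δ, hΔ, n₀, fun V _ _ H hn hdvd hext hdeg => h V H hn hdvd hext ?_⟩
  -- The degree condition is brought into the division-free form over the natural numbers; the
  -- truncated `k - ℓ` is the true difference since `ℓ < k`.
  have h1 : ((k - ℓ : ℕ) : ℝ) = (k : ℝ) - ℓ := Nat.cast_sub (by omega)
  have h2 : (0 : ℝ) < (k - ℓ : ℕ) := by exact_mod_cast (by omega : 0 < k - ℓ)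
  rw [← h1, div_le_iff₀ (by positivity)] at hdeg
  have h3 : (Fintype.card V : ℝ) ≤ 2 * (k - ℓ : ℕ) * H.minDegree (k - 1) := by linarith
  exact_mod_cast h3
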